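/- Let $M>0$ and consider the Schwarzschild exterior $\mathbb R_t\times]2M,\infty[_r\times\mathbb S^2$ with $F=1-2M/r$, $R=1/r$, $r_*=r+2M\log(r-2M)$, $u=t-r_*$, $v=t+r_*$, $L=\partial_t+\partial_{r_*}$, $\underline L=\partial_t-\partial_{r_*}$. For a field $\hat\phi_a$ of one-forms tangent to the spheres $\mathbb S^2_{(t,r)}$, let $|\hat\Phi|$ be its norm for the induced metric $\slashed g=r^2g_{\mathbb S^2}$, let $\slashed\nabla_{\partial_t},\slashed\nabla_{\partial_{r_*}},\slashed\nabla_L,\slashed\nabla_{\underline L}$ be the projected covariant derivatives, $\slashed\nabla_{\mathbb S^2}=r\slashed\nabla$, and $\slashed\Delta_{\mathbb S^2}=r^2\slashed\Delta$, where $\slashed\nabla$ and $\slashed\Delta$ are the Levi-Civita derivative and the covariant Laplacian of $\mathbb S^2_{(t,r)}$; $\mathrm d\mathbb S^2$ is the area element of the unit sphere. Let $\hat\phi_a$ be a smooth solution on the whole exterior of the rescaled tensorial Fackerell–Ipser equation $$\slashed\nabla_L\slashed\nabla_{\underline L}\hat\phi_a-FR^2\slashed\Delta_{\mathbb S^2}\hat\phi_a+(2MR+1)FR^2\hat\phi_a=0$$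 whose initial data $(\hat\phi_a,\slashed\nabla_{\partial_t}\hat\phi_a)$ on $\Sigma_0=\{t=0\}$ are compactly supported. (The field $\hat{\underline\phi}_a$ satisfies the same equation, so that everything below applies to it as well.) Put $W=R^2F|\slashed\nabla_{\mathbb S^2}\hat\Phi|^2+(2MR+1)R^2F|\hat\Phi|^2$, $$\mathcal E_{\Sigma_0}(\hat\Phi)=4\int_{\Sigma_0}\left(|\slashed\nabla_{\partial_t}\hat\Phi|^2+|\slashed\nabla_{\partial_{r_*}}\hat\Phi|^2+W\right)\mathrm dr_*\,\mathrm d\mathbb S^2,$$ $$\mathcal E_{\mathcal H_{u_T}}(\hat\Phi)=2\int_{v_T}^{2v_T}\!\!\int_{\mathbb S^2}\left(|\slashed\nabla_L\hat\Phi|^2+W\right)\Big|_{u=u_T}\mathrm d\mathbb S^2\,\mathrm dv,\qquad \mathcal E_{\mathcal I_{v_T}}(\hat\Phi)=2\int_{u_T}^{2u_T}\!\!\int_{\mathbb S^2}\left(|\slashed\nabla_{\underline L}\hat\Phi|^2+W\right)\Big|_{v=v_T}\mathrm d\mathbb S^2\,\mathrm du .$$ Then $\slashed\nabla_L\hat\Phi$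 extends continuously to the future horizon $\mathfrak H^+=\mathbb R_v\times\mathbb S^2$ ($u\to\infty$), and $\slashed\nabla_{\underline L}\hat\Phi$ to future null infinity $\mathscr I^+=\mathbb R_u\times\mathbb S^2$ ($v\to\infty$); here the tangent space of $\mathbb S^2_{(t,r)}$ with the metric $\slashed g$ is identified isometrically with that of the unit sphere, through division of tangent vectors of the unit sphere by $r$. The squared norms of these traces are integrable, the limits $$\mathcal E_{\mathfrak H^+}(\hat\Phi)=\lim_{v_T\to\infty}2\int_{-\infty}^{v_T}\!\!\int_{\mathbb S^2}\left|\slashed\nabla_L\hat\Phi|_{\mathfrak H^+}\right|^2\mathrm d\mathbb S^2\,\mathrm dv,\qquad \mathcal E_{\mathscr I^+}(\hat\Phi)=\lim_{u_T\to\infty}2\int_{-\infty}^{u_T}\!\!\int_{\mathbb S^2}\left|\slashed\nabla_{\underline L}\hat\Phi|_{\mathscr I^+}\right|^2\mathrm d\mathbb S^2\,\mathrm du$$ exist and are finite, and $$\mathcal E_{\mathscr I^+}(\hat\Phi)+\mathcal E_{\mathfrak H^+}(\hat\Phi)\le\mathcal E_{\Sigma_0}(\hat\Phi),$$ with equality if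 and only if $\displaystyle\lim_{u_T,v_T\to\infty}\left(\mathcal E_{\mathcal H_{u_T}}(\hat\Phi)+\mathcal E_{\mathcal I_{v_T}}(\hat\Phi)\right)=0$, where $u_T$ and $v_T$ tend to infinity independently. -/

import Mathlib

open Filter Topology MeasureTheory


noncomputable section

namespace Schwarzschild

/-! ### The exterior of the Schwarzschild black hole -/

/-- The Regge-Wheeler coordinate `r_* = r + 2 M log (r - 2 M)`, for `r > 2 M`. -/
def tortoise (M r : ℝ) : ℝ := r + 2 * M * Real.log (r - 2 * M)

/-- The area radius `r > 2 M` as a function of the Regge-Wheeler coordinate `r_*`. -/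
def radius (M x : ℝ) : ℝ := Function.invFunOn (tortoise M) (Set.Ioi (2 * M)) x

theorem tortoise_strictMonoOn {M : ℝ} (hM : 0 < M) :
    StrictMonoOn (tortoise M) (Set.Ioi (2 * M)) := by
  intro a ha b _ hab
  have ha' : 2 * M < a := ha
  have : Real.log (a - 2 * M) < Real.log (b - 2 * M) :=
    Real.log_lt_log (by linarith) (by linarith)
  unfold tortoise
  nlinarith

theorem tortoise_surjOn {M : ℝ} (hM : 0 < M) :
    Set.SurjOn (tortoise M) (Set.Ioi (2 * M)) Set.univ := by
  intro y _
  -- work with `s = log (r - 2 M)`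
  have hc : Continuous fun s : ℝ => 2 * M + Real.exp s + 2 * M * s := by fun_prop
  have htop : Tendsto (fun s : ℝ => 2 * M + Real.exp s + 2 * M * s) atTop atTop := by
    refine tendsto_atTop_mono' _ ?_ (tendsto_id.const_mul_atTop (by linarith : 0 < 2 * M))
    filter_upwards with s
    have := Real.exp_pos s
    simp only [id]
    linarith
  have hbot : Tendsto (fun s : ℝ => 2 * M + Real.exp s + 2 * M * s) atBot atBot := by
    refine tendsto_atBot_mono' _ ?_ (tendsto_atBot_add_const_left _ (2 * M + 1)
      (tendsto_id.const_mul_atBot (by linarith : 0 < 2 * M)))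
    filter_upwards [eventually_le_atBot (0 : ℝ)] with s hs
    have := Real.exp_le_one_iff.2 hs
    simp only [id]
    linarith
  obtain ⟨s, hs⟩ := hc.surjective htop hbot y
  refine ⟨2 * M + Real.exp s, ?_, ?_⟩
  · have := Real.exp_pos s
    simp only [Set.mem_Ioi]
    linarith
  · simpa [tortoise] using hs

/-- `radius M x` lies outside the black hole. -/
theorem two_mul_lt_radius {M : ℝ} (hM : 0 < M) (x : ℝ) : 2 * M < radius M x :=
  Function.invFunOn_mem (tortoise_surjOn hM (Set.mem_univ x))

/-- `radius M` inverts the Regge-Wheeler coordinate. -/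
theorem tortoise_radius {M : ℝ} (hM : 0 < M) (x : ℝ) : tortoise M (radius M x) = x :=
  Function.invFunOn_eq (tortoise_surjOn hM (Set.mem_univ x))

theorem radius_tortoise {M : ℝ} (hM : 0 < M) {r : ℝ} (hr : 2 * M < r) :
    radius M (tortoise M r) = r :=
  (tortoise_strictMonoOn hM).injOn (two_mul_lt_radius hM _) hr (tortoise_radius hM _)

/-- `R = 1 / r` at the point with Regge-Wheeler coordinate `x`. -/
def R (M x : ℝ) : ℝ := 1 / radius M x

/-- `F = 1 - 2 M / r` at the point with Regge-Wheeler coordinate `x`. -/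
def F (M x : ℝ) : ℝ := 1 - 2 * M / radius M x

/-! ### Tangential fields on the unit sphere -/

/-- Euclidean three-space. -/
abbrev E3 : Type := EuclideanSpace ℝ (Fin 3)

/-- The unit sphere of Euclidean three-space. -/
abbrev S2 : Type := Metric.sphere (0 : E3) 1

/-- The area measure of the unit sphere, of total mass `4 π`. -/
def area : Measure S2 := (volume : Measure E3).toSphere

/-- The extension of a map on the unit sphere that is constant along rays from the origin. -/
def radialExt (X : S2 → E3) (x : E3) : E3 :=
  if h : x = 0 then 0
  else X ⟨‖x‖⁻¹ • x, by
    rw [mem_sphere_zero_iff_norm, norm_smul, norm_inv, norm_norm,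
      inv_mul_cancel₀ (norm_ne_zero_iff.2 h)]⟩

/-- The orthogonal projection of `w` onto the plane orthogonal to `x ≠ 0`. -/
def tangentProj (x w : E3) : E3 := w - (inner ℝ x w / ‖x‖ ^ 2) • x

/-- The Levi-Civita derivative, in the direction `w`, of the tangential field `X` on the unit
sphere: the tangential part of the Euclidean derivative. At `x` on the sphere it vanishes for `w`
normal to the sphere, as the extension is constant along rays. -/
def sphereCovDeriv (X : S2 → E3) (x w : E3) : E3 :=
  tangentProj x (fderiv ℝ (radialExt X) x w)

/-- The pointwise square norm `|∇ X|²` of the covariant derivative on the unit sphere. -/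
def sphereGradSq (X : S2 → E3) (ω : S2) : ℝ :=
  ∑ i : Fin 3, ‖sphereCovDeriv X ω (EuclideanSpace.single i 1)‖ ^ 2

/-- The covariant (connection) Laplacian of the unit sphere on tangential fields, that is the trace
of the second covariant derivative. -/
def sphereLaplacian (X : S2 → E3) (ω : S2) : E3 :=
  tangentProj ω (∑ i : Fin 3,
    fderiv ℝ (fun x : E3 => sphereCovDeriv X x (EuclideanSpace.single i 1)) ω
      (EuclideanSpace.single i 1))

/-! ### Fields of one-forms on the orbit spheres

A field `Φ t x ω` is a function of the time `t`, of the Regge-Wheeler coordinate `x = r_*` and of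
the point `ω` of the unit sphere. The orbit sphere at `(t, r)` is the round sphere of radius `r` in
Euclidean space; its tangent plane at `r ω` is the plane orthogonal to `ω`, and its metric is the
Euclidean one. A one-form on the orbit sphere is recorded by its metric dual vector, which is
orthogonal to `ω`. In this way the norm for the metric of the orbit sphere is the Euclidean norm,
and the projected covariant derivatives along `∂_t` and `∂_{r_*}` are the derivatives of the
vector-valued function `Φ` (a frame that is orthonormal for the metrics of the orbit spheres and
does not depend on `t` and `r` as a frame of vectors of Euclidean space is parallel along these
directions). -/

/-- A field on the exterior of the black hole. -/
abbrev Field : Type := ℝ → ℝ → S2 → E3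

/-- The projected covariant derivative along `∂_t`. -/
def Dt (Φ : Field) : Field := fun t x ω => deriv (fun s => Φ s x ω) t

/-- The projected covariant derivative along `∂_{r_*}`. -/
def Dx (Φ : Field) : Field := fun t x ω => deriv (fun y => Φ t y ω) x

/-- The projected covariant derivative along the outgoing direction `L = ∂_t + ∂_{r_*}`. -/
def DL (Φ : Field) : Field := fun t x ω => Dt Φ t x ω + Dx Φ t x ω

/-- The projected covariant derivative along the incoming direction `∂_t - ∂_{r_*}`. -/
def DLbar (Φ : Field) : Field := fun t x ω => Dt Φ t x ω - Dx Φ t x ω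

/-- `Φ` is a smooth field of one-forms on the exterior of the black hole that solves the rescaled
tensorial Fackerell-Ipser equation of mass `M`. -/
structure IsSolution (M : ℝ) (Φ : Field) : Prop where
  tangential : ∀ t x (ω : S2), inner ℝ (ω : E3) (Φ t x ω) = 0
  smooth : ContDiffOn ℝ ((⊤ : ℕ∞) : WithTop ℕ∞) (fun p : ℝ × ℝ × E3 => radialExt (Φ p.1 p.2.1) p.2.2)
    {p | p.2.2 ≠ 0}
  equation : ∀ t x ω,
    DL (DLbar Φ) t x ω - (F M x * R M x ^ 2) • sphereLaplacian (Φ t x) ω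
      + ((2 * M * R M x + 1) * F M x * R M x ^ 2) • Φ t x ω = 0

/-- The initial data `(Φ, ∂_t Φ)` on `Σ₀ = {t = 0}` have compact support. -/
def HasCompactData (Φ : Field) : Prop :=
  HasCompactSupport (fun p : ℝ × S2 => Φ 0 p.1 p.2) ∧
    HasCompactSupport (fun p : ℝ × S2 => Dt Φ 0 p.1 p.2)

/-! ### Energies -/

/-- The density `R² F |∇_{S²} Φ|² + (2 M R + 1) R² F |Φ|²`. -/
def potentialDensity (M : ℝ) (Φ : Field) (t x : ℝ) (ω : S2) : ℝ :=
  R M x ^ 2 * F M x * sphereGradSq (Φ t x) ω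
    + (2 * M * R M x + 1) * R M x ^ 2 * F M x * ‖Φ t x ω‖ ^ 2

/-- The energy on `Σ₀ = {t = 0}`. -/
def initialEnergy (M : ℝ) (Φ : Field) : ℝ :=
  4 * ∫ x : ℝ, ∫ ω, (‖Dt Φ 0 x ω‖ ^ 2 + ‖Dx Φ 0 x ω‖ ^ 2 + potentialDensity M Φ 0 x ω) ∂area

/-- The value of `f` at the point with `t - r_* = u` and `t + r_* = v`. -/
def atNull {α : Type} (f : ℝ → ℝ → S2 → α) (u v : ℝ) (ω : S2) : α :=
  f ((u + v) / 2) ((v - u) / 2) ω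

/-- The energy flux through `{u = uT, vT ≤ v ≤ 2 vT}`. -/
def outgoingFlux (M : ℝ) (Φ : Field) (uT vT : ℝ) : ℝ :=
  2 * ∫ v in vT..2 * vT, ∫ ω,
    (‖atNull (DL Φ) uT v ω‖ ^ 2 + atNull (potentialDensity M Φ) uT v ω) ∂area

/-- The energy flux through `{v = vT, uT ≤ u ≤ 2 uT}`. -/
def incomingFlux (M : ℝ) (Φ : Field) (uT vT : ℝ) : ℝ :=
  2 * ∫ u in uT..2 * uT, ∫ ω,
    (‖atNull (DLbar Φ) u vT ω‖ ^ 2 + atNull (potentialDensity M Φ) u vT ω) ∂area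

/-- `h` is the restriction to the future horizon `ℝ_v × S²` (the boundary `u → ∞`) of the
continuous extension of `Ψ` to it. -/
def IsHorizonTrace (Ψ : Field) (h : ℝ → S2 → E3) : Prop :=
  ∀ v ω, Tendsto (fun p : ℝ × ℝ × S2 => atNull Ψ p.1 p.2.1 p.2.2)
    (atTop ×ˢ 𝓝 (v, ω)) (𝓝 (h v ω))

/-- `h` is the restriction to future null infinity `ℝ_u × S²` (the boundary `v → ∞`) of the
continuous extension of `Ψ` to it. -/
def IsScriTrace (Ψ : Field) (h : ℝ → S2 → E3) : Prop :=
  ∀ u ω, Tendsto (fun p : ℝ × ℝ × S2 => atNull Ψ p.2.1 p.1 p.2.2)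
    (atTop ×ˢ 𝓝 (u, ω)) (𝓝 (h u ω))

/-- The flux `2 ∫_{τ ≤ T} ∫_{S²} |h|²` of a boundary trace through the part `{τ ≤ T}` of the
boundary, where the null coordinate `τ` is `v` on the horizon and `u` on null infinity. -/
def boundaryFlux (h : ℝ → S2 → E3) (T : ℝ) : ℝ :=
  2 * ∫ τ in Set.Iic T, ∫ ω, ‖h τ ω‖ ^ 2 ∂area

end Schwarzschild

end

noncomputable section
namespace Schwarzschild

/-! ### The radial weights -/

section Weights

variable {M : ℝ}

/-! For compactly supported data no energy is lost, so both sides of the equivalence hold for every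
such solution and the inequality is an equality.

The field is extended to `y ≠ 0` in Euclidean space, homogeneous of degree zero. Counting all
Euclidean derivatives of the components absorbs the extra `1` in `2MR + 1` (`Wave`). The sphere
integrals of its quadratic expressions form a `Profile`, and the conservation law `∂_t e = 2 ∂_x m`
gives a potential `E` with `dE = 2m dt + e dx` (`exists_potential`). As `|2m| ≤ e`, `E` is monotone
along null lines. This yields finite speed of propagation, and turns the initial energy and all null
fluxes into 4 times differences of values of `E`.

Traces: in null coordinates the transverse derivative of `∂_t Φ ± ∂_{r_*} Φ` is half the wave
operator. By the equation it is `V₁`, of size `O((1 + |r_*|)⁻²)`, times the field and its angular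
derivatives. Energy and finite speed bound the sphere norm by a multiple of `√(1 + |t|)`. Rotations
commute with the equation, so a Sobolev inequality gives the same growth pointwise for the field and
its first and second angular derivatives. Along a null line the transverse derivative is then
`O(σ^(-3/2))`, which is integrable, and the potential part of the flux tends to zero
(`Wave.exists_trace`).

Decay: the multiplier `1 - 3M/r`, which vanishes at the photon sphere, controls the spacetime
integral of `F R³ |Φ|²` (`integral_decayWeight_q0_le`). Applied to the solution `∂_t Φ` it controls
`F R³ |∂_t Φ|²`, and a virial identity then controls the angular derivatives
(`integral_decayWeight_qy_le`). These absorb the bulk error of the dilation field `(t + R₀) ∂_t +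
r_* ∂_{r_*}` (`integral_dilation_le`). Hence at time `T` the energy between the cones `u = U` and `v
= V` is `O(1 / min U V)` (`energy_between_cones_le`). This makes the auxiliary null fluxes tend to
zero and shows that all the initial energy reaches the horizon or null infinity. -/

theorem sub_le_tortoise_sub (hM : 0 < M) {a b : ℝ} (ha : 2 * M < a) (hab : a ≤ b) :
    b - a ≤ tortoise M b - tortoise M a := by
  have h : Real.log (a - 2 * M) ≤ Real.log (b - 2 * M) :=
    Real.log_le_log (by linarith) (by linarith)
  unfold tortoise
  nlinarith

theorem strictMono_radius (hM : 0 < M) : StrictMono (radius M) := by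
  intro x y hxy
  by_contra! h
  have := sub_le_tortoise_sub hM (two_mul_lt_radius hM y) h
  rw [tortoise_radius hM, tortoise_radius hM] at this
  linarith

/-- The Regge-Wheeler coordinate expands distances, so its inverse is 1-Lipschitz. Continuity is
what the derivative rule for inverse functions requires in `hasDerivAt_radius`. -/
theorem continuous_radius (hM : 0 < M) : Continuous (radius M) := by
  have key : ∀ x y, x ≤ y → |radius M y - radius M x| ≤ |y - x| := by
    intro x y hxy
    have h1 := (strictMono_radius hM).monotone hxy
    have := sub_le_tortoise_sub hM (two_mul_lt_radius hM x) h1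
    rw [tortoise_radius hM, tortoise_radius hM] at this
    rw [abs_of_nonneg (by linarith), abs_of_nonneg (by linarith)]
    exact this
  refine (LipschitzWith.of_dist_le_mul (K := 1) fun x y => ?_).continuous
  rw [NNReal.coe_one, one_mul, Real.dist_eq, Real.dist_eq]
  rcases le_total x y with h | h
  · rw [abs_sub_comm, abs_sub_comm x]
    exact key x y h
  · exact key y x h

theorem radius_pos (hM : 0 < M) (x : ℝ) : 0 < radius M x := by
  linarith [two_mul_lt_radius hM x]

theorem F_pos (hM : 0 < M) (x : ℝ) : 0 < F M x := by
  unfold F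
  rw [sub_pos, div_lt_one (radius_pos hM x)]
  exact two_mul_lt_radius hM x

theorem R_pos (hM : 0 < M) (x : ℝ) : 0 < R M x := one_div_pos.2 (radius_pos hM x)

theorem F_eq (M x : ℝ) : F M x = 1 - 2 * M * R M x := by
  unfold F R
  ring

theorem hasDerivAt_radius (hM : 0 < M) (x : ℝ) : HasDerivAt (radius M) (F M x) x := by
  have hr := two_mul_lt_radius hM x
  have hp := radius_pos hM x
  have h1 : HasDerivAt (tortoise M) (F M x)⁻¹ (radius M x) := by
    have h2 := ((hasDerivAt_id (radius M x)).sub_const (2 * M)).log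
      (by change radius M x - 2 * M ≠ 0; linarith)
    have h3 := (hasDerivAt_id (radius M x)).add (h2.const_mul (2 * M))
    refine h3.congr_deriv ?_
    have h4 : radius M x - 2 * M ≠ 0 := by linarith
    have h5 : F M x = (radius M x - 2 * M) / radius M x := by
      unfold F
      field_simp
    rw [h5]
    simp only [id]
    field_simp
    ring
  exact h1.of_local_left_inverse (continuous_radius hM).continuousAt
    (inv_ne_zero (F_pos hM x).ne') (Eventually.of_forall fun y => tortoise_radius hM y)
    |>.congr_deriv (inv_inv _)

theorem hasDerivAt_R (hM : 0 < M) (x : ℝ) :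
    HasDerivAt (R M) (-(R M x ^ 2 * (1 - 2 * M * R M x))) x := by
  have h := (hasDerivAt_radius hM x).inv (radius_pos hM x).ne'
  have e : R M = (radius M)⁻¹ := by
    funext y
    simp [R]
  rw [← F_eq, e]
  exact h.congr_deriv (by simp only [Pi.inv_apply]; ring)

theorem continuous_R (hM : 0 < M) : Continuous (R M) :=
  continuous_iff_continuousAt.2 fun x => (hasDerivAt_R hM x).continuousAt

/-- `R` solves an autonomous equation with polynomial right-hand side, so each order of regularity
yields the next. -/
theorem contDiff_R (hM : 0 < M) (n : ℕ) : ContDiff ℝ n (R M) := by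
  induction n with
  | zero => exact contDiff_zero.2 (continuous_R hM)
  | succ n ih =>
    have hd : deriv (R M) = fun x => -(R M x ^ 2 * (1 - 2 * M * R M x)) :=
      funext fun x => (hasDerivAt_R hM x).deriv
    push_cast
    refine contDiff_succ_iff_deriv.2 ⟨fun x => (hasDerivAt_R hM x).differentiableAt, by simp, ?_⟩
    rw [hd]
    exact ((ih.pow 2).mul (contDiff_const.sub (contDiff_const.mul ih))).neg

theorem two_mul_R_lt_one (hM : 0 < M) (x : ℝ) : 2 * M * R M x < 1 := by
  have := F_pos hM x
  rw [F_eq] at this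
  linarith

/-- The weight `F R²` of the angular part of the wave operator. -/
def V₁ (M x : ℝ) : ℝ := R M x ^ 2 * (1 - 2 * M * R M x)

/-- The weight `2 M F R³` of the zeroth order part of the wave operator. -/
def V₃ (M x : ℝ) : ℝ := 2 * M * R M x ^ 3 * (1 - 2 * M * R M x)

theorem V₁_pos (hM : 0 < M) (x : ℝ) : 0 < V₁ M x :=
  mul_pos (pow_pos (R_pos hM x) 2) (by linarith [two_mul_R_lt_one hM x])

theorem V₃_pos (hM : 0 < M) (x : ℝ) : 0 < V₃ M x :=
  mul_pos (by have := R_pos hM x; positivity) (by linarith [two_mul_R_lt_one hM x])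

/-- The derivative of a polynomial in `R`, for `p'` the derivative of `p`. -/
theorem hasDerivAt_comp_R (hM : 0 < M) {p : ℝ → ℝ} {p' : ℝ} {x : ℝ}
    (hp : HasDerivAt p p' (R M x)) :
    HasDerivAt (fun x => p (R M x)) (-(p' * V₁ M x)) x := by
  have := hp.comp x (hasDerivAt_R hM x)
  refine this.congr_deriv ?_
  unfold V₁
  ring

/-- With `s = √(r - 2M)`, the logarithm in `r_*` is at most `2(s + 1/s)` in absolute value. It then
suffices that `V₁ = (r - 2M)/r³` stays bounded after multiplication by `1`, `r²` and `(s + 1/s)²`.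
The factor `r - 2M` compensates the `1/s²` at the horizon. -/
theorem sq_abs_mul_V₁_le (hM : 0 < M) :
    ∃ C : ℝ, 0 < C ∧ ∀ x, V₁ M x ≤ C / (1 + |x|) ^ 2 := by
  -- The factor 3 is from `(a + b + c)² ≤ 3(a² + b² + c²)`; the three summands are the bounds `e1`,
  -- `e2`, `e3` below.
  refine ⟨3 * (1 / (4 * M ^ 2) + 1 + 16 * M ^ 2 *
    (1 / (2 * M) + 2 / (4 * M ^ 2) + 1 / (8 * M ^ 3))), by positivity, fun x => ?_⟩
  rw [le_div_iff₀ (by positivity)]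
  have hr := two_mul_lt_radius hM x
  have hp := radius_pos hM x
  have hz : 0 < radius M x - 2 * M := by linarith
  have hx := tortoise_radius hM x
  set r := radius M x with hrdef
  set s := Real.sqrt (r - 2 * M) with hs
  have hs0 : 0 < s := Real.sqrt_pos.2 hz
  have hss : s ^ 2 = r - 2 * M := Real.sq_sqrt hz.le
  have hlog : |Real.log (r - 2 * M)| ≤ 2 * (s + 1 / s) := by
    have h1 : Real.log (r - 2 * M) = 2 * Real.log s := by
      rw [← hss, Real.log_pow]
      norm_num
    have h2 := Real.log_le_sub_one_of_pos hs0
    have h3 := Real.one_sub_inv_le_log_of_pos hs0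
    have h4 : 0 < 1 / s := by positivity
    rw [inv_eq_one_div] at h3
    rw [h1, abs_le]
    constructor <;> linarith
  have hxle : |x| ≤ r + 4 * M * (s + 1 / s) := by
    rw [← hx]
    unfold tortoise
    refine (abs_add_le _ _).trans ?_
    rw [abs_mul, abs_of_pos hp, abs_of_pos (by linarith : 0 < 2 * M)]
    nlinarith
  have hsq : (1 + |x|) ^ 2 ≤ 3 * (1 + r ^ 2 + 16 * M ^ 2 * (s + 1 / s) ^ 2) := by
    have h0 : (1 + |x|) ^ 2 ≤ (1 + r + 4 * M * (s + 1 / s)) ^ 2 := by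
      exact pow_le_pow_left₀ (by positivity) (by linarith) 2
    nlinarith [sq_nonneg (1 - r), sq_nonneg (1 - 4 * M * (s + 1 / s)),
      sq_nonneg (r - 4 * M * (s + 1 / s))]
  have hinv : (s + 1 / s) ^ 2 = (r - 2 * M) + 2 + 1 / (r - 2 * M) := by
    rw [← hss]
    field_simp
    ring
  have hV : V₁ M x = (r - 2 * M) / r ^ 3 := by
    unfold V₁ R
    rw [← hrdef]
    field_simp
  have hV0 := V₁_pos hM x
  have e1 : V₁ M x ≤ 1 / (4 * M ^ 2) := by
    rw [hV, div_le_div_iff₀ (by positivity) (by positivity)]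
    have : (2 * M) ^ 2 ≤ r ^ 2 := by gcongr
    nlinarith [pow_pos hp 2]
  have e2 : V₁ M x * r ^ 2 ≤ 1 := by
    rw [hV, div_mul_eq_mul_div, div_le_one (by positivity)]
    nlinarith [pow_pos hp 2]
  have e3 : V₁ M x * (s + 1 / s) ^ 2 ≤
      1 / (2 * M) + 2 / (4 * M ^ 2) + 1 / (8 * M ^ 3) := by
    have h1 : V₁ M x * (s + 1 / s) ^ 2 = (r - 2 * M + 1) ^ 2 / r ^ 3 := by
      rw [hV, hinv]
      have := hz.ne'
      field_simp
      ring
    have h2 : (r - 2 * M + 1) ^ 2 / r ^ 3 ≤ (r + 1) ^ 2 / r ^ 3 := by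
      gcongr
      linarith
    have h3 : (r + 1) ^ 2 / r ^ 3 = 1 / r + 2 / r ^ 2 + 1 / r ^ 3 := by
      field_simp
      ring
    have h4 : 1 / r ≤ 1 / (2 * M) := by gcongr
    have h5 : 2 / r ^ 2 ≤ 2 / (4 * M ^ 2) := by
      have : 4 * M ^ 2 = (2 * M) ^ 2 := by ring
      rw [this]
      gcongr
    have h6 : 1 / r ^ 3 ≤ 1 / (8 * M ^ 3) := by
      have : 8 * M ^ 3 = (2 * M) ^ 3 := by ring
      rw [this]
      gcongr
    linarith
  have hM2 : 0 < 16 * M ^ 2 := by positivity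
  calc V₁ M x * (1 + |x|) ^ 2
      ≤ V₁ M x * (3 * (1 + r ^ 2 + 16 * M ^ 2 * (s + 1 / s) ^ 2)) := by gcongr
    _ = 3 * (V₁ M x + V₁ M x * r ^ 2 + 16 * M ^ 2 * (V₁ M x * (s + 1 / s) ^ 2)) := by ring
    _ ≤ _ := by gcongr

/-- Only the compact interval between the two thresholds matters, and there the continuous quotient
`b / w` is bounded. -/
theorem exists_le_mul_of_nonpos_outside {b w : ℝ → ℝ} (hb : Continuous b) (hw : Continuous w)
    (hpos : ∀ x, 0 < w x) {lo hi : ℝ} (hlo : ∀ x ≤ lo, b x ≤ 0) (hhi : ∀ x, hi ≤ x → b x ≤ 0) :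
    ∃ C : ℝ, 0 < C ∧ ∀ x, b x ≤ C * w x := by
  obtain ⟨C, hC⟩ := (isCompact_Icc (a := lo) (b := hi)).exists_bound_of_continuousOn
    (f := fun x => b x / w x) ((hb.div hw fun x => (hpos x).ne').continuousOn)
  refine ⟨max C 1, by positivity, fun x => ?_⟩
  have h1 : 0 < max C 1 * w x := mul_pos (by positivity) (hpos x)
  rcases le_total x lo with h | h
  · exact (hlo x h).trans h1.le
  rcases le_total hi x with h' | h'
  · exact (hhi x h').trans h1.le
  · have := (le_abs_self _).trans (hC x ⟨h, h'⟩)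
    rw [div_le_iff₀ (hpos x)] at this
    exact this.trans (mul_le_mul_of_nonneg_right (le_max_left _ _) (hpos x).le)

/-- The weights produced by the dilation field `x ∂_x` are positive in a bounded range of `x`
only. -/
theorem dilation_weights_le (hM : 0 < M) : ∃ C : ℝ, 0 < C ∧ ∀ x,
    2 - x * (2 * R M x - 6 * M * R M x ^ 2) ≤ C * (R M x ^ 3 * (1 - 2 * M * R M x)) ∧
    2 - x * (3 * R M x - 8 * M * R M x ^ 2) ≤ C * (R M x ^ 3 * (1 - 2 * M * R M x)) := by
  have hRc := continuous_R hM
  have hw : Continuous fun x => R M x ^ 3 * (1 - 2 * M * R M x) := by fun_prop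
  have hwpos : ∀ x, 0 < R M x ^ 3 * (1 - 2 * M * R M x) := fun x =>
    mul_pos (pow_pos (R_pos hM x) 3) (by linarith [two_mul_R_lt_one hM x])
  have hrR : ∀ x, radius M x * R M x = 1 := fun x => by
    unfold R
    exact mul_one_div_cancel (radius_pos hM x).ne'
  -- near the horizon
  have hlo : ∀ x ≤ min (tortoise M (12 / 5 * M)) (-(15 * M)),
      5 / 12 ≤ M * R M x ∧ 6 ≤ -x * R M x := by
    intro x hx
    have h1 : radius M x ≤ 12 / 5 * M := by
      have := (strictMono_radius hM).monotone (hx.trans (min_le_left _ _))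
      rwa [radius_tortoise hM (by linarith)] at this
    have h2 := hx.trans (min_le_right _ _)
    have h3 := R_pos hM x
    have h4 := hrR x
    have h5 : 5 / 12 ≤ M * R M x := by nlinarith
    exact ⟨h5, by nlinarith⟩
  -- near infinity
  have hhi : ∀ x, tortoise M (8 * M + Real.exp 3) ≤ x →
      M * R M x ≤ 1 / 8 ∧ 1 + 6 * M * R M x ≤ x * R M x := by
    intro x hx
    have he := Real.exp_pos 3
    have h1 : 8 * M + Real.exp 3 ≤ radius M x := by
      have := (strictMono_radius hM).monotone hx
      rwa [radius_tortoise hM (by linarith)] at this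
    have h3 := R_pos hM x
    have h4 := hrR x
    have h5 : M * R M x ≤ 1 / 8 := by nlinarith
    refine ⟨h5, ?_⟩
    -- The value 3 makes the logarithmic part of `r_*` at least `6M`.
    have h6 : 3 ≤ Real.log (radius M x - 2 * M) := by
      rw [← Real.log_exp 3]
      exact Real.log_le_log he (by linarith)
    have h7 : radius M x + 6 * M ≤ x := by
      conv_rhs => rw [← tortoise_radius hM x]
      unfold tortoise
      nlinarith
    nlinarith
  -- Write `y = MR`. Near the horizon `y ≥ 5/12` gives `2 - 6y ≤ -1/2` and `3 - 8y ≤ -1/3`, and `-xR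
  -- ≥ 6` makes each product at most `-2`. Near infinity `(1 + 6y)(2 - 6y)` and `(1 + 6y)(3 - 8y)`
  -- are at least 2 for `0 < y ≤ 1/8`.
  obtain ⟨C₁, hC₁, h₁⟩ := exists_le_mul_of_nonpos_outside
    (b := fun x => 2 - x * (2 * R M x - 6 * M * R M x ^ 2)) (by fun_prop) hw hwpos
    (lo := min (tortoise M (12 / 5 * M)) (-(15 * M))) (hi := tortoise M (8 * M + Real.exp 3))
    (fun x hx => by
      obtain ⟨a, b⟩ := hlo x hx
      show 2 - x * (2 * R M x - 6 * M * R M x ^ 2) ≤ 0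
      nlinarith) (fun x hx => by
      obtain ⟨a, b⟩ := hhi x hx
      have := R_pos hM x
      show 2 - x * (2 * R M x - 6 * M * R M x ^ 2) ≤ 0
      nlinarith [mul_pos hM this])
  obtain ⟨C₂, hC₂, h₂⟩ := exists_le_mul_of_nonpos_outside
    (b := fun x => 2 - x * (3 * R M x - 8 * M * R M x ^ 2)) (by fun_prop) hw hwpos
    (lo := min (tortoise M (12 / 5 * M)) (-(15 * M))) (hi := tortoise M (8 * M + Real.exp 3))
    (fun x hx => by
      obtain ⟨a, b⟩ := hlo x hx
      show 2 - x * (3 * R M x - 8 * M * R M x ^ 2) ≤ 0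
      nlinarith) (fun x hx => by
      obtain ⟨a, b⟩ := hhi x hx
      have := R_pos hM x
      show 2 - x * (3 * R M x - 8 * M * R M x ^ 2) ≤ 0
      nlinarith [mul_pos hM this])
  refine ⟨max C₁ C₂, by positivity, fun x => ⟨(h₁ x).trans ?_, (h₂ x).trans ?_⟩⟩
  · exact mul_le_mul_of_nonneg_right (le_max_left _ _) (hwpos x).le
  · exact mul_le_mul_of_nonneg_right (le_max_right _ _) (hwpos x).le

end Weights

/-! ### Energy identities in the `(t, r_*)` plane -/

section Plane

theorem hasDerivAt_fst {f : ℝ × ℝ → ℝ} {p : ℝ × ℝ} (hf : DifferentiableAt ℝ f p) :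
    HasDerivAt (fun s => f (s, p.2)) (fderiv ℝ f p (1, 0)) p.1 :=
  HasFDerivAt.comp_hasDerivAt (f := fun s => (s, p.2)) p.1 hf.hasFDerivAt
    ((hasDerivAt_id p.1).prodMk (hasDerivAt_const p.1 p.2))

theorem hasDerivAt_snd {f : ℝ × ℝ → ℝ} {p : ℝ × ℝ} (hf : DifferentiableAt ℝ f p) :
    HasDerivAt (fun y => f (p.1, y)) (fderiv ℝ f p (0, 1)) p.2 :=
  HasFDerivAt.comp_hasDerivAt (f := fun s => (p.1, s)) p.2 hf.hasFDerivAt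
    ((hasDerivAt_const p.2 p.1).prodMk (hasDerivAt_id p.2))

/-- This is the divergence theorem on a rectangle whose lateral fluxes vanish. It serves every
multiplier identity below. -/
theorem integral_sub_integral_of_conservation {A B Z : ℝ × ℝ → ℝ} (hA : ContDiff ℝ 1 A)
    (hB : ContDiff ℝ 1 B) (hZ : ∀ p, fderiv ℝ A p (1, 0) - fderiv ℝ B p (0, 1) = Z p)
    {X T : ℝ} (hT : 0 ≤ T) (hX : ∀ t ∈ Set.Icc 0 T, B (t, X) = 0 ∧ B (t, -X) = 0) :
    (∫ x in -X..X, A (T, x)) - ∫ x in -X..X, A (0, x) = ∫ t in 0..T, ∫ x in -X..X, Z (t, x) := by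
  have hA' := (hA.continuous_fderiv one_ne_zero).clm_apply continuous_const (g := fun _ => (1, 0))
  have hB' := (hB.continuous_fderiv one_ne_zero).clm_apply continuous_const (g := fun _ => (0, 1))
  have key := integral2_divergence_prod_of_hasFDerivAt A (fun p => -B p) (fderiv ℝ A)
    (fun p => -fderiv ℝ B p) 0 (-X) T X hA.continuous.continuousOn
    hB.continuous.neg.continuousOn
    (fun p _ => (hA.differentiable one_ne_zero p).hasFDerivAt)
    (fun p _ => (hB.differentiable one_ne_zero p).hasFDerivAt.neg)
    ((hA'.add hB'.neg).continuousOn.integrableOn_compact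
      (isCompact_uIcc.prod isCompact_uIcc))
  have e1 : (∫ t in 0..T, -B (t, X)) = 0 := by
    rw [intervalIntegral.integral_congr (g := fun _ => (0 : ℝ)), intervalIntegral.integral_zero]
    intro t ht
    rw [Set.uIcc_of_le hT] at ht
    simp [(hX t ht).1]
  have e2 : (∫ t in 0..T, -B (t, -X)) = 0 := by
    rw [intervalIntegral.integral_congr (g := fun _ => (0 : ℝ)), intervalIntegral.integral_zero]
    intro t ht
    rw [Set.uIcc_of_le hT] at ht
    simp [(hX t ht).2]
  rw [e1, e2] at key
  have e3 : (∫ t in 0..T, ∫ x in -X..X, Z (t, x)) = ∫ t in 0..T, ∫ x in -X..X,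
      fderiv ℝ A (t, x) (1, 0) + (-fderiv ℝ B (t, x)) (0, 1) := by
    congr 1
    funext t
    congr 1
    funext x
    rw [← hZ]
    simp [sub_eq_add_neg]
  rw [e3, key]
  ring

end Plane

/-- The sphere integrals of the quadratic expressions in a solution of the Fackerell-Ipser equation,
as functions of `(t, r_*)`: `q0`, `qt`, `qx` of the square norms of the field and of its
derivatives, `qy` of the square norm of all the derivatives along the sphere of the components of
the field in Euclidean space, and `m`, `k`, `l` of the inner products `⟨∂_t, ∂_{r_*}⟩`,
`⟨field, ∂_t⟩`, `⟨field, ∂_{r_*}⟩`. -/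
structure Profile (M : ℝ) where
  q0 : ℝ × ℝ → ℝ
  qt : ℝ × ℝ → ℝ
  qx : ℝ × ℝ → ℝ
  qy : ℝ × ℝ → ℝ
  m : ℝ × ℝ → ℝ
  k : ℝ × ℝ → ℝ
  l : ℝ × ℝ → ℝ
  contDiff_q0 : ContDiff ℝ 1 q0
  contDiff_qt : ContDiff ℝ 1 qt
  contDiff_qx : ContDiff ℝ 1 qx
  contDiff_qy : ContDiff ℝ 1 qy
  contDiff_m : ContDiff ℝ 1 m
  contDiff_k : ContDiff ℝ 1 k
  contDiff_l : ContDiff ℝ 1 l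
  -- The next three laws come from pairing the equation with `∂_t`, with `∂_{r_*}` and with the
  -- field itself. They and the inequalities below are all that the energy argument uses, so it
  -- takes place in the `(t, r_*)` plane.
  energy_t : ∀ p, fderiv ℝ qt p (1, 0) + fderiv ℝ qx p (1, 0) + V₁ M p.2 * fderiv ℝ qy p (1, 0)
    + V₃ M p.2 * fderiv ℝ q0 p (1, 0) = 2 * fderiv ℝ m p (0, 1)
  m_t : ∀ p, 2 * fderiv ℝ m p (1, 0) = fderiv ℝ qt p (0, 1) + fderiv ℝ qx p (0, 1)
    - V₁ M p.2 * fderiv ℝ qy p (0, 1) - V₃ M p.2 * fderiv ℝ q0 p (0, 1)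
  k_t : ∀ p, fderiv ℝ k p (1, 0) = qt p - qx p + fderiv ℝ l p (0, 1) - V₁ M p.2 * qy p
    - V₃ M p.2 * q0 p
  q0_x : ∀ p, fderiv ℝ q0 p (0, 1) = 2 * l p
  q0_nonneg : ∀ p, 0 ≤ q0 p
  qt_nonneg : ∀ p, 0 ≤ qt p
  qx_nonneg : ∀ p, 0 ≤ qx p
  q0_le_qy : ∀ p, q0 p ≤ qy p
  m_le : ∀ p, |2 * m p| ≤ qt p + qx p
  k_le : ∀ p a, |2 * a * k p| ≤ a ^ 2 * q0 p + qt p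
  l_le : ∀ p a, |2 * a * l p| ≤ a ^ 2 * q0 p + qx p

/-! ### Derivatives and smoothness of the potentials. -/

section Weights

variable {M : ℝ} (hM : 0 < M)
include hM

theorem hasDerivAt_V₁ (x : ℝ) :
    HasDerivAt (V₁ M) (-((2 * R M x - 6 * M * R M x ^ 2) * V₁ M x)) x := by
  refine hasDerivAt_comp_R hM (p := fun r => r ^ 2 * (1 - 2 * M * r)) ?_
  have h := (hasDerivAt_pow 2 (R M x)).mul
    (((hasDerivAt_id (R M x)).const_mul (2 * M)).const_sub 1)
  exact h.congr_deriv (by simp only [id]; push_cast; ring)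

theorem hasDerivAt_V₃ (x : ℝ) :
    HasDerivAt (V₃ M) (-(2 * M * (3 * R M x ^ 2 - 8 * M * R M x ^ 3) * V₁ M x)) x := by
  refine hasDerivAt_comp_R hM (p := fun r => 2 * M * r ^ 3 * (1 - 2 * M * r)) ?_
  have h := ((hasDerivAt_pow 3 (R M x)).const_mul (2 * M)).mul
    (((hasDerivAt_id (R M x)).const_mul (2 * M)).const_sub 1)
  exact h.congr_deriv (by simp only [id]; push_cast; ring)

theorem contDiff_V₁ (n : ℕ) : ContDiff ℝ n (V₁ M) := by
  have := contDiff_R hM n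
  unfold V₁
  fun_prop

theorem contDiff_V₃ (n : ℕ) : ContDiff ℝ n (V₃ M) := by
  have := contDiff_R hM n
  unfold V₃
  fun_prop

end Weights

/-! ### The energy density and its potential. -/

namespace Profile

variable {M : ℝ} (P : Profile M)

/-- The energy density. -/
def e (p : ℝ × ℝ) : ℝ := P.qt p + P.qx p + V₁ M p.2 * P.qy p + V₃ M p.2 * P.q0 p

theorem qy_nonneg (p : ℝ × ℝ) : 0 ≤ P.qy p := (P.q0_nonneg p).trans (P.q0_le_qy p)

section

variable (hM : 0 < M)
include hM

theorem contDiff_e : ContDiff ℝ 1 P.e := by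
  have h1 := (contDiff_V₁ hM 1).comp (contDiff_snd (E := ℝ) (F := ℝ))
  have h3 := (contDiff_V₃ hM 1).comp (contDiff_snd (E := ℝ) (F := ℝ))
  exact ((P.contDiff_qt.add P.contDiff_qx).add (h1.mul P.contDiff_qy)).add (h3.mul P.contDiff_q0)

theorem qt_add_qx_le_e (p : ℝ × ℝ) : P.qt p + P.qx p ≤ P.e p := by
  have h1 := mul_nonneg (V₁_pos hM p.2).le (P.qy_nonneg p)
  have h3 := mul_nonneg (V₃_pos hM p.2).le (P.q0_nonneg p)
  unfold e
  linarith

theorem e_nonneg (p : ℝ × ℝ) : 0 ≤ P.e p := by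
  have := P.qt_add_qx_le_e hM p
  have := P.qt_nonneg p
  have := P.qx_nonneg p
  linarith

theorem two_mul_abs_m_le_e (p : ℝ × ℝ) : |2 * P.m p| ≤ P.e p :=
  (P.m_le p).trans (P.qt_add_qx_le_e hM p)

theorem eq_zero_of_e_eq_zero {p : ℝ × ℝ} (h : P.e p = 0) :
    P.q0 p = 0 ∧ P.qt p = 0 ∧ P.qx p = 0 ∧ P.qy p = 0 ∧ P.m p = 0 ∧ P.k p = 0 ∧ P.l p = 0 := by
  have v1 := V₁_pos hM p.2
  have v3 := V₃_pos hM p.2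
  have h1 := mul_nonneg v1.le (P.qy_nonneg p)
  have h3 := mul_nonneg v3.le (P.q0_nonneg p)
  have ht := P.qt_nonneg p
  have hx := P.qx_nonneg p
  unfold e at h
  have a1 : P.qt p = 0 := by linarith
  have a2 : P.qx p = 0 := by linarith
  have a3 : P.qy p = 0 := by
    have : V₁ M p.2 * P.qy p = 0 := by linarith
    exact (mul_eq_zero.1 this).resolve_left v1.ne'
  have a4 : P.q0 p = 0 := by
    have : V₃ M p.2 * P.q0 p = 0 := by linarith
    exact (mul_eq_zero.1 this).resolve_left v3.ne'
  have b1 := P.m_le p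
  have b2 := P.k_le p 1
  have b3 := P.l_le p 1
  rw [a1, a2, add_zero] at b1
  rw [a4, a1] at b2
  rw [a4, a2] at b3
  have c1 := abs_nonpos_iff.1 b1
  have c2 := abs_nonpos_iff.1 (b2.trans_eq (by ring))
  have c3 := abs_nonpos_iff.1 (b3.trans_eq (by ring))
  exact ⟨a4, a1, a2, a3, by linarith, by linarith, by linarith⟩

theorem fderiv_e_fst (p : ℝ × ℝ) : fderiv ℝ P.e p (1, 0) = 2 * fderiv ℝ P.m p (0, 1) := by
  rw [← P.energy_t]
  have h := (((hasDerivAt_fst (P.contDiff_qt.differentiable one_ne_zero p)).add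
    (hasDerivAt_fst (P.contDiff_qx.differentiable one_ne_zero p))).add
    ((hasDerivAt_fst (P.contDiff_qy.differentiable one_ne_zero p)).const_mul (V₁ M p.2))).add
    ((hasDerivAt_fst (P.contDiff_q0.differentiable one_ne_zero p)).const_mul (V₃ M p.2))
  exact (hasDerivAt_fst ((P.contDiff_e hM).differentiable one_ne_zero p)).unique h

/-- The energy density and the energy current have a common potential. -/
theorem exists_potential : ∃ E : ℝ × ℝ → ℝ, ∀ p, HasFDerivAt E
    ((2 * P.m p) • ContinuousLinearMap.fst ℝ ℝ ℝ + P.e p • ContinuousLinearMap.snd ℝ ℝ ℝ) p := by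
  have hm := P.contDiff_m.differentiable one_ne_zero
  have he := (P.contDiff_e hM).differentiable one_ne_zero
  have hd : ∀ p, HasFDerivAt (fun p => (2 * P.m p) • ContinuousLinearMap.fst ℝ ℝ ℝ
      + P.e p • ContinuousLinearMap.snd ℝ ℝ ℝ) _ p := fun p =>
    (((hm p).hasFDerivAt.const_mul 2).smul_const (ContinuousLinearMap.fst ℝ ℝ ℝ)).add
      ((he p).hasFDerivAt.smul_const (ContinuousLinearMap.snd ℝ ℝ ℝ))
  -- Poincaré's lemma on the plane: the form `2m dt + e dx` is closed exactly by the conservation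
  -- law `fderiv_e_fst`.
  obtain ⟨E, hE⟩ := Convex.exists_forall_hasFDerivAt_of_fderiv_symmetric
    (convex_univ (𝕜 := ℝ) (E := ℝ × ℝ)) isOpen_univ
    (fun p _ => (hd p).differentiableAt.differentiableWithinAt) (fun p _ v w => by
      rw [(hd p).fderiv]
      have hv : ∀ v : ℝ × ℝ, v = v.1 • (1, 0) + v.2 • (0, 1) := fun v => by simp
      have h := P.fderiv_e_fst hM p
      rw [hv v, hv w]
      simp only [_root_.add_apply, ContinuousLinearMap.smulRight_apply, map_add,
        map_smul, _root_.smul_apply, ContinuousLinearMap.coe_fst',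
        ContinuousLinearMap.coe_snd', smul_eq_mul, h]
      ring)
  exact ⟨E, fun p => hE p trivial⟩

end

end Profile
-- Monotonicity of the potential and finite speed of propagation.
namespace Profile

variable {M : ℝ} (P : Profile M)

/-- `E` is a potential of the energy density and the energy current. -/
def IsPotential (E : ℝ × ℝ → ℝ) : Prop := ∀ p, HasFDerivAt E
  ((2 * P.m p) • ContinuousLinearMap.fst ℝ ℝ ℝ + P.e p • ContinuousLinearMap.snd ℝ ℝ ℝ) p

/-- The profile vanishes outside the domain of influence of `{|r_*| ≤ R₀}`. -/
def SupportedIn (R₀ : ℝ) : Prop := ∀ t x, R₀ + |t| < |x| → P.e (t, x) = 0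

namespace IsPotential

variable {P} {E : ℝ × ℝ → ℝ} (hE : P.IsPotential E)
include hE

theorem hasDerivAt_comp {γ₁ γ₂ : ℝ → ℝ} {a b s : ℝ} (h₁ : HasDerivAt γ₁ a s)
    (h₂ : HasDerivAt γ₂ b s) : HasDerivAt (fun s => E (γ₁ s, γ₂ s))
      (2 * P.m (γ₁ s, γ₂ s) * a + P.e (γ₁ s, γ₂ s) * b) s := by
  have h := HasFDerivAt.comp_hasDerivAt (f := fun s => (γ₁ s, γ₂ s)) s (hE _) (h₁.prodMk h₂)
  exact h.congr_deriv (by simp)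

theorem hasDerivAt_snd (t x : ℝ) : HasDerivAt (fun x => E (t, x)) (P.e (t, x)) x :=
  (hE.hasDerivAt_comp (hasDerivAt_const x t) (hasDerivAt_id x)).congr_deriv (by simp)

variable (hM : 0 < M)
include hM

theorem integral_e (t a b : ℝ) : ∫ x in a..b, P.e (t, x) = E (t, b) - E (t, a) := by
  refine intervalIntegral.integral_eq_sub_of_hasDerivAt (fun x _ => hE.hasDerivAt_snd t x) ?_
  exact (Continuous.intervalIntegrable
    ((P.contDiff_e hM).continuous.comp (by fun_prop)) _ _)

theorem monotone_snd (t : ℝ) : Monotone fun x => E (t, x) :=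
  monotone_of_hasDerivAt_nonneg (fun x => hE.hasDerivAt_snd t x) fun _ => P.e_nonneg hM _

/-- The derivative along the outgoing direction is `e + 2m`, nonnegative by the dominant energy
condition `|2m| ≤ e`. -/
theorem monotone_outgoing (t x : ℝ) : Monotone fun s => E (t + s, x + s) :=
  monotone_of_hasDerivAt_nonneg (fun s => hE.hasDerivAt_comp ((hasDerivAt_id s).const_add t)
    ((hasDerivAt_id s).const_add x)) fun s => by
      have := (abs_le.1 (P.two_mul_abs_m_le_e hM (t + s, x + s))).1
      simp only [Pi.zero_apply]
      linarith

theorem antitone_incoming (t x : ℝ) : Antitone fun s => E (t + s, x - s) :=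
  antitone_of_hasDerivAt_nonpos (fun s => hE.hasDerivAt_comp ((hasDerivAt_id s).const_add t)
    ((hasDerivAt_id s).const_sub x)) fun s => by
      have := (abs_le.1 (P.two_mul_abs_m_le_e hM (t + s, x - s))).2
      simp only [Pi.zero_apply]
      linarith

/-- The potential lies between its values at the ends of the past and future light cones. -/
theorem mem_Icc_initial (t x : ℝ) : E (t, x) ∈ Set.Icc (E (0, x - |t|)) (E (0, x + |t|)) := by
  have a := hE.monotone_outgoing hM t x
  have b := hE.antitone_incoming hM t x
  rcases le_total 0 t with h | h
  · rw [abs_of_nonneg h]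
    have a' := @a (-t) 0 (by linarith)
    have b' := @b (-t) 0 (by linarith)
    simp only [add_neg_cancel, add_zero, sub_zero, sub_neg_eq_add] at a' b'
    rw [← sub_eq_add_neg] at a'
    exact ⟨a', b'⟩
  · rw [abs_of_nonpos h]
    have a' := @a 0 (-t) (by linarith)
    have b' := @b 0 (-t) (by linarith)
    simp only [add_neg_cancel, add_zero, sub_zero, sub_neg_eq_add] at a' b'
    rw [sub_neg_eq_add]
    rw [← sub_eq_add_neg] at a'
    exact ⟨b', a'⟩

section Support

variable {R₀ : ℝ} (h0 : ∀ x, R₀ ≤ |x| → P.e (0, x) = 0)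
include h0

/-- Beyond the support of the data `E (0, ·)` is constant. Both feet of the light cone of `(t, x)`
lie there, so `mem_Icc_initial` squeezes the value. -/
theorem eq_right {t x : ℝ} (hx : R₀ + |t| ≤ x) : E (t, x) = E (0, R₀) := by
  have hc : ∀ y, R₀ ≤ y → E (0, y) = E (0, R₀) := by
    intro y hy
    have h1 := hE.integral_e hM 0 R₀ y
    rw [intervalIntegral.integral_congr (g := fun _ => (0 : ℝ)),
      intervalIntegral.integral_zero] at h1
    · linarith
    · intro z hz
      rw [Set.uIcc_of_le hy] at hz
      exact h0 z (hz.1.trans (le_abs_self z))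
  have h := hE.mem_Icc_initial hM t x
  have := abs_nonneg t
  rw [hc (x - |t|) (by linarith), hc (x + |t|) (by linarith)] at h
  exact le_antisymm h.2 h.1

theorem eq_left {t x : ℝ} (hx : x ≤ -(R₀ + |t|)) : E (t, x) = E (0, -R₀) := by
  have hc : ∀ y, y ≤ -R₀ → E (0, y) = E (0, -R₀) := by
    intro y hy
    have h1 := hE.integral_e hM 0 y (-R₀)
    rw [intervalIntegral.integral_congr (g := fun _ => (0 : ℝ)),
      intervalIntegral.integral_zero] at h1
    · linarith
    · intro z hz
      rw [Set.uIcc_of_le hy] at hz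
      exact h0 z ((by linarith [hz.2] : R₀ ≤ -z).trans (neg_le_abs z))
  have h := hE.mem_Icc_initial hM t x
  have := abs_nonneg t
  rw [hc (x - |t|) (by linarith), hc (x + |t|) (by linarith)] at h
  exact le_antisymm h.2 h.1

/-- On a slice `E` increases from its constant value far to the left to its constant value far to
the right; neither depends on the slice. -/
theorem mem_Icc (p : ℝ × ℝ) : E p ∈ Set.Icc (E (0, -R₀)) (E (0, R₀)) := by
  obtain ⟨t, x⟩ := p
  have hm := hE.monotone_snd hM t
  constructor
  · rw [← hE.eq_left hM h0 (t := t) (x := min x (-(R₀ + |t|))) (min_le_right _ _)]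
    exact hm (min_le_left _ _)
  · rw [← hE.eq_right hM h0 (t := t) (x := max x (R₀ + |t|)) (le_max_right _ _)]
    exact hm (le_max_left _ _)

/-- Finite speed of propagation. -/
theorem supportedIn : P.SupportedIn R₀ := by
  intro t x hx
  -- The strict inequality leaves room for `E (t, ·)` to be locally constant, and its derivative is
  -- the energy density.
  have key : (fun y => E (t, y)) =ᶠ[𝓝 x] fun _ => E (t, x) := by
    rcases le_total 0 x with h | h
    · rw [abs_of_nonneg h] at hx
      filter_upwards [eventually_gt_nhds hx] with y hy
      rw [hE.eq_right hM h0 hy.le, hE.eq_right hM h0 hx.le]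
    · rw [abs_of_nonpos h] at hx
      have hx' : x < -(R₀ + |t|) := by linarith
      filter_upwards [eventually_lt_nhds hx'] with y hy
      rw [hE.eq_left hM h0 hy.le, hE.eq_left hM h0 hx'.le]
  exact (hE.hasDerivAt_snd t x).unique ((hasDerivAt_const x _).congr_of_eventuallyEq key)

end Support

end IsPotential

/-! ### Multiplier identities. -/

section Multiplier

variable (hM : 0 < M) {f f' g g' g'' : ℝ → ℝ} (τ R₀ : ℝ)

/-- The density obtained from the multiplier `τ (t + R₀) ∂_t + f ∂_{r_*} + g / 2`. -/
def multDensity (f g : ℝ → ℝ) (p : ℝ × ℝ) : ℝ :=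
  τ * ((p.1 + R₀) * P.e p) + 2 * f p.2 * P.m p + g p.2 * P.k p

/-- The current obtained from the multiplier `τ (t + R₀) ∂_t + f ∂_{r_*} + g / 2`. -/
def multCurrent (f g g' : ℝ → ℝ) (p : ℝ × ℝ) : ℝ :=
  τ * ((p.1 + R₀) * (2 * P.m p)) + f p.2 * (P.qt p + P.qx p - V₁ M p.2 * P.qy p
    - V₃ M p.2 * P.q0 p) + g p.2 * P.l p - 1 / 2 * g' p.2 * P.q0 p

/-- The bulk term of the multiplier `τ (t + R₀) ∂_t + f ∂_{r_*} + g / 2`. -/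
def multBulk (f f' g g'' : ℝ → ℝ) (p : ℝ × ℝ) : ℝ :=
  τ * P.e p + (g p.2 - f' p.2) * P.qt p - (f' p.2 + g p.2) * P.qx p
    + (f' p.2 - g p.2 - f p.2 * (2 * R M p.2 - 6 * M * R M p.2 ^ 2)) * V₁ M p.2 * P.qy p
    + ((f' p.2 - g p.2) * V₃ M p.2
      - f p.2 * (2 * M * (3 * R M p.2 ^ 2 - 8 * M * R M p.2 ^ 3)) * V₁ M p.2
      + 1 / 2 * g'' p.2) * P.q0 p

include hM

theorem contDiff_multDensity (cf : ContDiff ℝ 1 f) (cg : ContDiff ℝ 1 g) :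
    ContDiff ℝ 1 (P.multDensity τ R₀ f g) := by
  have := P.contDiff_e hM
  have := P.contDiff_m
  have := P.contDiff_k
  unfold multDensity
  fun_prop

theorem contDiff_multCurrent (cf : ContDiff ℝ 1 f) (cg : ContDiff ℝ 1 g)
    (cg' : ContDiff ℝ 1 g') : ContDiff ℝ 1 (P.multCurrent τ R₀ f g g') := by
  have := P.contDiff_m
  have := P.contDiff_l
  have := P.contDiff_q0
  have := P.contDiff_qt
  have := P.contDiff_qx
  have := P.contDiff_qy
  have := contDiff_V₁ hM 1
  have := contDiff_V₃ hM 1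
  unfold multCurrent
  simp only [Nat.cast_one] at *
  fun_prop

/-- The product rule is combined with the momentum law weighted by `f` and with the virial law
weighted by `g`. The term `-g' q0 / 2` of the current is there to cancel `g' l`, since `∂_x q0 =
2l`, which leaves `g'' q0 / 2` in the bulk. -/
theorem fderiv_multDensity_sub (cf : ContDiff ℝ 1 f) (cg : ContDiff ℝ 1 g)
    (cg' : ContDiff ℝ 1 g') (hf : ∀ x, HasDerivAt f (f' x) x) (hg : ∀ x, HasDerivAt g (g' x) x)
    (hg' : ∀ x, HasDerivAt g' (g'' x) x) (p : ℝ × ℝ) :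
    fderiv ℝ (P.multDensity τ R₀ f g) p (1, 0) - fderiv ℝ (P.multCurrent τ R₀ f g g') p (0, 1)
      = P.multBulk τ f f' g g'' p := by
  have d : ∀ {h : ℝ × ℝ → ℝ}, ContDiff ℝ 1 h → DifferentiableAt ℝ h p :=
    fun h => h.differentiable one_ne_zero p
  have a1 := hasDerivAt_fst (d (P.contDiff_multDensity hM τ R₀ cf cg))
  have a2 := (((((hasDerivAt_id p.1).add_const R₀).mul
    (hasDerivAt_fst (d (P.contDiff_e hM)))).const_mul τ).add
    ((hasDerivAt_fst (d P.contDiff_m)).const_mul (2 * f p.2))).add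
    ((hasDerivAt_fst (d P.contDiff_k)).const_mul (g p.2))
  have b1 := hasDerivAt_snd (d (P.contDiff_multCurrent hM τ R₀ cf cg cg'))
  have b2 := ((((hasDerivAt_snd (d P.contDiff_m)).const_mul 2).const_mul (p.1 + R₀)).const_mul τ
    |>.add ((hf p.2).mul ((((hasDerivAt_snd (d P.contDiff_qt)).add
      (hasDerivAt_snd (d P.contDiff_qx))).sub ((hasDerivAt_V₁ hM p.2).mul
      (hasDerivAt_snd (d P.contDiff_qy)))).sub ((hasDerivAt_V₃ hM p.2).mul
      (hasDerivAt_snd (d P.contDiff_q0))))) |>.add ((hg p.2).mul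
      (hasDerivAt_snd (d P.contDiff_l)))).sub (((hg' p.2).const_mul (1 / 2)).mul
      (hasDerivAt_snd (d P.contDiff_q0)))
  rw [a1.unique a2, b1.unique b2]
  have e1 := P.fderiv_e_fst hM p
  have e2 := P.m_t p
  have e3 := P.k_t p
  have e4 := P.q0_x p
  simp only [id, multBulk, Prod.mk.eta, Pi.add_apply, Pi.sub_apply, Pi.mul_apply] at *
  rw [e1, e3]
  linear_combination (f p.2) * e2 + (1 / 2 * g' p.2) * e4

theorem integral_multDensity {R₀ : ℝ} (hR : 0 ≤ R₀) (hs : P.SupportedIn R₀)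
    (cf : ContDiff ℝ 1 f) (cg : ContDiff ℝ 1 g)
    (cg' : ContDiff ℝ 1 g') (hf : ∀ x, HasDerivAt f (f' x) x) (hg : ∀ x, HasDerivAt g (g' x) x)
    (hg' : ∀ x, HasDerivAt g' (g'' x) x) {T : ℝ} (hT : 0 ≤ T) :
    (∫ x in -(R₀ + T + 1)..R₀ + T + 1, P.multDensity τ R₀ f g (T, x))
      - ∫ x in -(R₀ + T + 1)..R₀ + T + 1, P.multDensity τ R₀ f g (0, x)
      = ∫ t in 0..T, ∫ x in -(R₀ + T + 1)..R₀ + T + 1, P.multBulk τ f f' g g'' (t, x) := by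
  refine integral_sub_integral_of_conservation (P.contDiff_multDensity hM τ R₀ cf cg)
    (P.contDiff_multCurrent hM τ R₀ cf cg cg')
    (P.fderiv_multDensity_sub hM τ R₀ cf cg cg' hf hg hg') hT fun t ht => ?_
  -- The extra 1 puts the lateral sides strictly outside the domain of influence for all times up to
  -- `T`.
  have key : ∀ x, |x| = R₀ + T + 1 → P.multCurrent τ R₀ f g g' (t, x) = 0 := by
    intro x hx
    obtain ⟨a1, a2, a3, a4, a5, a6, a7⟩ := P.eq_zero_of_e_eq_zero hM (hs t x (by
      rw [hx, abs_of_nonneg ht.1]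
      linarith [ht.2]))
    simp [multCurrent, a1, a2, a3, a4, a5, a7]
  exact ⟨key _ (abs_of_nonneg (by linarith)), key _ (by rw [abs_neg, abs_of_nonneg (by linarith)])⟩

end Multiplier

end Profile

/-- The weight `F R³` of the integrated decay estimate. -/
def decayWeight (M x : ℝ) : ℝ := R M x ^ 3 * (1 - 2 * M * R M x)

/-! ### Derivatives of the virial weight and of the Morawetz multiplier. -/

section Weights

variable {M : ℝ} (hM : 0 < M)
include hM

theorem decayWeight_pos (x : ℝ) : 0 < decayWeight M x :=
  mul_pos (pow_pos (R_pos hM x) 3) (by linarith [two_mul_R_lt_one hM x])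

theorem contDiff_decayWeight (n : ℕ) : ContDiff ℝ n (decayWeight M) := by
  have := contDiff_R hM n
  unfold decayWeight
  fun_prop

theorem hasDerivAt_decayWeight (x : ℝ) : HasDerivAt (decayWeight M)
    (-((3 * R M x ^ 2 - 8 * M * R M x ^ 3) * V₁ M x)) x := by
  refine hasDerivAt_comp_R hM (p := fun r => r ^ 3 * (1 - 2 * M * r)) ?_
  have h := (hasDerivAt_pow 3 (R M x)).mul
    (((hasDerivAt_id (R M x)).const_mul (2 * M)).const_sub 1)
  exact h.congr_deriv (by simp only [id]; push_cast; ring)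

theorem hasDerivAt_decayWeight' (x : ℝ) :
    HasDerivAt (fun x => -((3 * R M x ^ 2 - 8 * M * R M x ^ 3) * V₁ M x))
      ((12 * R M x ^ 3 - 70 * M * R M x ^ 4 + 96 * M ^ 2 * R M x ^ 5) * V₁ M x) x := by
  have h := (((hasDerivAt_pow 2 (R M x)).const_mul 3).sub
    ((hasDerivAt_pow 3 (R M x)).const_mul (8 * M))).mul ((hasDerivAt_pow 2 (R M x)).mul
    (((hasDerivAt_id (R M x)).const_mul (2 * M)).const_sub 1)) |>.neg
  have h' := hasDerivAt_comp_R hM (x := x) h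
  refine HasDerivAt.congr_deriv h' ?_
  simp only [id, Pi.sub_apply, Pi.mul_apply]
  push_cast
  ring

/-- The multiplier `1 - 3M/r` changes sign at the photon sphere `r = 3M`, where the derivative of
`V₁` does as well. -/
theorem hasDerivAt_morawetz (x : ℝ) :
    HasDerivAt (fun x => 1 - 3 * M * R M x) (3 * M * V₁ M x) x := by
  refine (hasDerivAt_comp_R hM (p := fun r => 1 - 3 * M * r)
    (((hasDerivAt_id (R M x)).const_mul (3 * M)).const_sub 1)).congr_deriv ?_
  ring

theorem hasDerivAt_morawetz' (x : ℝ) : HasDerivAt (fun x => 3 * M * V₁ M x)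
    (-(3 * M * (2 * R M x - 6 * M * R M x ^ 2) * V₁ M x)) x :=
  ((hasDerivAt_V₁ hM x).const_mul (3 * M)).congr_deriv (by ring)

theorem hasDerivAt_morawetz'' (x : ℝ) :
    HasDerivAt (fun x => -(3 * M * (2 * R M x - 6 * M * R M x ^ 2) * V₁ M x))
      (3 * M * (6 * R M x ^ 2 - 40 * M * R M x ^ 3 + 60 * M ^ 2 * R M x ^ 4) * V₁ M x) x := by
  have h := ((((hasDerivAt_id (R M x)).const_mul 2).sub
    ((hasDerivAt_pow 2 (R M x)).const_mul (6 * M))).const_mul (3 * M)).mul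
    ((hasDerivAt_pow 2 (R M x)).mul
    (((hasDerivAt_id (R M x)).const_mul (2 * M)).const_sub 1)) |>.neg
  have h' := hasDerivAt_comp_R hM (x := x) h
  refine HasDerivAt.congr_deriv h' ?_
  simp only [id, Pi.sub_apply, Pi.mul_apply]
  push_cast
  ring

end Weights

/-! ### Pointwise estimates of bulk terms and densities. -/

namespace Profile

variable {M : ℝ} (P : Profile M)

section

variable (hM : 0 < M)
include hM

/-- Taking `g = f'` removes `qt`. The `qx` term is nonpositive, and the coefficient of `qy` is
`-2R(1 - 3MR)² V₁`. The `q0` term has no sign by itself, but `q0 ≤ qy` lends it the angular term.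
With `y = MR`, what remains after setting aside `1/4` is the cubic `(1/2 - y)(7/2 - 23y + 42y²)`,
positive for `y < 1/2`. -/
theorem morawetz_bulk_le (p : ℝ × ℝ) :
    P.multBulk 0 (fun x => 1 - 3 * M * R M x) (fun x => 3 * M * V₁ M x)
      (fun x => 3 * M * V₁ M x)
      (fun x => 3 * M * (6 * R M x ^ 2 - 40 * M * R M x ^ 3 + 60 * M ^ 2 * R M x ^ 4) * V₁ M x) p
      ≤ -(1 / 4 * (decayWeight M p.2 * P.q0 p)) := by
  have hR := R_pos hM p.2
  have h1 := two_mul_R_lt_one hM p.2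
  have hV := V₁_pos hM p.2
  have hq0 := P.q0_nonneg p
  have hqx := P.qx_nonneg p
  have hq := P.q0_le_qy p
  set ρ := R M p.2
  have hw : decayWeight M p.2 = ρ * V₁ M p.2 := by
    unfold decayWeight V₁
    ring
  have hy : 0 < M * ρ := mul_pos hM hR
  have c1 : 0 ≤ 2 * ρ * (1 - 3 * M * ρ) ^ 2 * V₁ M p.2 * (P.qy p - P.q0 p) :=
    mul_nonneg (by positivity) (by linarith)
  have c2 : 0 ≤ 6 * M * V₁ M p.2 * P.qx p := by positivity
  -- The quadratic factor has negative discriminant; its vertex is `23/84`.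
  have c3 : 0 ≤ (1 / 2 - M * ρ) * (7 / 2 - 23 * (M * ρ) + 42 * (M * ρ) ^ 2) :=
    mul_nonneg (by linarith) (by nlinarith [sq_nonneg (M * ρ - 23 / 84)])
  have c4 := mul_nonneg c3 (mul_nonneg (mul_nonneg hR.le hV.le) hq0)
  rw [hw]
  simp only [multBulk]
  change _ at c4
  nlinarith [c1, c2, c4]

/-- `|1 - 3MR| ≤ 1` handles the momentum term. Since `(3M V₁)² ≤ (9/4) V₃`, the cross term `k` is
absorbed by `qt + V₃ q0`. -/
theorem abs_multDensity_morawetz_le (p : ℝ × ℝ) :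
    |P.multDensity 0 0 (fun x => 1 - 3 * M * R M x) (fun x => 3 * M * V₁ M x) p| ≤ 3 * P.e p := by
  have hR := R_pos hM p.2
  have h1 := two_mul_R_lt_one hM p.2
  have hy : 0 < M * R M p.2 := mul_pos hM hR
  have hf : |1 - 3 * M * R M p.2| ≤ 1 := abs_le.2 ⟨by linarith, by linarith⟩
  have hk := P.k_le p (3 * M * V₁ M p.2)
  have hm := P.two_mul_abs_m_le_e hM p
  have hq0 := P.q0_nonneg p
  have hqt := P.qt_nonneg p
  have hqx := P.qx_nonneg p
  have h3 : (3 * M * V₁ M p.2) ^ 2 ≤ 9 / 4 * V₃ M p.2 := by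
    unfold V₁ V₃
    have a1 : 0 ≤ 1 - 2 * M * R M p.2 := by linarith
    have a2 : M * R M p.2 * (1 - 2 * M * R M p.2) ≤ 1 / 2 := by nlinarith
    have a3 : 0 ≤ 9 * M * R M p.2 ^ 3 * (1 - 2 * M * R M p.2) := by positivity
    nlinarith
  have h4 : P.qt p + V₃ M p.2 * P.q0 p ≤ P.e p := by
    have := mul_nonneg (V₁_pos hM p.2).le (P.qy_nonneg p)
    unfold e
    linarith
  have h5 := mul_le_mul_of_nonneg_right h3 hq0
  have h6 := mul_nonneg (V₃_pos hM p.2).le hq0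
  have e1 : |2 * (1 - 3 * M * R M p.2) * P.m p| ≤ P.e p := by
    rw [mul_assoc, mul_left_comm, abs_mul]
    calc _ ≤ 1 * |2 * P.m p| := by gcongr
      _ ≤ _ := by rwa [one_mul]
  have e2 : |3 * M * V₁ M p.2 * P.k p| ≤ 2 * P.e p := by
    have : |2 * (3 * M * V₁ M p.2) * P.k p| = 2 * |3 * M * V₁ M p.2 * P.k p| := by
      rw [mul_assoc, abs_mul, abs_two]
    rw [this] at hk
    linarith
  simp only [multDensity, zero_mul, zero_add]
  exact (abs_add_le _ _).trans (by linarith)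

/-- With `f = 0` the bulk is the weighted difference of kinetic and potential terms plus `w'' q0 /
2`, where `w = F R³`. Solving for the `qy` term leaves `w qt`, harmless nonpositive terms, and `w''
≤ (10/M²) w`. -/
theorem virial_bulk_ge (p : ℝ × ℝ) :
    decayWeight M p.2 * V₁ M p.2 * P.qy p ≤
      -P.multBulk 0 (fun _ => 0) (fun _ => 0) (decayWeight M)
        (fun x => (12 * R M x ^ 3 - 70 * M * R M x ^ 4 + 96 * M ^ 2 * R M x ^ 5) * V₁ M x) p
      + decayWeight M p.2 * P.qt p + 5 / M ^ 2 * (decayWeight M p.2 * P.q0 p) := by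
  have hR := R_pos hM p.2
  have h1 := two_mul_R_lt_one hM p.2
  have hV := V₁_pos hM p.2
  have hV3 := V₃_pos hM p.2
  have hq0 := P.q0_nonneg p
  have hqx := P.qx_nonneg p
  have hw := decayWeight_pos hM p.2
  have hw' : decayWeight M p.2 = R M p.2 * V₁ M p.2 := by
    unfold decayWeight V₁
    ring
  set ρ := R M p.2
  have hy : 0 < M * ρ := mul_pos hM hR
  have c1 : (12 * ρ ^ 3 - 70 * M * ρ ^ 4 + 96 * M ^ 2 * ρ ^ 5) * V₁ M p.2
      ≤ 10 / M ^ 2 * decayWeight M p.2 := by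
    rw [hw', ← mul_assoc]
    refine mul_le_mul_of_nonneg_right ?_ hV.le
    have a1 : ρ * ((M * ρ) ^ 2 * (12 - 70 * (M * ρ) + 96 * (M * ρ) ^ 2)) ≤ ρ * 10 := by
      refine mul_le_mul_of_nonneg_left ?_ hR.le
      have b1 : (M * ρ) ^ 2 ≤ 1 / 4 := by nlinarith
      have b2 : 12 - 70 * (M * ρ) + 96 * (M * ρ) ^ 2 ≤ 36 := by nlinarith
      nlinarith [sq_nonneg (M * ρ)]
    rw [div_mul_eq_mul_div, le_div_iff₀ (by positivity)]
    nlinarith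
  have c2 := mul_le_mul_of_nonneg_right c1 hq0
  have c3 := mul_nonneg hw.le hqx
  have c4 := mul_nonneg (mul_nonneg hw.le hV3.le) hq0
  have c5 : 10 / M ^ 2 = 2 * (5 / M ^ 2) := by ring
  rw [c5] at c2
  simp only [multBulk]
  nlinarith [c2, c3, c4]

theorem abs_multDensity_virial_le (p : ℝ × ℝ) :
    |P.multDensity 0 0 (fun _ => 0) (decayWeight M) p| ≤ (1 + 1 / (16 * M ^ 4)) * P.e p := by
  have hR := R_pos hM p.2
  have h1 := two_mul_R_lt_one hM p.2
  have hy : 0 < M * R M p.2 := mul_pos hM hR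
  have hk := P.k_le p (decayWeight M p.2)
  have hq0 := P.q0_nonneg p
  have hqt := P.qt_nonneg p
  have hqx := P.qx_nonneg p
  have h3 : decayWeight M p.2 ^ 2 ≤ 1 / (16 * M ^ 4) * V₃ M p.2 := by
    unfold decayWeight V₃
    have a1 : 0 ≤ 1 - 2 * M * R M p.2 := by linarith
    have a2 : (M * R M p.2) ^ 3 * (1 - 2 * M * R M p.2) ≤ 1 / 8 := by
      have : (M * R M p.2) ^ 3 ≤ (1 / 2) ^ 3 := pow_le_pow_left₀ hy.le (by linarith) 3
      nlinarith [pow_pos hy 3]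
    have a3 : 0 ≤ 16 * M * R M p.2 ^ 3 * (1 - 2 * M * R M p.2) := by positivity
    rw [div_mul_eq_mul_div, le_div_iff₀ (by positivity)]
    nlinarith
  have h4 : P.qt p + V₃ M p.2 * P.q0 p ≤ P.e p := by
    have := mul_nonneg (V₁_pos hM p.2).le (P.qy_nonneg p)
    unfold e
    linarith
  have h5 := mul_le_mul_of_nonneg_right h3 hq0
  have h6 := mul_nonneg (V₃_pos hM p.2).le hq0
  have hc : 0 ≤ 1 / (16 * M ^ 4) := by positivity
  have h7 : 1 / (16 * M ^ 4) * (V₃ M p.2 * P.q0 p) ≤ 1 / (16 * M ^ 4) * P.e p :=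
    mul_le_mul_of_nonneg_left (by linarith) hc
  have e2 : |2 * decayWeight M p.2 * P.k p| = 2 * |decayWeight M p.2 * P.k p| := by
    rw [mul_assoc, abs_mul, abs_two]
  rw [e2] at hk
  have h8 := abs_nonneg (decayWeight M p.2 * P.k p)
  simp only [multDensity, mul_zero, zero_mul, zero_add]
  linarith

/-- For `f = x` and `g = 0` the kinetic terms cancel, and only the potential terms remain,
multiplied by the weights of `dilation_weights_le`. The `q0` part is then bounded by the `qy` part,
since `2MR < 1` and `q0 ≤ qy`. -/
theorem dilation_bulk_le {C : ℝ} (hC : 0 < C) {p : ℝ × ℝ}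
    (h1 : 2 - p.2 * (2 * R M p.2 - 6 * M * R M p.2 ^ 2) ≤ C * decayWeight M p.2)
    (h3 : 2 - p.2 * (3 * R M p.2 - 8 * M * R M p.2 ^ 2) ≤ C * decayWeight M p.2) :
    P.multBulk 1 (fun x => x) (fun _ => 1) (fun _ => 0) (fun _ => 0) p
      ≤ 2 * C * (decayWeight M p.2 * V₁ M p.2 * P.qy p) := by
  have hR := R_pos hM p.2
  have hR1 := two_mul_R_lt_one hM p.2
  have hV := V₁_pos hM p.2
  have hq0 := P.q0_nonneg p
  have hqy := P.qy_nonneg p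
  have hw := decayWeight_pos hM p.2
  have hV3 : V₃ M p.2 = 2 * M * R M p.2 * V₁ M p.2 := by
    unfold V₁ V₃
    ring
  have a1 := mul_le_mul_of_nonneg_right h1 (mul_nonneg hV.le hqy)
  have a3 := mul_le_mul_of_nonneg_right h3
    (mul_nonneg (mul_nonneg (mul_nonneg (mul_nonneg zero_le_two hM.le) hR.le) hV.le) hq0)
  have hk : 0 ≤ C * decayWeight M p.2 * V₁ M p.2 := by positivity
  have a4 : 2 * M * R M p.2 * P.q0 p ≤ 1 * P.qy p :=
    mul_le_mul hR1.le (P.q0_le_qy p) hq0 zero_le_one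
  have a5 := mul_le_mul_of_nonneg_left a4 hk
  have hid : P.multBulk 1 (fun x => x) (fun _ => 1) (fun _ => 0) (fun _ => 0) p =
      (2 - p.2 * (2 * R M p.2 - 6 * M * R M p.2 ^ 2)) * (V₁ M p.2 * P.qy p)
      + (2 - p.2 * (3 * R M p.2 - 8 * M * R M p.2 ^ 2)) *
        (2 * M * R M p.2 * V₁ M p.2 * P.q0 p) := by
    simp only [multBulk, e, hV3]
    ring
  rw [hid]
  linarith

end
end Profile

/-! ### Iterated integrals over a time strip. -/

theorem integral_integral_mono {f g : ℝ × ℝ → ℝ} (hf : Continuous f) (hg : Continuous g)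
    (h : ∀ p, f p ≤ g p) {T a b : ℝ} (hT : 0 ≤ T) (hab : a ≤ b) :
    (∫ t in 0..T, ∫ x in a..b, f (t, x)) ≤ ∫ t in 0..T, ∫ x in a..b, g (t, x) := by
  have hc : ∀ {f : ℝ × ℝ → ℝ}, Continuous f → Continuous fun t => ∫ x in a..b, f (t, x) :=
    fun hf => intervalIntegral.continuous_parametric_intervalIntegral_of_continuous'
      (f := fun t x => _) (by simpa [Function.uncurry_def] using hf) a b
  refine intervalIntegral.integral_mono_on hT ((hc hf).intervalIntegrable _ _)
    ((hc hg).intervalIntegrable _ _) fun t _ => ?_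
  exact intervalIntegral.integral_mono_on hab
    (Continuous.intervalIntegrable (by fun_prop) _ _)
    (Continuous.intervalIntegrable (by fun_prop) _ _) fun x _ => h _

theorem integral_integral_add {f g : ℝ × ℝ → ℝ} (hf : Continuous f) (hg : Continuous g)
    {T a b : ℝ} : (∫ t in 0..T, ∫ x in a..b, (f (t, x) + g (t, x))) =
      (∫ t in 0..T, ∫ x in a..b, f (t, x)) + ∫ t in 0..T, ∫ x in a..b, g (t, x) := by
  have hc : ∀ {f : ℝ × ℝ → ℝ}, Continuous f → Continuous fun t => ∫ x in a..b, f (t, x) :=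
    fun hf => intervalIntegral.continuous_parametric_intervalIntegral_of_continuous'
      (f := fun t x => _) (by simpa [Function.uncurry_def] using hf) a b
  rw [← intervalIntegral.integral_add ((hc hf).intervalIntegrable _ _)
    ((hc hg).intervalIntegrable _ _)]
  congr 1
  funext t
  exact intervalIntegral.integral_add (Continuous.intervalIntegrable (by fun_prop) _ _)
    (Continuous.intervalIntegrable (by fun_prop) _ _)

theorem integral_integral_const_mul (c : ℝ) (f : ℝ × ℝ → ℝ) {T a b : ℝ} :
    (∫ t in 0..T, ∫ x in a..b, c * f (t, x)) = c * ∫ t in 0..T, ∫ x in a..b, f (t, x) := by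
  rw [← intervalIntegral.integral_const_mul]
  congr 1
  funext t
  exact intervalIntegral.integral_const_mul _ _

/-! ### Integrated local decay and decay of the energy between cones. -/

namespace Profile

variable {M : ℝ} (P : Profile M) (hM : 0 < M)
include hM

theorem continuous_multBulk {f f' g g'' : ℝ → ℝ} (τ : ℝ) (hf : Continuous f) (hf' : Continuous f')
    (hg : Continuous g) (hg'' : Continuous g'') : Continuous (P.multBulk τ f f' g g'') := by
  have := (P.contDiff_e hM).continuous
  have := P.contDiff_q0.continuous
  have := P.contDiff_qt.continuous
  have := P.contDiff_qx.continuous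
  have := P.contDiff_qy.continuous
  have := (contDiff_V₁ hM 1).continuous
  have := (contDiff_V₃ hM 1).continuous
  have := continuous_R hM
  unfold multBulk
  fun_prop

theorem continuous_weight_mul {q : ℝ × ℝ → ℝ} (hq : Continuous q) :
    Continuous fun p : ℝ × ℝ => decayWeight M p.2 * q p :=
  (((contDiff_decayWeight hM 1).continuous).comp continuous_snd).mul hq

variable {P} {E : ℝ × ℝ → ℝ} (hE : P.IsPotential E) {R₀ : ℝ} (hR : 0 ≤ R₀)
  (h0 : ∀ x, R₀ ≤ |x| → P.e (0, x) = 0)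
include hE hR h0

omit hR in
theorem abs_integral_le {A : ℝ × ℝ → ℝ} (hA : Continuous A) {c : ℝ} (hc : 0 ≤ c)
    (h : ∀ p, |A p| ≤ c * P.e p) {X : ℝ} (hX : 0 ≤ X) (t : ℝ) :
    |∫ x in -X..X, A (t, x)| ≤ c * (E (0, R₀) - E (0, -R₀)) := by
  have hce := (P.contDiff_e hM).continuous
  calc |∫ x in -X..X, A (t, x)| ≤ ∫ x in -X..X, |A (t, x)| :=
        intervalIntegral.abs_integral_le_integral_abs (by linarith)
    _ ≤ ∫ x in -X..X, c * P.e (t, x) :=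
        intervalIntegral.integral_mono_on (by linarith)
          (Continuous.intervalIntegrable (by fun_prop) _ _)
          (Continuous.intervalIntegrable (by fun_prop) _ _) fun x _ => h _
    _ = c * (E (t, X) - E (t, -X)) := by
        rw [intervalIntegral.integral_const_mul, hE.integral_e hM]
    _ ≤ _ := by
        have a := hE.mem_Icc hM h0 (t, X)
        have b := hE.mem_Icc hM h0 (t, -X)
        exact mul_le_mul_of_nonneg_left (by linarith [a.2, b.1]) hc

/-- Integrated local energy decay for the field itself. -/
theorem integral_decayWeight_q0_le {T : ℝ} (hT : 0 ≤ T) :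
    ∫ t in 0..T, ∫ x in -(R₀ + T + 1)..R₀ + T + 1, decayWeight M x * P.q0 (t, x)
      ≤ 24 * (E (0, R₀) - E (0, -R₀)) := by
  have hRc := contDiff_R hM 1
  have hVc := contDiff_V₁ hM 1
  simp only [Nat.cast_one] at hRc hVc
  have hR' := hRc.continuous
  have hV' := hVc.continuous
  have hq := P.contDiff_q0.continuous
  have hs := hE.supportedIn hM h0
  have cf : ContDiff ℝ 1 fun x => 1 - 3 * M * R M x := by fun_prop
  have cg : ContDiff ℝ 1 fun x => 3 * M * V₁ M x := by fun_prop
  have key := P.integral_multDensity hM 0 hR hs cf cg (by fun_prop) (hasDerivAt_morawetz hM)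
    (hasDerivAt_morawetz' hM) (hasDerivAt_morawetz'' hM) hT
  have hA : Continuous (P.multDensity 0 0 (fun x => 1 - 3 * M * R M x)
    (fun x => 3 * M * V₁ M x)) := (P.contDiff_multDensity hM 0 0 cf cg).continuous
  have hden : P.multDensity 0 R₀ (fun x => 1 - 3 * M * R M x) (fun x => 3 * M * V₁ M x)
      = P.multDensity 0 0 (fun x => 1 - 3 * M * R M x) (fun x => 3 * M * V₁ M x) := by
    funext p
    simp [multDensity]
  rw [hden] at key
  -- Each end slice costs 3 times the energy, and the bulk carries a factor `1/4`, whence 24.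
  have b1 := abs_le.1 (abs_integral_le hM hE h0 hA (by norm_num)
    (P.abs_multDensity_morawetz_le hM) (by linarith : 0 ≤ R₀ + T + 1) T)
  have b2 := abs_le.1 (abs_integral_le hM hE h0 hA (by norm_num)
    (P.abs_multDensity_morawetz_le hM) (by linarith : 0 ≤ R₀ + T + 1) 0)
  have hw := continuous_weight_mul hM hq
  have mono := integral_integral_mono (P.continuous_multBulk hM 0 cf.continuous cg.continuous
    cg.continuous (by fun_prop)) (g := fun p => -1 / 4 * (decayWeight M p.2 * P.q0 p))
    (by fun_prop) (fun p => (P.morawetz_bulk_le hM p).trans_eq (by ring)) hT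
    (by linarith : -(R₀ + T + 1) ≤ R₀ + T + 1)
  rw [← key, integral_integral_const_mul (-1 / 4) fun p => decayWeight M p.2 * P.q0 p] at mono
  linarith [b1.1, b2.2]

/-- Integrated local energy decay for the derivatives along the sphere, given integrated decay of
the time derivative. -/
theorem integral_decayWeight_qy_le {B : ℝ} (hB : ∀ T : ℝ, 0 ≤ T →
    ∫ t in 0..T, ∫ x in -(R₀ + T + 1)..R₀ + T + 1, decayWeight M x * P.qt (t, x) ≤ B) :
    ∃ C, ∀ T : ℝ, 0 ≤ T → ∫ t in 0..T, ∫ x in -(R₀ + T + 1)..R₀ + T + 1,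
      decayWeight M x * V₁ M x * P.qy (t, x) ≤ C := by
  refine ⟨2 * ((1 + 1 / (16 * M ^ 4)) * (E (0, R₀) - E (0, -R₀))) + B
    + 5 / M ^ 2 * (24 * (E (0, R₀) - E (0, -R₀))), fun T hT => ?_⟩
  have hRc := contDiff_R hM 1
  have hVc := contDiff_V₁ hM 1
  have hwc := contDiff_decayWeight hM 1
  simp only [Nat.cast_one] at hRc hVc hwc
  have hR' := hRc.continuous
  have hV' := hVc.continuous
  have hw' := hwc.continuous
  have hq := P.contDiff_q0.continuous
  have hqt := P.contDiff_qt.continuous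
  have hqy := P.contDiff_qy.continuous
  have hs := hE.supportedIn hM h0
  have key := P.integral_multDensity hM 0 hR hs (f := fun _ => 0) (f' := fun _ => 0)
    contDiff_const hwc (by fun_prop) (fun x => hasDerivAt_const x 0)
    (hasDerivAt_decayWeight hM) (hasDerivAt_decayWeight' hM) hT
  have hA : Continuous (P.multDensity 0 0 (fun _ => 0) (decayWeight M)) :=
    (P.contDiff_multDensity hM 0 0 contDiff_const hwc).continuous
  have hden : P.multDensity 0 R₀ (fun _ => 0) (decayWeight M)
      = P.multDensity 0 0 (fun _ => 0) (decayWeight M) := by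
    funext p
    simp [multDensity]
  rw [hden] at key
  have b1 := abs_le.1 (abs_integral_le hM hE h0 hA (by positivity)
    (P.abs_multDensity_virial_le hM) (by linarith : 0 ≤ R₀ + T + 1) T)
  have b2 := abs_le.1 (abs_integral_le hM hE h0 hA (by positivity)
    (P.abs_multDensity_virial_le hM) (by linarith : 0 ≤ R₀ + T + 1) 0)
  have c1 := continuous_weight_mul hM hq
  have c2 := continuous_weight_mul hM hqt
  have c3 := P.continuous_multBulk hM 0 (f := fun _ => 0) (f' := fun _ => 0) continuous_const
    continuous_const hw' (g'' := fun x => (12 * R M x ^ 3 - 70 * M * R M x ^ 4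
      + 96 * M ^ 2 * R M x ^ 5) * V₁ M x) (by fun_prop)
  have hge := P.virial_bulk_ge hM
  generalize P.multBulk 0 (fun _ => 0) (fun _ => 0) (decayWeight M) _ = Z at c3 key hge
  have mono := integral_integral_mono (f := fun p => decayWeight M p.2 * V₁ M p.2 * P.qy p)
    (g := fun p => (-1 * Z p + decayWeight M p.2 * P.qt p) + 5 / M ^ 2 * (decayWeight M p.2 * P.q0 p))
    (by fun_prop) (by fun_prop) (fun p => (hge p).trans_eq (by ring)) hT
    (by linarith : -(R₀ + T + 1) ≤ R₀ + T + 1)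
  rw [integral_integral_add (f := fun p => -1 * Z p + decayWeight M p.2 * P.qt p)
      (g := fun p => 5 / M ^ 2 * (decayWeight M p.2 * P.q0 p)) (by fun_prop) (by fun_prop),
    integral_integral_add (f := fun p => -1 * Z p) (g := fun p => decayWeight M p.2 * P.qt p)
      (by fun_prop) (by fun_prop),
    integral_integral_const_mul, integral_integral_const_mul (5 / M ^ 2)
      (fun p => decayWeight M p.2 * P.q0 p), ← key] at mono
  have d1 := hB T hT
  have d2 := mul_le_mul_of_nonneg_left (integral_decayWeight_q0_le hM hE hR h0 hT)
    (by positivity : 0 ≤ 5 / M ^ 2)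
  linarith [b1.1, b2.2]

/-- The energy of the dilation field `(t + R₀) ∂_t + r_* ∂_{r_*}` stays bounded. -/
theorem integral_dilation_le {B : ℝ} (hB : ∀ T : ℝ, 0 ≤ T →
    ∫ t in 0..T, ∫ x in -(R₀ + T + 1)..R₀ + T + 1, decayWeight M x * P.qt (t, x) ≤ B) :
    ∃ C, ∀ T : ℝ, 0 ≤ T → ∫ x in -(R₀ + T + 1)..R₀ + T + 1,
      ((T + R₀) * P.e (T, x) + 2 * x * P.m (T, x)) ≤ C := by
  obtain ⟨C, hC⟩ := integral_decayWeight_qy_le hM hE hR h0 hB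
  obtain ⟨D, hD, hDw⟩ := dilation_weights_le hM
  have hec := (P.contDiff_e hM).continuous
  have hmc := P.contDiff_m.continuous
  have hqy := P.contDiff_qy.continuous
  have hw' := (contDiff_decayWeight hM 1).continuous
  have hV' := (contDiff_V₁ hM 1).continuous
  refine ⟨2 * R₀ * (E (0, R₀) - E (0, -R₀)) + 2 * D * C, fun T hT => ?_⟩
  have hs := hE.supportedIn hM h0
  have key := P.integral_multDensity hM 1 hR hs (f := fun x => x) (f' := fun _ => 1)
    (g := fun _ => 0) (g' := fun _ => 0) (g'' := fun _ => 0)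
    contDiff_id contDiff_const contDiff_const (fun x => hasDerivAt_id x)
    (fun x => hasDerivAt_const x 0) (fun x => hasDerivAt_const x 0) hT
  -- On the initial slice the energy density lives in `|x| < R₀`, so the momentum term costs at most
  -- another `R₀ e`.
  have hAle : ∀ x, P.multDensity 1 R₀ (fun x => x) (fun _ => 0) (0, x)
      ≤ 2 * R₀ * P.e (0, x) := by
    intro x
    simp only [multDensity, one_mul, zero_add, zero_mul, add_zero]
    have hm := P.two_mul_abs_m_le_e hM (0, x)
    have he := P.e_nonneg hM (0, x)
    rcases le_or_gt R₀ |x| with h | h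
    · have he0 := h0 x h
      rw [he0] at hm ⊢
      have := abs_nonpos_iff.1 hm
      have hm0 : P.m (0, x) = 0 := by linarith
      simp [hm0]
    · have : x * (2 * P.m (0, x)) ≤ R₀ * P.e (0, x) := by
        refine (le_abs_self _).trans ?_
        rw [abs_mul]
        exact mul_le_mul h.le hm (abs_nonneg _) hR
      linarith
  have b2 : ∫ x in -(R₀ + T + 1)..R₀ + T + 1, P.multDensity 1 R₀ (fun x => x) (fun _ => 0) (0, x)
      ≤ 2 * R₀ * (E (0, R₀) - E (0, -R₀)) := by
    have hA := (P.contDiff_multDensity hM 1 R₀ contDiff_id contDiff_const (f := fun x => x)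
      (g := fun _ => 0)).continuous
    refine (intervalIntegral.integral_mono_on (by linarith)
      (Continuous.intervalIntegrable (by fun_prop) _ _)
      (Continuous.intervalIntegrable (by fun_prop) _ _) fun x _ => hAle x).trans ?_
    rw [intervalIntegral.integral_const_mul, hE.integral_e hM]
    have a := hE.mem_Icc hM h0 (0, R₀ + T + 1)
    have b := hE.mem_Icc hM h0 (0, -(R₀ + T + 1))
    exact mul_le_mul_of_nonneg_left (by linarith [a.2, b.1]) (by linarith)
  have mono := integral_integral_mono (P.continuous_multBulk hM 1 (f := fun x => x)
    (f' := fun _ => 1) (g := fun _ => 0) (g'' := fun _ => 0) continuous_id continuous_const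
    continuous_const continuous_const)
    (g := fun p => 2 * D * (decayWeight M p.2 * V₁ M p.2 * P.qy p)) (by fun_prop)
    (fun p => P.dilation_bulk_le hM hD (hDw p.2).1 (hDw p.2).2) hT
    (by linarith : -(R₀ + T + 1) ≤ R₀ + T + 1)
  rw [← key, integral_integral_const_mul (2 * D)
    (fun p => decayWeight M p.2 * V₁ M p.2 * P.qy p)] at mono
  have d := mul_le_mul_of_nonneg_left (hC T hT) (by positivity : 0 ≤ 2 * D)
  simp only [multDensity, one_mul, zero_mul, add_zero] at mono b2
  linarith

/-- The energy between the outgoing cone `u = U` and the incoming cone `v = V` decays. -/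
theorem energy_between_cones_le {B : ℝ} (hB : ∀ T : ℝ, 0 ≤ T →
    ∫ t in 0..T, ∫ x in -(R₀ + T + 1)..R₀ + T + 1, decayWeight M x * P.qt (t, x) ≤ B) :
    ∃ C, ∀ T U V : ℝ, 0 < U → 0 < V → U + V ≤ 2 * T →
      min U V * (E (T, T - U) - E (T, V - T)) ≤ C := by
  obtain ⟨C, hC⟩ := integral_dilation_le hM hE hR h0 hB
  refine ⟨C, fun T U V hU hV hT => (le_trans ?_ (hC T (by linarith)))⟩
  have hs := hE.supportedIn hM h0
  have hec := (P.contDiff_e hM).continuous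
  have hmc := P.contDiff_m.continuous
  have hT0 : 0 ≤ T := by linarith
  -- The dilation field is causal in `|x| ≤ T + R₀`, which contains the support of the solution, so
  -- its energy density is nonnegative everywhere on the slice. Between the two cones `T - |x| ≥ min
  -- U V`.
  have lower : ∀ x, |x| ≤ T + R₀ → (T + R₀ - |x|) * P.e (T, x)
      ≤ (T + R₀) * P.e (T, x) + 2 * x * P.m (T, x) := by
    intro x _
    have hm := P.two_mul_abs_m_le_e hM (T, x)
    have : |x * (2 * P.m (T, x))| ≤ |x| * P.e (T, x) := by
      rw [abs_mul]
      exact mul_le_mul_of_nonneg_left hm (abs_nonneg _)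
    have := (abs_le.1 this).1
    linarith
  have nonneg : ∀ x, 0 ≤ (T + R₀) * P.e (T, x) + 2 * x * P.m (T, x) := by
    intro x
    rcases le_or_gt |x| (T + R₀) with h | h
    · exact (mul_nonneg (by linarith) (P.e_nonneg hM _)).trans (lower x h)
    · have he : P.e (T, x) = 0 := hs T x (by rw [abs_of_nonneg hT0]; linarith)
      have hm0 := (P.eq_zero_of_e_eq_zero hM he).2.2.2.2.1
      simp [he, hm0]
  rw [← hE.integral_e hM, ← intervalIntegral.integral_const_mul]
  have hab : V - T ≤ T - U := by linarith
  calc ∫ x in V - T..T - U, min U V * P.e (T, x)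
      ≤ ∫ x in V - T..T - U, ((T + R₀) * P.e (T, x) + 2 * x * P.m (T, x)) := by
        refine intervalIntegral.integral_mono_on hab
          (Continuous.intervalIntegrable (by fun_prop) _ _)
          (Continuous.intervalIntegrable (by fun_prop) _ _) fun x hx => ?_
        have hx' : |x| ≤ T - min U V := by
          rw [abs_le]
          have := min_le_left U V
          have := min_le_right U V
          constructor <;> linarith [hx.1, hx.2]
        have hmin : 0 < min U V := lt_min hU hV
        refine le_trans ?_ (lower x (by linarith))
        exact mul_le_mul_of_nonneg_right (by linarith) (P.e_nonneg hM _)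
    _ ≤ ∫ x in -(R₀ + T + 1)..R₀ + T + 1, ((T + R₀) * P.e (T, x) + 2 * x * P.m (T, x)) := by
        refine intervalIntegral.integral_mono_interval (by linarith) hab (by linarith)
          (Eventually.of_forall nonneg) (Continuous.intervalIntegrable (by fun_prop) _ _)

end Profile

/-! ### Calculus on `ℝ × ℝ × (E3 \ {0})` -/

/-- Points `(t, r_*, y)`, with `y` a point of Euclidean space. -/
abbrev Pt : Type := ℝ × ℝ × E3

/-- The points with `y ≠ 0`. -/
def offAxis : Set Pt := {p | p.2.2 ≠ 0}

theorem isOpen_offAxis : IsOpen offAxis :=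
  isOpen_ne.preimage (continuous_snd.comp continuous_snd)

/-- Smoothness on the set of points with `y ≠ 0`. -/
def Sm {V : Type*} [NormedAddCommGroup V] [NormedSpace ℝ V] (g : Pt → V) : Prop :=
  ContDiffOn ℝ ((⊤ : ℕ∞) : WithTop ℕ∞) g offAxis

/-- The derivative along a constant vector. -/
def D {V : Type*} [NormedAddCommGroup V] [NormedSpace ℝ V] (w : Pt) (g : Pt → V) : Pt → V :=
  fun p => fderiv ℝ g p w

/-- The standard basis of Euclidean three-space. -/
abbrev b (i : Fin 3) : E3 := EuclideanSpace.single i 1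

/-- The direction of `∂_t`. -/
abbrev et : Pt := (1, 0, 0)

/-- The direction of `∂_{r_*}`. -/
abbrev ex : Pt := (0, 1, 0)

/-- The coordinate directions of Euclidean space. -/
abbrev ey (i : Fin 3) : Pt := (0, 0, b i)

theorem E3_eq_sum (w : E3) : w = ∑ i, w i • b i := by
  ext j
  simp [Pi.single_apply]

theorem inner_b (i : Fin 3) (w : E3) : inner ℝ (b i) w = w i := by
  simp [EuclideanSpace.inner_single_left]

section Calculus

variable {V : Type*} [NormedAddCommGroup V] [NormedSpace ℝ V]
  {V' : Type*} [NormedAddCommGroup V'] [NormedSpace ℝ V']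

namespace Sm

variable {g h : Pt → V} {p : Pt}

theorem contDiffAt (hg : Sm g) (hp : p ∈ offAxis) :
    ContDiffAt ℝ ((⊤ : ℕ∞) : WithTop ℕ∞) g p :=
  ContDiffOn.contDiffAt hg (isOpen_offAxis.mem_nhds hp)

theorem differentiableAt (hg : Sm g) (hp : p ∈ offAxis) : DifferentiableAt ℝ g p :=
  (hg.contDiffAt hp).differentiableAt (by simp)

theorem continuousOn (hg : Sm g) : ContinuousOn g offAxis := ContDiffOn.continuousOn hg

theorem fderiv (hg : Sm g) : Sm (fderiv ℝ g) :=
  ContDiffOn.fderiv_of_isOpen hg isOpen_offAxis (by simp)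

theorem D (hg : Sm g) (w : Pt) : Sm (D w g) :=
  ContDiffOn.clm_apply hg.fderiv contDiffOn_const

theorem const (c : V) : Sm fun _ => c := contDiffOn_const

theorem add (hg : Sm g) (hh : Sm h) : Sm fun p => g p + h p := ContDiffOn.add hg hh

theorem sub (hg : Sm g) (hh : Sm h) : Sm fun p => g p - h p := ContDiffOn.sub hg hh

theorem sum {ι : Type*} {s : Finset ι} {g : ι → Pt → V} (hg : ∀ i ∈ s, Sm (g i)) :
    Sm fun p => ∑ i ∈ s, g i p := ContDiffOn.sum hg

theorem smul {c : Pt → ℝ} (hc : Sm c) (hg : Sm g) : Sm fun p => c p • g p := ContDiffOn.smul hc hg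

theorem mul {c d : Pt → ℝ} (hc : Sm c) (hd : Sm d) : Sm fun p => c p * d p := ContDiffOn.mul hc hd

theorem clm (L : V →L[ℝ] V') (hg : Sm g) : Sm fun p => L (g p) :=
  L.contDiff.comp_contDiffOn hg

theorem inner {g h : Pt → E3} (hg : Sm g) (hh : Sm h) : Sm fun p => inner ℝ (g p) (h p) :=
  ContDiffOn.inner ℝ hg hh

theorem snd_snd : Sm fun p : Pt => p.2.2 := (contDiff_snd.comp contDiff_snd).contDiffOn

theorem coord (i : Fin 3) : Sm fun p : Pt => p.2.2 i :=
  clm (EuclideanSpace.proj i : E3 →L[ℝ] ℝ) snd_snd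

theorem congr (hg : Sm g) (h' : ∀ p ∈ offAxis, h p = g p) : Sm h := ContDiffOn.congr hg h'

end Sm

variable {g h : Pt → V} {p : Pt}

theorem D_congr (h' : ∀ p ∈ offAxis, g p = h p) (w : Pt) (hp : p ∈ offAxis) :
    D w g p = D w h p := by
  have : g =ᶠ[𝓝 p] h := by
    filter_upwards [isOpen_offAxis.mem_nhds hp] with q hq using h' q hq
  unfold D
  rw [this.fderiv_eq]

theorem D_comm (hg : Sm g) (v w : Pt) (hp : p ∈ offAxis) : D v (D w g) p = D w (D v g) p := by
  have hd := hg.fderiv.differentiableAt hp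
  have key : ∀ v w : Pt, D v (D w g) p = fderiv ℝ (fderiv ℝ g) p v w := by
    intro v w
    unfold D
    rw [fderiv_clm_apply hd (by fun_prop)]
    simp
  rw [key, key]
  exact ((hg.contDiffAt hp).isSymmSndFDerivAt (by
    rw [minSmoothness_of_isRCLikeNormedField]
    exact WithTop.coe_le_coe.2 (le_top : (2 : ℕ∞) ≤ ⊤))) v w

theorem D_const (c : V) (w : Pt) : D w (fun _ => c) p = 0 := by
  simp [D]

theorem D_add (hg : Sm g) (hh : Sm h) (w : Pt) (hp : p ∈ offAxis) :
    D w (fun p => g p + h p) p = D w g p + D w h p := by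
  unfold D
  rw [fderiv_fun_add (hg.differentiableAt hp) (hh.differentiableAt hp)]
  rfl

theorem D_sub (hg : Sm g) (hh : Sm h) (w : Pt) (hp : p ∈ offAxis) :
    D w (fun p => g p - h p) p = D w g p - D w h p := by
  unfold D
  rw [fderiv_fun_sub (hg.differentiableAt hp) (hh.differentiableAt hp)]
  rfl

theorem D_sum {ι : Type*} {s : Finset ι} {g : ι → Pt → V} (hg : ∀ i ∈ s, Sm (g i)) (w : Pt)
    (hp : p ∈ offAxis) : D w (fun p => ∑ i ∈ s, g i p) p = ∑ i ∈ s, D w (g i) p := by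
  unfold D
  rw [fderiv_fun_sum fun i hi => (hg i hi).differentiableAt hp]
  simp

theorem D_smul {c : Pt → ℝ} (hc : Sm c) (hg : Sm g) (w : Pt) (hp : p ∈ offAxis) :
    D w (fun p => c p • g p) p = c p • D w g p + D w c p • g p := by
  unfold D
  rw [fderiv_fun_smul (hc.differentiableAt hp) (hg.differentiableAt hp)]
  simp

theorem D_mul {c d : Pt → ℝ} (hc : Sm c) (hd : Sm d) (w : Pt) (hp : p ∈ offAxis) :
    D w (fun p => c p * d p) p = c p * D w d p + D w c p * d p := D_smul hc hd w hp

theorem D_clm (L : V →L[ℝ] V') (hg : Sm g) (w : Pt) (hp : p ∈ offAxis) :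
    D w (fun p => L (g p)) p = L (D w g p) := by
  unfold D
  have := (L.hasFDerivAt.comp p (hg.differentiableAt hp).hasFDerivAt).fderiv
  simp only [Function.comp_def] at this
  rw [this]
  rfl

theorem D_inner {g h : Pt → E3} (hg : Sm g) (hh : Sm h) (w : Pt) (hp : p ∈ offAxis) :
    D w (fun p => inner ℝ (g p) (h p)) p
      = inner ℝ (g p) (D w h p) + inner ℝ (D w g p) (h p) := by
  unfold D
  rw [fderiv_inner_apply ℝ (hg.differentiableAt hp) (hh.differentiableAt hp)]

theorem D_snd_snd (w : Pt) : D w (fun p : Pt => p.2.2) p = w.2.2 := by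
  unfold D
  have : HasFDerivAt (fun p : Pt => p.2.2)
      ((ContinuousLinearMap.snd ℝ ℝ E3).comp (ContinuousLinearMap.snd ℝ ℝ (ℝ × E3))) p :=
    ((ContinuousLinearMap.snd ℝ ℝ E3).comp
      (ContinuousLinearMap.snd ℝ ℝ (ℝ × E3))).hasFDerivAt
  rw [this.fderiv]
  rfl

theorem D_coord (w : Pt) (i : Fin 3) : D w (fun p : Pt => p.2.2 i) p = w.2.2 i := by
  unfold D
  have : HasFDerivAt (fun p : Pt => p.2.2 i)
      ((EuclideanSpace.proj i : E3 →L[ℝ] ℝ).comp ((ContinuousLinearMap.snd ℝ ℝ E3).comp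
        (ContinuousLinearMap.snd ℝ ℝ (ℝ × E3)))) p :=
    ((EuclideanSpace.proj i : E3 →L[ℝ] ℝ).comp ((ContinuousLinearMap.snd ℝ ℝ E3).comp
        (ContinuousLinearMap.snd ℝ ℝ (ℝ × E3)))).hasFDerivAt
  rw [this.fderiv]
  rfl

theorem D_lin (g : Pt → V) (p : Pt) (c₁ c₂ : ℝ) (w₁ w₂ : Pt) :
    D (c₁ • w₁ + c₂ • w₂) g p = c₁ • D w₁ g p + c₂ • D w₂ g p := by
  simp [D]

theorem D_sphere (g : Pt → V) (p : Pt) (w : E3) :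
    D (0, 0, w) g p = ∑ i, w i • D (ey i) g p := by
  have : ((0, 0, w) : Pt) = ∑ i, w i • ey i := by
    simp only [Prod.ext_iff, Prod.fst_sum, Prod.snd_sum, Prod.smul_mk, smul_zero,
      Finset.sum_const_zero, true_and]
    exact E3_eq_sum w
  rw [this]
  unfold D
  simp only [map_sum, map_smul]

/-- Homogeneity of degree `-n` in `y`. -/
def Hom (n : ℕ) (g : Pt → V) : Prop :=
  ∀ (t x : ℝ) (y : E3) (c : ℝ), 0 < c → y ≠ 0 → c ^ n • g (t, x, c • y) = g (t, x, y)

namespace Hom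

variable {n : ℕ}

/-- The homogeneity relation is differentiated along `y + s w`; the chain rule supplies the
additional factor `c`. -/
theorem D_y (hn : Hom n g) (hg : Sm g) (w : E3) : Hom (n + 1) (D (0, 0, w) g) := by
  intro t x y c hc hy
  have hy' : (t, x, c • y) ∈ offAxis := smul_ne_zero hc.ne' hy
  have h1 := HasFDerivAt.comp_hasDerivAt (f := fun s : ℝ => ((t, x, c • (y + s • w)) : Pt)) 0
    (by simpa using (hg.differentiableAt hy').hasFDerivAt)
    ((hasDerivAt_const (0 : ℝ) t).prodMk ((hasDerivAt_const (0 : ℝ) x).prodMk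
      ((((hasDerivAt_id (0 : ℝ)).smul_const w).const_add y).const_smul c)))
  have h2 := HasFDerivAt.comp_hasDerivAt (f := fun s : ℝ => ((t, x, y + s • w) : Pt)) 0
    (by simpa using (hg.differentiableAt (p := (t, x, y)) hy).hasFDerivAt)
    ((hasDerivAt_const (0 : ℝ) t).prodMk ((hasDerivAt_const (0 : ℝ) x).prodMk
      (((hasDerivAt_id (0 : ℝ)).smul_const w).const_add y)))
  have hev : ∀ᶠ s : ℝ in 𝓝 0, y + s • w ≠ 0 := by
    have : ContinuousAt (fun s : ℝ => y + s • w) 0 := by fun_prop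
    exact this.eventually_ne (by simpa using hy)
  have h3 := (h1.const_smul (c ^ n)).congr_of_eventuallyEq (f₁ := fun s => g (t, x, y + s • w)) (by
    filter_upwards [hev] with s hs
    exact (hn t x _ c hc hs).symm)
  have h4 := h3.unique h2
  simp only [one_smul] at h4
  have h5 : ((0, 0, c • w) : Pt) = c • (0, 0, w) := by simp
  rw [h5, map_smul, smul_smul, ← pow_succ] at h4
  exact h4

theorem D_tx (hn : Hom n g) (hg : Sm g) (w₁ w₂ : ℝ) : Hom n (D (w₁, w₂, 0) g) := by
  intro t x y c hc hy
  have hy' : (t, x, c • y) ∈ offAxis := smul_ne_zero hc.ne' hy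
  have path : ∀ z : E3, HasDerivAt (fun s : ℝ => ((t + s * w₁, x + s * w₂, z) : Pt))
      (w₁, w₂, 0) 0 := fun z => by
    have := (((hasDerivAt_id (0 : ℝ)).mul_const w₁).const_add t).prodMk
      ((((hasDerivAt_id (0 : ℝ)).mul_const w₂).const_add x).prodMk (hasDerivAt_const (0 : ℝ) z))
    simpa using this
  have h1 := HasFDerivAt.comp_hasDerivAt (f := fun s : ℝ => ((t + s * w₁, x + s * w₂, c • y) : Pt)) 0
    (by simpa using (hg.differentiableAt hy').hasFDerivAt) (path _)
  have h2 := HasFDerivAt.comp_hasDerivAt (f := fun s : ℝ => ((t + s * w₁, x + s * w₂, y) : Pt)) 0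
    (by simpa using (hg.differentiableAt (p := (t, x, y)) hy).hasFDerivAt) (path _)
  have h3 := (h1.const_smul (c ^ n)).congr_of_eventuallyEq
    (f₁ := fun s => g (t + s * w₁, x + s * w₂, y))
    (Eventually.of_forall fun s => (hn _ _ _ c hc hy).symm)
  exact h3.unique h2

/-- Euler's relation. -/
theorem euler (hn : Hom 0 g) (hg : Sm g) (hp : p ∈ offAxis) :
    ∑ i, p.2.2 i • D (ey i) g p = 0 := by
  rw [← D_sphere]
  obtain ⟨t, x, y⟩ := p
  have h1 := HasFDerivAt.comp_hasDerivAt (f := fun s : ℝ => ((t, x, s • y) : Pt)) 1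
    (by simpa using (hg.differentiableAt hp).hasFDerivAt)
    ((hasDerivAt_const (1 : ℝ) t).prodMk ((hasDerivAt_const (1 : ℝ) x).prodMk
      ((hasDerivAt_id (1 : ℝ)).smul_const y)))
  have h2 := (hasDerivAt_const (1 : ℝ) (g (t, x, y))).congr_of_eventuallyEq
    (f₁ := fun s => g (t, x, s • y)) (by
      filter_upwards [eventually_gt_nhds (zero_lt_one (α := ℝ))] with s hs
      have := hn t x y s hs hp
      simpa using this)
  simpa [D] using h1.unique h2

end Hom

end Calculus

/-- The Laplacian of Euclidean space, applied to each component. -/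
def lap (G : Pt → E3) (p : Pt) : E3 := ∑ i, D (ey i) (D (ey i) G) p

theorem Sm.lap {G : Pt → E3} (hG : Sm G) : Sm (lap G) := Sm.sum fun _ _ => (hG.D _).D _

theorem Hom.lap {G : Pt → E3} (h : Hom 0 G) (hG : Sm G) : Hom 2 (lap G) := by
  intro t x y c hc hy
  unfold Schwarzschild.lap
  rw [Finset.smul_sum]
  exact Finset.sum_congr rfl fun i _ => (h.D_y hG (b i)).D_y (hG.D _) (b i) t x y c hc hy

/-- The extension to `y ≠ 0`, homogeneous of degree zero, of a solution of the Fackerell-Ipser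
equation. -/
structure Wave (M : ℝ) (G : Pt → E3) : Prop where
  smooth : Sm G
  homog : Hom 0 G
  tangential : ∀ p ∈ offAxis, inner ℝ p.2.2 (G p) = 0
  equation : ∀ p ∈ offAxis, D et (D et G) p - D ex (D ex G) p =
    V₁ M p.2.1 • ((‖p.2.2‖ ^ 2) • lap G p - (inner ℝ p.2.2 (lap G p)) • p.2.2
      - (2 * M * R M p.2.1) • G p)

/-- The extension of a field on the exterior, homogeneous of degree zero in `y`. -/
def extField (Φ : Field) (p : Pt) : E3 := radialExt (Φ p.1 p.2.1) p.2.2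

/-! ### The homogeneous extension of a field. -/

section Extension

theorem radialExt_smul (X : S2 → E3) (x : E3) {c : ℝ} (hc : 0 < c) :
    radialExt X (c • x) = radialExt X x := by
  unfold radialExt
  by_cases h : x = 0
  · simp [h]
  · rw [dif_neg h, dif_neg (smul_ne_zero hc.ne' h)]
    congr 2
    rw [norm_smul, Real.norm_of_nonneg hc.le, smul_smul, mul_inv]
    congr 1
    field_simp

theorem sphere_ne_zero (ω : S2) : (ω : E3) ≠ 0 := ne_zero_of_mem_unit_sphere ω

theorem norm_sphere (ω : S2) : ‖(ω : E3)‖ = 1 := norm_eq_of_mem_sphere ω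

theorem mem_offAxis (t x : ℝ) (ω : S2) : ((t, x, (ω : E3)) : Pt) ∈ offAxis := sphere_ne_zero ω

theorem radialExt_coe (X : S2 → E3) (ω : S2) : radialExt X ω = X ω := by
  unfold radialExt
  rw [dif_neg (sphere_ne_zero ω)]
  congr 1
  ext1
  simp

theorem extField_coe (Φ : Field) (t x : ℝ) (ω : S2) : extField Φ (t, x, ω) = Φ t x ω :=
  radialExt_coe _ ω

/-- A point with `y ≠ 0` is a positive multiple of a point of the sphere. -/
theorem exists_smul_sphere {y : E3} (hy : y ≠ 0) : ∃ ω : S2, y = ‖y‖ • (ω : E3) := by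
  refine ⟨⟨‖y‖⁻¹ • y, ?_⟩, ?_⟩
  · rw [mem_sphere_zero_iff_norm, norm_smul, norm_inv, norm_norm,
      inv_mul_cancel₀ (norm_ne_zero_iff.2 hy)]
  · rw [smul_smul, mul_inv_cancel₀ (norm_ne_zero_iff.2 hy), one_smul]

theorem deriv_t_eq_D {V : Type*} [NormedAddCommGroup V] [NormedSpace ℝ V] {g : Pt → V} (hg : Sm g)
    {t x : ℝ} {y : E3} (hy : y ≠ 0) : HasDerivAt (fun s => g (s, x, y)) (D et g (t, x, y)) t :=
  HasFDerivAt.comp_hasDerivAt (f := fun s : ℝ => ((s, x, y) : Pt)) t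
    (hg.differentiableAt (p := (t, x, y)) hy).hasFDerivAt
    ((hasDerivAt_id t).prodMk (hasDerivAt_const t (x, y)))

theorem deriv_x_eq_D {V : Type*} [NormedAddCommGroup V] [NormedSpace ℝ V] {g : Pt → V} (hg : Sm g)
    {t x : ℝ} {y : E3} (hy : y ≠ 0) : HasDerivAt (fun s => g (t, s, y)) (D ex g (t, x, y)) x :=
  HasFDerivAt.comp_hasDerivAt (f := fun s : ℝ => ((t, s, y) : Pt)) x
    (hg.differentiableAt (p := (t, x, y)) hy).hasFDerivAt
    ((hasDerivAt_const x t).prodMk ((hasDerivAt_id x).prodMk (hasDerivAt_const x y)))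

theorem fderiv_y_eq_D {V : Type*} [NormedAddCommGroup V] [NormedSpace ℝ V] {g : Pt → V}
    (hg : Sm g) {t x : ℝ} {y : E3} (hy : y ≠ 0) (w : E3) :
    fderiv ℝ (fun z => g (t, x, z)) y w = D (0, 0, w) g (t, x, y) := by
  have h := HasFDerivAt.comp (f := fun z : E3 => ((t, x, z) : Pt)) y
    (hg.differentiableAt (p := (t, x, y)) hy).hasFDerivAt
    ((hasFDerivAt_const t y).prodMk ((hasFDerivAt_const x y).prodMk (hasFDerivAt_id y)))
  have h' : fderiv ℝ (fun z => g (t, x, z)) y = _ := h.fderiv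
  rw [h']
  rfl

theorem tangentProj_eq_self {x w : E3} (h : inner ℝ x w = 0) : tangentProj x w = w := by
  simp [tangentProj, h]

theorem tangentProj_add (x w w' : E3) :
    tangentProj x (w + w') = tangentProj x w + tangentProj x w' := by
  simp only [tangentProj, inner_add_right, add_div, add_smul]
  abel

theorem tangentProj_smul (x w : E3) (c : ℝ) :
    tangentProj x (c • w) = c • tangentProj x w := by
  simp only [tangentProj, inner_smul_right, smul_sub, smul_smul, mul_div_assoc]

theorem tangentProj_self {x : E3} (hx : x ≠ 0) : tangentProj x x = 0 := by
  have : ‖x‖ ^ 2 ≠ 0 := by positivity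
  simp [tangentProj, this]

end Extension

/-! ### From the tensorial equation to the Euclidean components. -/

namespace IsSolution

variable {M : ℝ} {Φ : Field} (hΦ : IsSolution M Φ)
include hΦ

theorem sm : Sm (extField Φ) := hΦ.smooth

omit hΦ in
theorem hom : Hom 0 (extField Φ) := fun t x y c hc _ => by
  simp [extField, radialExt_smul _ _ hc]

theorem Dt_eq (t x : ℝ) (ω : S2) : Dt Φ t x ω = D et (extField Φ) (t, x, ω) := by
  rw [← (deriv_t_eq_D hΦ.sm (sphere_ne_zero ω)).deriv]
  simp only [Dt, extField_coe]

theorem Dx_eq (t x : ℝ) (ω : S2) : Dx Φ t x ω = D ex (extField Φ) (t, x, ω) := by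
  rw [← (deriv_x_eq_D hΦ.sm (sphere_ne_zero ω)).deriv]
  simp only [Dx, extField_coe]

theorem DL_eq (t x : ℝ) (ω : S2) :
    DL Φ t x ω = D et (extField Φ) (t, x, ω) + D ex (extField Φ) (t, x, ω) := by
  rw [DL, hΦ.Dt_eq, hΦ.Dx_eq]

theorem DLbar_eq (t x : ℝ) (ω : S2) :
    DLbar Φ t x ω = D et (extField Φ) (t, x, ω) - D ex (extField Φ) (t, x, ω) := by
  rw [DLbar, hΦ.Dt_eq, hΦ.Dx_eq]

theorem DL_DLbar_eq (t x : ℝ) (ω : S2) :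
    DL (DLbar Φ) t x ω = D et (D et (extField Φ)) (t, x, ω) - D ex (D ex (extField Φ)) (t, x, ω) := by
  have h1 : Dt (DLbar Φ) t x ω =
      D et (D et (extField Φ)) (t, x, ω) - D et (D ex (extField Φ)) (t, x, ω) := by
    unfold Dt
    simp only [hΦ.DLbar_eq]
    exact ((deriv_t_eq_D (hΦ.sm.D et) (sphere_ne_zero ω)).sub
      (deriv_t_eq_D (hΦ.sm.D ex) (sphere_ne_zero ω))).deriv
  have h2 : Dx (DLbar Φ) t x ω =
      D ex (D et (extField Φ)) (t, x, ω) - D ex (D ex (extField Φ)) (t, x, ω) := by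
    unfold Dx
    simp only [hΦ.DLbar_eq]
    exact ((deriv_x_eq_D (hΦ.sm.D et) (sphere_ne_zero ω)).sub
      (deriv_x_eq_D (hΦ.sm.D ex) (sphere_ne_zero ω))).deriv
  rw [DL, h1, h2, D_comm hΦ.sm et ex (mem_offAxis t x ω)]
  abel

theorem inner_ext (p : Pt) (hp : p ∈ offAxis) : inner ℝ p.2.2 (extField Φ p) = 0 := by
  obtain ⟨t, x, y⟩ := p
  obtain ⟨ω, hω⟩ := exists_smul_sphere (y := y) hp
  have hn : 0 < ‖y‖ := norm_pos_iff.2 hp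
  simp only [extField]
  rw [hω, radialExt_smul _ _ hn, radialExt_coe, inner_smul_left, hΦ.tangential]
  simp

/-- Differentiating the tangentiality relation yields the normal part of each derivative. This is
the source of all the curvature corrections below. -/
theorem inner_D_ext (p : Pt) (hp : p ∈ offAxis) (i : Fin 3) :
    inner ℝ p.2.2 (D (ey i) (extField Φ) p) = -(extField Φ p i) := by
  have h1 := D_inner Sm.snd_snd hΦ.sm (ey i) hp
  rw [D_congr (g := fun p => inner ℝ p.2.2 (extField Φ p)) (h := fun _ => (0 : ℝ)) hΦ.inner_ext _ hp,
    D_const, D_snd_snd, inner_b] at h1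
  linarith

theorem sphereCovDeriv_eq (t x : ℝ) {y : E3} (hy : y ≠ 0) (i : Fin 3) :
    sphereCovDeriv (Φ t x) y (b i) = D (ey i) (extField Φ) (t, x, y)
      + (extField Φ (t, x, y) i / ‖y‖ ^ 2) • y := by
  unfold sphereCovDeriv tangentProj
  have h := fderiv_y_eq_D (t := t) (x := x) hΦ.sm hy (b i)
  have h' : fderiv ℝ (radialExt (Φ t x)) y (b i) = D (ey i) (extField Φ) (t, x, y) := h
  rw [h', hΦ.inner_D_ext (t, x, y) hy i, neg_div, neg_smul, sub_neg_eq_add]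

/-- The Euclidean derivative in the direction `b i` has normal component minus the `i`-th component
of the field; by Pythagoras these contribute `|Φ|²` in total. -/
theorem sphereGradSq_eq (t x : ℝ) (ω : S2) :
    sphereGradSq (Φ t x) ω + ‖Φ t x ω‖ ^ 2 = ∑ i, ‖D (ey i) (extField Φ) (t, x, ω)‖ ^ 2 := by
  have hn : ‖Φ t x ω‖ ^ 2 = ∑ i, (Φ t x ω i) ^ 2 := by
    rw [EuclideanSpace.norm_sq_eq]
    simp
  rw [sphereGradSq, hn, ← Finset.sum_add_distrib]
  refine Finset.sum_congr rfl fun i _ => ?_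
  rw [hΦ.sphereCovDeriv_eq t x (sphere_ne_zero ω), norm_add_sq_real, inner_smul_right,
    real_inner_comm, hΦ.inner_D_ext _ (mem_offAxis t x ω), norm_smul, norm_sphere, extField_coe]
  simp only [one_pow, div_one, mul_one, Real.norm_eq_abs, sq_abs]
  ring

/-- Differentiating the normal correction of the covariant derivative gives `Σ Φ_i b_i = Φ` and a
radial vector that the projection removes. The additional `Φ` cancels the `1` of `2MR + 1` in the
equation. -/
theorem sphereLaplacian_eq (t x : ℝ) (ω : S2) : sphereLaplacian (Φ t x) ω =
    tangentProj ω (lap (extField Φ) (t, x, ω)) + Φ t x ω := by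
  have key : ∀ i, fderiv ℝ (fun y : E3 => sphereCovDeriv (Φ t x) y (b i)) ω (b i) =
      D (ey i) (D (ey i) (extField Φ)) (t, x, ω)
      + (Φ t x ω i • b i + D (ey i) (fun p => extField Φ p i * (‖p.2.2‖ ^ 2)⁻¹) (t, x, ω)
          • (ω : E3)) := by
    intro i
    have hc : Sm fun p : Pt => extField Φ p i * (‖p.2.2‖ ^ 2)⁻¹ := by
      refine Sm.mul (Sm.clm (EuclideanSpace.proj i : E3 →L[ℝ] ℝ) hΦ.sm) ?_
      refine ContDiffOn.inv (ContDiffOn.norm_sq ℝ Sm.snd_snd) fun p hp => ?_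
      have : p.2.2 ≠ 0 := hp
      positivity
    have hs : Sm fun p : Pt => (extField Φ p i * (‖p.2.2‖ ^ 2)⁻¹) • p.2.2 := hc.smul Sm.snd_snd
    have hev : (fun y : E3 => sphereCovDeriv (Φ t x) y (b i)) =ᶠ[𝓝 (ω : E3)] fun y =>
        (fun p : Pt => D (ey i) (extField Φ) p + (extField Φ p i * (‖p.2.2‖ ^ 2)⁻¹) • p.2.2)
          (t, x, y) := by
      filter_upwards [isOpen_ne.mem_nhds (sphere_ne_zero ω)] with y hy
      rw [hΦ.sphereCovDeriv_eq t x hy, div_eq_mul_inv]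
    rw [hev.fderiv_eq, fderiv_y_eq_D (Sm.add (hΦ.sm.D _) hs) (sphere_ne_zero ω),
      D_add (hΦ.sm.D _) hs _ (mem_offAxis t x ω), D_smul hc Sm.snd_snd _ (mem_offAxis t x ω),
      D_snd_snd, extField_coe, norm_sphere]
    simp
  have ht : inner ℝ (ω : E3) (Φ t x ω) = 0 := hΦ.tangential t x ω
  unfold sphereLaplacian
  rw [Finset.sum_congr rfl fun i _ => key i, Finset.sum_add_distrib, Finset.sum_add_distrib,
    ← E3_eq_sum, ← Finset.sum_smul, tangentProj_add, tangentProj_add, tangentProj_smul,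
    tangentProj_self (sphere_ne_zero ω), tangentProj_eq_self ht, smul_zero, add_zero]
  rfl

/-- The equation is known on the unit sphere. All its terms are homogeneous of degree zero, thanks
to the factor `‖y‖²` in front of the Laplacian, so it extends to every `y ≠ 0`. -/
theorem wave : Wave M (extField Φ) where
  smooth := hΦ.sm
  homog := hom
  tangential := hΦ.inner_ext
  equation := by
    rintro ⟨t, x, y⟩ hp
    obtain ⟨ω, hω⟩ := exists_smul_sphere (y := y) hp
    have hn : 0 < ‖y‖ := norm_pos_iff.2 hp
    set c := ‖y‖
    have h1 := (hom.D_tx hΦ.sm 1 0).D_tx (hΦ.sm.D et) 1 0 t x ω c hn (sphere_ne_zero ω)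
    have h2 := (hom.D_tx hΦ.sm 0 1).D_tx (hΦ.sm.D ex) 0 1 t x ω c hn (sphere_ne_zero ω)
    have h3 := hom.lap hΦ.sm t x ω c hn (sphere_ne_zero ω)
    have h4 := hom (Φ := Φ) t x ω c hn (sphere_ne_zero ω)
    have he := hΦ.equation t x ω
    rw [hΦ.DL_DLbar_eq, hΦ.sphereLaplacian_eq] at he
    simp only [pow_zero, one_smul, ← hω] at h1 h2 h3 h4
    have h5 : inner ℝ y (lap (extField Φ) (t, x, y)) • y
        = inner ℝ (ω : E3) (lap (extField Φ) (t, x, ω)) • (ω : E3) := by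
      rw [← h3]
      generalize lap (extField Φ) (t, x, y) = A
      rw [hω, inner_smul_left, inner_smul_right, smul_smul]
      congr 1
      simp only [conj_trivial]
      ring
    have h6 : V₁ M x = F M x * R M x ^ 2 := by
      rw [F_eq, V₁]
      ring
    simp only
    rw [h1, h2, h3, h4, h5, extField_coe, h6]
    rw [tangentProj, norm_sphere] at he
    refine sub_eq_zero.1 (Eq.trans ?_ he)
    module

end IsSolution

/-! ### Integration over the unit sphere -/

instance : IsFiniteMeasure area := inferInstanceAs (IsFiniteMeasure (volume : Measure E3).toSphere)

theorem integrable_sphere {V : Type*} [NormedAddCommGroup V] {k : S2 → V} (hk : Continuous k) :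
    Integrable k area :=
  hk.integrable_of_hasCompactSupport (HasCompactSupport.of_compactSpace k)

/-- The integral over the unit sphere, as a function of `(t, r_*)`. -/
def sInt (g : Pt → ℝ) (z : ℝ × ℝ) : ℝ := ∫ ω, g (z.1, z.2, (ω : E3)) ∂area

section SphereIntegral

variable {g h : Pt → ℝ}

theorem Sm.continuous_sphere {V : Type*} [NormedAddCommGroup V] [NormedSpace ℝ V] {g : Pt → V}
    (hg : Sm g) : Continuous fun p : (ℝ × ℝ) × S2 => g (p.1.1, p.1.2, (p.2 : E3)) :=
  hg.continuousOn.comp_continuous (by fun_prop) fun p => sphere_ne_zero p.2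

theorem Sm.continuous_sphere_right {V : Type*} [NormedAddCommGroup V] [NormedSpace ℝ V]
    {g : Pt → V} (hg : Sm g) (t x : ℝ) : Continuous fun ω : S2 => g (t, x, (ω : E3)) :=
  hg.continuous_sphere.comp (f := fun ω : S2 => ((t, x), ω)) (by fun_prop)

theorem Sm.integrable (hg : Sm g) (t x : ℝ) : Integrable (fun ω : S2 => g (t, x, (ω : E3))) area :=
  integrable_sphere (hg.continuous_sphere_right t x)

theorem continuous_sInt (hg : Sm g) : Continuous (sInt g) := by
  have := continuous_parametric_integral_of_continuous (μ := area) (s := Set.univ)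
    (f := fun (z : ℝ × ℝ) (ω : S2) => g (z.1, z.2, (ω : E3))) hg.continuous_sphere isCompact_univ
  simp only [Measure.restrict_univ] at this
  exact this

/-- Differentiation under the integral sign: the derivative is bounded on the compact product of a
closed ball around `z` and the sphere. -/
theorem hasFDerivAt_sInt (hg : Sm g) (z : ℝ × ℝ) : HasFDerivAt (sInt g)
    (sInt (D et g) z • ContinuousLinearMap.fst ℝ ℝ ℝ
      + sInt (D ex g) z • ContinuousLinearMap.snd ℝ ℝ ℝ) z := by
  have hc : Continuous fun p : (ℝ × ℝ) × S2 =>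
      D et g (p.1.1, p.1.2, (p.2 : E3)) • ContinuousLinearMap.fst ℝ ℝ ℝ
        + D ex g (p.1.1, p.1.2, (p.2 : E3)) • ContinuousLinearMap.snd ℝ ℝ ℝ :=
    ((hg.D et).continuous_sphere.smul continuous_const).add
      ((hg.D ex).continuous_sphere.smul continuous_const)
  obtain ⟨C, hC⟩ := ((isCompact_closedBall z 1).prod
    (isCompact_univ (X := S2))).exists_bound_of_continuousOn hc.continuousOn
  have key := hasFDerivAt_integral_of_dominated_of_fderiv_le (𝕜 := ℝ) (μ := area) (x₀ := z)
    (F := fun (z : ℝ × ℝ) (ω : S2) => g (z.1, z.2, (ω : E3)))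
    (F' := fun (z : ℝ × ℝ) (ω : S2) =>
      D et g (z.1, z.2, (ω : E3)) • ContinuousLinearMap.fst ℝ ℝ ℝ
        + D ex g (z.1, z.2, (ω : E3)) • ContinuousLinearMap.snd ℝ ℝ ℝ)
    (bound := fun _ => C) (Metric.closedBall_mem_nhds z one_pos)
    (Eventually.of_forall fun z => (hg.integrable z.1 z.2).aestronglyMeasurable)
    (hg.integrable z.1 z.2)
    ((hc.comp (f := fun ω : S2 => (z, ω)) (by fun_prop)).aestronglyMeasurable)
    (Eventually.of_forall fun ω z hz => hC (z, ω) ⟨hz, trivial⟩)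
    (integrable_const C) (Eventually.of_forall fun ω z _ => by
      have h1 := HasFDerivAt.comp (f := fun z : ℝ × ℝ => ((z.1, z.2, (ω : E3)) : Pt)) z
        (hg.differentiableAt (mem_offAxis z.1 z.2 ω)).hasFDerivAt
        (hasFDerivAt_fst.prodMk (hasFDerivAt_snd.prodMk (hasFDerivAt_const (ω : E3) z)))
      refine HasFDerivAt.congr_fderiv h1 ?_
      ext <;> simp [D])
  refine HasFDerivAt.congr_fderiv key ?_
  rw [integral_add ((hg.D et).integrable z.1 z.2 |>.smul_const _)
    ((hg.D ex).integrable z.1 z.2 |>.smul_const _), integral_smul_const, integral_smul_const]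
  rfl

theorem contDiff_sInt (hg : Sm g) : ContDiff ℝ 1 (sInt g) := by
  refine contDiff_one_iff_fderiv.2 ⟨fun z => (hasFDerivAt_sInt hg z).differentiableAt, ?_⟩
  have : fderiv ℝ (sInt g) = fun z => sInt (D et g) z • ContinuousLinearMap.fst ℝ ℝ ℝ
      + sInt (D ex g) z • ContinuousLinearMap.snd ℝ ℝ ℝ :=
    funext fun z => (hasFDerivAt_sInt hg z).fderiv
  rw [this]
  exact ((continuous_sInt (hg.D et)).smul continuous_const).add
    ((continuous_sInt (hg.D ex)).smul continuous_const)

theorem fderiv_sInt_fst (hg : Sm g) (z : ℝ × ℝ) : fderiv ℝ (sInt g) z (1, 0) = sInt (D et g) z := by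
  rw [(hasFDerivAt_sInt hg z).fderiv]
  simp

theorem fderiv_sInt_snd (hg : Sm g) (z : ℝ × ℝ) : fderiv ℝ (sInt g) z (0, 1) = sInt (D ex g) z := by
  rw [(hasFDerivAt_sInt hg z).fderiv]
  simp

theorem sInt_congr (h' : ∀ p ∈ offAxis, g p = h p) (z : ℝ × ℝ) : sInt g z = sInt h z := by
  unfold sInt
  congr 1
  funext ω
  exact h' _ (mem_offAxis _ _ ω)

theorem sInt_add (hg : Sm g) (hh : Sm h) (z : ℝ × ℝ) :
    sInt (fun p => g p + h p) z = sInt g z + sInt h z :=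
  integral_add (hg.integrable _ _) (hh.integrable _ _)

theorem sInt_const_mul (c : ℝ) (g : Pt → ℝ) (z : ℝ × ℝ) :
    sInt (fun p => c * g p) z = c * sInt g z :=
  integral_const_mul c fun ω : S2 => g (z.1, z.2, (ω : E3))

theorem sInt_nonneg (h' : ∀ p ∈ offAxis, 0 ≤ g p) (z : ℝ × ℝ) : 0 ≤ sInt g z :=
  integral_nonneg fun ω => h' _ (mem_offAxis _ _ ω)

theorem sInt_mono (hg : Sm g) (hh : Sm h)
    (h' : ∀ (t x : ℝ) (ω : S2), g (t, x, (ω : E3)) ≤ h (t, x, (ω : E3))) (z : ℝ × ℝ) :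
    sInt g z ≤ sInt h z :=
  integral_mono (hg.integrable _ _) (hh.integrable _ _) fun ω => h' _ _ ω

end SphereIntegral

/-! ### Polar coordinates and integration by parts on the sphere -/

/-- In polar coordinates the integrand separates, as `g` sees only the direction and `f` only the
radius. It lets sphere integrals be computed as Euclidean ones. -/
theorem integral_polar (f : ℝ → ℝ) {g : E3 → ℝ}
    (hg : ∀ (c : ℝ) (y : E3), 0 < c → y ≠ 0 → g (c • y) = g y) :
    ∫ y : E3, f ‖y‖ * g y =
      (∫ ω, g (ω : E3) ∂area) * ∫ r : Set.Ioi (0 : ℝ), f r ∂(Measure.volumeIoiPow 2) := by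
  have hd : Module.finrank ℝ E3 - 1 = 2 := by simp
  calc ∫ y : E3, f ‖y‖ * g y
      = ∫ y : ({(0)}ᶜ : Set E3), f ‖y.1‖ * g y.1 ∂((volume : Measure E3).comap (↑)) := by
        rw [integral_subtype_comap (measurableSet_singleton _).compl fun y : E3 => f ‖y‖ * g y,
          restrict_compl_singleton]
    _ = ∫ q : S2 × Set.Ioi (0 : ℝ), g (q.1 : E3) * f q.2
          ∂((volume : Measure E3).toSphere.prod (.volumeIoiPow (Module.finrank ℝ E3 - 1))) := by
        rw [← ((volume : Measure E3).measurePreserving_homeomorphUnitSphereProd).integral_comp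
          (Homeomorph.measurableEmbedding _)]
        congr 1
        funext y
        have hy : (y : E3) ≠ 0 := y.2
        have hn : 0 < ‖(y : E3)‖⁻¹ := inv_pos.2 (norm_pos_iff.2 hy)
        simp only [homeomorphUnitSphereProd_apply_fst_coe, homeomorphUnitSphereProd_apply_snd_coe,
          hg _ _ hn hy]
        ring
    _ = _ := by
        rw [integral_prod_mul (fun ω : S2 => g (ω : E3)) fun r : Set.Ioi (0 : ℝ) => f r, hd]
        rfl

/-- A bump function at `1` on the real line. -/
def bump : ContDiffBump (1 : ℝ) := ⟨1 / 4, 1 / 2, by norm_num, by norm_num⟩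

/-- A radial cut-off function, supported away from the origin. -/
def cutoff (y : E3) : ℝ := bump (‖y‖ ^ 2)

theorem contDiff_cutoff {n : ℕ∞} : ContDiff ℝ n cutoff := bump.contDiff.comp (contDiff_norm_sq ℝ)

theorem cutoff_nonneg (y : E3) : 0 ≤ cutoff y := bump.nonneg

theorem cutoff_sphere (ω : S2) : cutoff ω = 1 := by
  unfold cutoff
  rw [norm_sphere]
  exact bump.one_of_mem_closedBall (by simp [bump])

theorem tsupport_cutoff_subset : tsupport cutoff ⊆ {y | 1 / 2 ≤ ‖y‖ ^ 2 ∧ ‖y‖ ^ 2 ≤ 3 / 2} := by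
  refine closure_minimal (fun y hy => ?_) ?_
  · have h : ‖y‖ ^ 2 ∈ Function.support bump := hy
    rw [bump.support_eq, Metric.mem_ball, Real.dist_eq, abs_lt] at h
    have h2 : bump.rOut = 1 / 2 := rfl
    rw [h2] at h
    constructor <;> linarith [h.1, h.2]
  · have hc : Continuous fun y : E3 => ‖y‖ ^ 2 := by fun_prop
    exact (isClosed_le continuous_const hc).inter (isClosed_le hc continuous_const)

theorem zero_notMem_tsupport_cutoff : (0 : E3) ∉ tsupport cutoff := fun h => by
  have := (tsupport_cutoff_subset h).1
  norm_num at this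

theorem hasCompactSupport_cutoff : HasCompactSupport cutoff := by
  refine HasCompactSupport.of_support_subset_isCompact (isCompact_closedBall (0 : E3) 2) ?_
  intro y hy
  have := (tsupport_cutoff_subset (subset_tsupport _ hy)).2
  rw [mem_closedBall_zero_iff]
  nlinarith [norm_nonneg y]

/-- The mass of the cut-off function along a ray. -/
def rayMass : ℝ := ∫ r : Set.Ioi (0 : ℝ), bump ((r : ℝ) ^ 2) ∂(Measure.volumeIoiPow 2)

theorem integral_cutoff_mul {g : E3 → ℝ}
    (hg : ∀ (c : ℝ) (y : E3), 0 < c → y ≠ 0 → g (c • y) = g y) :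
    ∫ y : E3, cutoff y * g y = (∫ ω, g (ω : E3) ∂area) * rayMass :=
  integral_polar (fun r => bump (r ^ 2)) hg

instance : Nonempty S2 := ⟨⟨b 0, by simp [b]⟩⟩

/-- Otherwise polar coordinates with `g = 1` would make the integral of the cut-off vanish. -/
theorem rayMass_ne_zero : rayMass ≠ 0 := by
  have h1 := integral_cutoff_mul (g := fun _ => 1) fun _ _ _ _ => rfl
  have h2 : 0 < ∫ y : E3, cutoff y := by
    obtain ⟨ω⟩ := (inferInstance : Nonempty S2)
    exact (contDiff_cutoff (n := 0)).continuous.integral_pos_of_hasCompactSupport_nonneg_nonzero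
      hasCompactSupport_cutoff cutoff_nonneg (x := ω) (by simp [cutoff_sphere])
  intro h
  rw [h, mul_zero] at h1
  simp only [mul_one] at h1
  linarith

theorem integral_fderiv_eq_zero {k : E3 → ℝ} (hk : ContDiff ℝ 1 k) (hs : HasCompactSupport k)
    (w : E3) : ∫ y, fderiv ℝ k y w = 0 := by
  have hd : Continuous fun y => fderiv ℝ k y w :=
    (hk.continuous_fderiv one_ne_zero).clm_apply continuous_const
  have hsd : HasCompactSupport fun y => fderiv ℝ k y w := hs.fderiv_apply ℝ w
  have h := integral_mul_fderiv_eq_neg_fderiv_mul_of_integrable (μ := (volume : Measure E3))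
    (f := fun _ => (1 : ℝ)) (g := k) (v := w) (by simp)
    (by simpa using hd.integrable_of_hasCompactSupport hsd)
    (by simpa using hk.continuous.integrable_of_hasCompactSupport hs)
    (by fun_prop) (by exact fun y _ => hk.differentiable one_ne_zero y)
  simpa using h

/-- A smooth function off the origin, times a function that vanishes near the origin. -/
theorem contDiff_smul_of_notMem_tsupport {V : Type*} [NormedAddCommGroup V] [NormedSpace ℝ V]
    {c : E3 → ℝ} (hc : ContDiff ℝ ((⊤ : ℕ∞) : WithTop ℕ∞) c) (h0 : (0 : E3) ∉ tsupport c)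
    {g : Pt → V} (hg : Sm g) (t x : ℝ) :
    ContDiff ℝ ((⊤ : ℕ∞) : WithTop ℕ∞) fun y : E3 => c y • g (t, x, y) := by
  refine contDiff_iff_contDiffAt.2 fun y => ?_
  by_cases hy : y ∈ tsupport fun y : E3 => c y • g (t, x, y)
  swap
  · exact (contDiffAt_const (c := (0 : V))).congr_of_eventuallyEq
      (notMem_tsupport_iff_eventuallyEq.1 hy)
  have hy' : y ∈ tsupport c := tsupport_smul_subset_left c _ hy
  have hy0 : y ≠ 0 := fun h => h0 (h ▸ hy')
  exact hc.contDiffAt.smul (ContDiffAt.comp (f := fun y : E3 => ((t, x, y) : Pt)) y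
    (hg.contDiffAt (p := (t, x, y)) hy0) (by fun_prop))

theorem ae_ne_zero : ∀ᵐ y : E3, y ≠ 0 := compl_mem_ae_iff.2 (measure_singleton 0)

/-- Integration by parts on the sphere: the divergence of a field of degree `-1` that is orthogonal
to the radial direction integrates to zero. -/
theorem integral_sphere_div_eq_zero {H : Fin 3 → Pt → ℝ} (hH : ∀ i, Sm (H i))
    (hom : ∀ i, Hom 1 (H i)) (hrad : ∀ p ∈ offAxis, ∑ i, p.2.2 i * H i p = 0) (z : ℝ × ℝ) :
    sInt (fun p => ∑ i, D (ey i) (H i) p) z = 0 := by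
  have hnsq : Sm fun p : Pt => ‖p.2.2‖ ^ 2 := ContDiffOn.norm_sq ℝ Sm.snd_snd
  -- The divergence has degree `-2`; the factor `‖y‖²` brings it to degree zero, as polar
  -- coordinates require.
  have h1 := integral_cutoff_mul (g := fun y => ‖y‖ ^ 2 * ∑ i, D (ey i) (H i) (z.1, z.2, y)) (by
    intro c y hc hy
    have key : ∀ i, c ^ 2 • D (ey i) (H i) (z.1, z.2, c • y) = D (ey i) (H i) (z.1, z.2, y) :=
      fun i => (hom i).D_y (hH i) (b i) z.1 z.2 y c hc hy
    rw [norm_smul, Real.norm_of_nonneg hc.le, mul_pow, mul_right_comm, mul_comm (c ^ 2 * _),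
      Finset.mul_sum]
    simp only [smul_eq_mul] at key
    simp only [key])
  simp only [norm_sphere, one_pow, one_mul] at h1
  refine (mul_eq_zero.1 (h1.symm.trans ?_)).resolve_right rayMass_ne_zero
  have hcN : ContDiff ℝ ((⊤ : ℕ∞) : WithTop ℕ∞) cutoff := contDiff_cutoff
  have hk : ∀ i, ContDiff ℝ ((⊤ : ℕ∞) : WithTop ℕ∞)
      fun y : E3 => cutoff y • (‖y‖ ^ 2 * H i (z.1, z.2, y)) := fun i =>
    contDiff_smul_of_notMem_tsupport hcN zero_notMem_tsupport_cutoff (hnsq.mul (hH i)) z.1 z.2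
  have hks : ∀ i, HasCompactSupport fun y : E3 => cutoff y • (‖y‖ ^ 2 * H i (z.1, z.2, y)) :=
    fun i => hasCompactSupport_cutoff.smul_right
  have hcs : Sm fun p : Pt => cutoff p.2.2 := hcN.comp_contDiffOn Sm.snd_snd
  have hz : ∀ i, ∫ y, fderiv ℝ (fun y : E3 => cutoff y • (‖y‖ ^ 2 * H i (z.1, z.2, y))) y (b i) = 0 :=
    fun i => integral_fderiv_eq_zero ((hk i).of_le (by simp)) (hks i) (b i)
  -- A compactly supported divergence integrates to zero. It agrees with the weighted divergence of
  -- `H`, since the gradient of the radial factor is parallel to `y` and `H` is orthogonal to `y`.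
  have hsum : ∫ y, ∑ i, fderiv ℝ (fun y : E3 => cutoff y • (‖y‖ ^ 2 * H i (z.1, z.2, y))) y (b i)
      = 0 := by
    rw [integral_finsetSum]
    · exact Finset.sum_eq_zero fun i _ => hz i
    · intro i _
      exact (((hk i).continuous_fderiv (by simp)).clm_apply
        continuous_const).integrable_of_hasCompactSupport ((hks i).fderiv_apply ℝ (b i))
  rw [← hsum]
  refine integral_congr_ae ?_
  filter_upwards [ae_ne_zero] with y hy
  have hp : ((z.1, z.2, y) : Pt) ∈ offAxis := hy
  -- the derivative of the radial factor
  set c : Pt → ℝ := fun p => cutoff p.2.2 * ‖p.2.2‖ ^ 2 with hcdef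
  have hc : Sm c := hcs.mul hnsq
  have hD : ∀ i, D (ey i) c (z.1, z.2, y)
      = (deriv (fun s : ℝ => bump s * s) (‖y‖ ^ 2) * 2) * y i := by
    intro i
    have hb : HasDerivAt (fun s : ℝ => bump s * s) (deriv (fun s : ℝ => bump s * s) (‖y‖ ^ 2))
        (‖y‖ ^ 2) := by
      refine DifferentiableAt.hasDerivAt ?_
      exact ((bump.contDiff (n := 1)).differentiable one_ne_zero _).mul differentiableAt_id
    have hn : HasFDerivAt (fun p : Pt => ‖p.2.2‖ ^ 2) (fderiv ℝ (fun p : Pt => ‖p.2.2‖ ^ 2)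
        (z.1, z.2, y)) (z.1, z.2, y) := (hnsq.differentiableAt hp).hasFDerivAt
    have hn' : D (ey i) (fun p : Pt => ‖p.2.2‖ ^ 2) (z.1, z.2, y) = 2 * y i := by
      have h2 := D_inner Sm.snd_snd Sm.snd_snd (ey i) hp
      rw [D_congr (g := fun p : Pt => inner ℝ p.2.2 p.2.2) (h := fun p => ‖p.2.2‖ ^ 2)
        (fun p _ => real_inner_self_eq_norm_sq _) _ hp, D_snd_snd, real_inner_comm, inner_b] at h2
      rw [h2]
      ring
    have hcomp := HasDerivAt.comp_hasFDerivAt (z.1, z.2, y) hb hn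
    have : D (ey i) c (z.1, z.2, y) = _ := congrArg (fun L => L (ey i)) hcomp.fderiv
    rw [this]
    change _ * D (ey i) (fun p : Pt => ‖p.2.2‖ ^ 2) (z.1, z.2, y) = _
    rw [hn']
    ring
  have hE : ∀ i, fderiv ℝ (fun y : E3 => cutoff y • (‖y‖ ^ 2 * H i (z.1, z.2, y))) y (b i)
      = c (z.1, z.2, y) * D (ey i) (H i) (z.1, z.2, y)
        + (deriv (fun s : ℝ => bump s * s) (‖y‖ ^ 2) * 2) * (y i * H i (z.1, z.2, y)) := by
    intro i
    have e := fderiv_y_eq_D (t := z.1) (x := z.2) (hc.mul (hH i)) hy (b i)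
    rw [D_mul hc (hH i) _ hp, hD] at e
    have e' : (fun y : E3 => cutoff y • (‖y‖ ^ 2 * H i (z.1, z.2, y)))
        = fun y => c (z.1, z.2, y) * H i (z.1, z.2, y) := by
      funext y
      simp only [hcdef, smul_eq_mul]
      ring
    rw [e', e]
    ring
  have hr := hrad (z.1, z.2, y) hp
  simp only at hr
  simp only [hE, Finset.sum_add_distrib, ← Finset.mul_sum, hr, mul_zero, add_zero, hcdef]
  ring

/-- Green's identity on the sphere. -/
theorem sInt_inner_lap {K G : Pt → E3} (hK : Sm K) (hG : Sm G) (homK : Hom 0 K) (homG : Hom 0 G)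
    (z : ℝ × ℝ) : sInt (fun p => inner ℝ (K p) (lap G p)) z
      = -sInt (fun p => ∑ i, inner ℝ (D (ey i) K p) (D (ey i) G p)) z := by
  -- This field has degree `-1`, and Euler's relation for `G` makes it orthogonal to `y`.
  have hdiv := integral_sphere_div_eq_zero (H := fun i p => inner ℝ (K p) (D (ey i) G p))
    (fun i => hK.inner (hG.D _)) (fun i t x y c hc hy => by
      have h1 := homK t x y c hc hy
      have h2 := homG.D_y hG (b i) t x y c hc hy
      rw [pow_zero, one_smul] at h1
      rw [zero_add] at h2
      simp only [smul_eq_mul, h1, ← h2, inner_smul_right]) (fun p hp => by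
      have h := congrArg (fun w => inner ℝ (K p) w) (homG.euler hG hp)
      simpa [inner_sum, inner_smul_right] using h) z
  rw [eq_neg_iff_add_eq_zero, ← sInt_add (hK.inner hG.lap)
    (Sm.sum fun i _ => (hK.D _).inner (hG.D _)), ← hdiv]
  refine sInt_congr (fun p hp => ?_) z
  rw [lap, inner_sum, ← Finset.sum_add_distrib]
  exact Finset.sum_congr rfl fun i _ => (D_inner hK (hG.D _) (ey i) hp).symm


/-! ### The equation is preserved by time translations and rotations -/

theorem D_radial {φ : ℝ → ℝ} (hφ : Differentiable ℝ φ) {w : Pt} (hw : w.2.1 = 0) (p : Pt) :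
    D w (fun p : Pt => φ p.2.1) p = 0 := by
  have h1 : HasFDerivAt (fun p : Pt => p.2.1)
      ((ContinuousLinearMap.fst ℝ ℝ E3).comp (ContinuousLinearMap.snd ℝ ℝ (ℝ × E3))) p :=
    ((ContinuousLinearMap.fst ℝ ℝ E3).comp (ContinuousLinearMap.snd ℝ ℝ (ℝ × E3))).hasFDerivAt
  have h2 := HasDerivAt.comp_hasFDerivAt p (hφ p.2.1).hasDerivAt h1
  have : D w (fun p : Pt => φ p.2.1) p = _ := congrArg (fun L => L w) h2.fderiv
  rw [this]
  simp [hw]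

theorem Sm.radial {φ : ℝ → ℝ} (hφ : ContDiff ℝ ((⊤ : ℕ∞) : WithTop ℕ∞) φ) :
    Sm fun p : Pt => φ p.2.1 :=
  (hφ.comp (contDiff_fst.comp contDiff_snd)).contDiffOn

theorem contDiff_R_top {M : ℝ} (hM : 0 < M) : ContDiff ℝ ((⊤ : ℕ∞) : WithTop ℕ∞) (R M) :=
  contDiff_infty.2 fun n => contDiff_R hM n

theorem contDiff_V₁_top {M : ℝ} (hM : 0 < M) : ContDiff ℝ ((⊤ : ℕ∞) : WithTop ℕ∞) (V₁ M) :=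
  contDiff_infty.2 fun n => contDiff_V₁ hM n

theorem Sm.normSq : Sm fun p : Pt => ‖p.2.2‖ ^ 2 := ContDiffOn.norm_sq ℝ Sm.snd_snd

theorem D_normSq (w : Pt) {p : Pt} (hp : p ∈ offAxis) :
    D w (fun p : Pt => ‖p.2.2‖ ^ 2) p = 2 * inner ℝ p.2.2 w.2.2 := by
  have h2 := D_inner Sm.snd_snd Sm.snd_snd w hp
  rw [D_congr (g := fun p : Pt => inner ℝ p.2.2 p.2.2) (h := fun p => ‖p.2.2‖ ^ 2)
    (fun p _ => real_inner_self_eq_norm_sq _) _ hp, D_snd_snd, real_inner_comm] at h2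
  rw [h2, real_inner_comm]
  ring

theorem D_D_comm {G : Pt → E3} (hG : Sm G) (u v w : Pt) {p : Pt} (hp : p ∈ offAxis) :
    D u (D v (D w G)) p = D v (D w (D u G)) p := by
  rw [D_comm (hG.D w) u v hp, D_congr (fun q hq => D_comm hG u w hq) v hp]

theorem D_lap {G : Pt → E3} (hG : Sm G) (w : Pt) {p : Pt} (hp : p ∈ offAxis) :
    D w (lap G) p = lap (D w G) p := by
  unfold lap
  rw [D_sum (fun i _ => (hG.D _).D _) w hp]
  exact Finset.sum_congr rfl fun i _ => D_D_comm hG _ _ _ hp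

/-- The infinitesimal rotation in the plane of the coordinates `k` and `j`. -/
def rotGen (k j : Fin 3) : E3 →L[ℝ] E3 :=
  (EuclideanSpace.proj k : E3 →L[ℝ] ℝ).smulRight (b j)
    - (EuclideanSpace.proj j : E3 →L[ℝ] ℝ).smulRight (b k)

theorem rotGen_apply (k j : Fin 3) (w : E3) : rotGen k j w = w k • b j - w j • b k := rfl

theorem inner_rotGen (k j : Fin 3) (v w : E3) :
    inner ℝ (rotGen k j v) w = -inner ℝ v (rotGen k j w) := by
  simp only [rotGen_apply, inner_sub_left, inner_sub_right, inner_smul_left, inner_smul_right,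
    inner_b, real_inner_comm (b _) v, conj_trivial]
  ring

theorem inner_self_rotGen (k j : Fin 3) (v : E3) : inner ℝ v (rotGen k j v) = 0 := by
  have := inner_rotGen k j v v
  rw [real_inner_comm] at this
  linarith

/-- The derivative of the components along an infinitesimal rotation. -/
def rotD (k j : Fin 3) (G : Pt → E3) (p : Pt) : E3 := D (0, 0, rotGen k j p.2.2) G p

/-- The Lie derivative along an infinitesimal rotation. -/
def lie (k j : Fin 3) (G : Pt → E3) (p : Pt) : E3 := rotD k j G p - rotGen k j (G p)

theorem rotD_eq (k j : Fin 3) (G : Pt → E3) (p : Pt) :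
    rotD k j G p = p.2.2 k • D (ey j) G p - p.2.2 j • D (ey k) G p := by
  have h : ((0, 0, rotGen k j p.2.2) : Pt) = p.2.2 k • ey j + (-p.2.2 j) • ey k := by
    simp [rotGen_apply, sub_eq_add_neg]
  rw [rotD, h, D_lin, neg_smul, sub_eq_add_neg]

theorem Sm.rotD {G : Pt → E3} (hG : Sm G) (k j : Fin 3) : Sm (rotD k j G) :=
  (((Sm.coord k).smul (hG.D (ey j))).sub ((Sm.coord j).smul (hG.D (ey k)))).congr
    fun p _ => rotD_eq k j G p

theorem Sm.lie {G : Pt → E3} (hG : Sm G) (k j : Fin 3) : Sm (lie k j G) :=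
  (hG.rotD k j).sub (hG.clm _)

theorem D_rotD {G : Pt → E3} (hG : Sm G) (k j : Fin 3) (w : Pt) {p : Pt} (hp : p ∈ offAxis) :
    D w (rotD k j G) p = rotD k j (D w G) p + (w.2.2 k • D (ey j) G p - w.2.2 j • D (ey k) G p) := by
  rw [D_congr (fun q _ => rotD_eq k j G q) w hp,
    D_sub ((Sm.coord k).smul (hG.D (ey j))) ((Sm.coord j).smul (hG.D (ey k))) w hp,
    D_smul (Sm.coord k) (hG.D _) w hp, D_smul (Sm.coord j) (hG.D _) w hp, D_coord, D_coord,
    rotD_eq, D_comm hG w (ey j) hp, D_comm hG w (ey k) hp]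
  abel

/-- The commutator of the rotation with the Laplacian is `2(∂_k ∂_j - ∂_j ∂_k)`, which vanishes. -/
theorem lap_rotD {G : Pt → E3} (hG : Sm G) (k j : Fin 3) {p : Pt} (hp : p ∈ offAxis) :
    lap (rotD k j G) p = rotD k j (lap G) p := by
  have hterm : ∀ i, D (ey i) (D (ey i) (rotD k j G)) p = rotD k j (D (ey i) (D (ey i) G)) p
      + (2 : ℝ) • (b i k • D (ey i) (D (ey j) G) p - b i j • D (ey i) (D (ey k) G) p) := by
    intro i
    have h1 : ∀ q ∈ offAxis, D (ey i) (rotD k j G) q = rotD k j (D (ey i) G) q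
        + (b i k • D (ey j) G q - b i j • D (ey k) G q) := fun q hq => D_rotD hG k j (ey i) hq
    have hs : ∀ (c : ℝ) (w : Pt), Sm fun q => c • D w G q := fun c w => (Sm.const c).smul (hG.D w)
    have hcs : ∀ (c : ℝ) (w : Pt), D (ey i) (fun q => c • D w G q) p = c • D (ey i) (D w G) p := by
      intro c w
      rw [D_smul (Sm.const c) (hG.D w) _ hp, D_const, zero_smul, add_zero]
    rw [D_congr h1 (ey i) hp, D_add ((hG.D _).rotD k j) ((hs _ _).sub (hs _ _)) _ hp,
      D_sub (hs _ _) (hs _ _) _ hp, hcs, hcs, D_rotD (hG.D _) k j _ hp,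
      D_comm hG (ey j) (ey i) hp, D_comm hG (ey k) (ey i) hp]
    module
  unfold lap
  have hrot : rotD k j (fun p => ∑ i, D (ey i) (D (ey i) G) p) p
      = ∑ i, rotD k j (D (ey i) (D (ey i) G)) p := D_sum (fun i _ => (hG.D _).D _) _ hp
  have hs1 : ∀ (k : Fin 3) (H : Fin 3 → E3), ∑ i, b i k • H i = H k := by
    intro k H
    simp
  rw [hrot, Finset.sum_congr rfl fun i _ => hterm i, Finset.sum_add_distrib, ← Finset.smul_sum,
    Finset.sum_sub_distrib, hs1 k fun i => D (ey i) (D (ey j) G) p,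
    hs1 j fun i => D (ey i) (D (ey k) G) p, D_comm hG (ey j) (ey k) hp, sub_self, smul_zero,
    add_zero]

theorem lap_clm {G : Pt → E3} (hG : Sm G) (L : E3 →L[ℝ] E3) {p : Pt} (hp : p ∈ offAxis) :
    lap (fun p => L (G p)) p = L (lap G p) := by
  unfold lap
  rw [map_sum]
  refine Finset.sum_congr rfl fun i _ => ?_
  rw [D_congr (fun q hq => D_clm L hG (ey i) hq) (ey i) hp, D_clm L (hG.D _) _ hp]

theorem lap_sub {G H : Pt → E3} (hG : Sm G) (hH : Sm H) {p : Pt} (hp : p ∈ offAxis) :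
    lap (fun p => G p - H p) p = lap G p - lap H p := by
  unfold lap
  rw [← Finset.sum_sub_distrib]
  refine Finset.sum_congr rfl fun i _ => ?_
  rw [D_congr (fun q hq => D_sub hG hH (ey i) hq) (ey i) hp, D_sub (hG.D _) (hH.D _) _ hp]

theorem D_D_tx_rotD {G : Pt → E3} (hG : Sm G) (k j : Fin 3) {w : Pt} (hw : w.2.2 = 0) {p : Pt}
    (hp : p ∈ offAxis) : D w (D w (rotD k j G)) p = rotD k j (D w (D w G)) p := by
  have h : ∀ {G : Pt → E3}, Sm G → ∀ q ∈ offAxis, D w (rotD k j G) q = rotD k j (D w G) q := by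
    intro G hG q hq
    rw [D_rotD hG k j w hq, hw]
    simp
  rw [D_congr (h hG) w hp, h (hG.D w) p hp]

namespace Wave

variable {M : ℝ} (hM : 0 < M) {G : Pt → E3} (hG : Wave M G)
include hM hG

/-- The derivative of the equation. -/
theorem D_equation {w : Pt} (hw : w.2.1 = 0) {p : Pt} (hp : p ∈ offAxis) :
    D w (D et (D et G)) p - D w (D ex (D ex G)) p =
    V₁ M p.2.1 • ((‖p.2.2‖ ^ 2) • D w (lap G) p - (inner ℝ p.2.2 (D w (lap G) p)) • p.2.2
      - (2 * M * R M p.2.1) • D w G p) + V₁ M p.2.1 • ((2 * inner ℝ p.2.2 w.2.2) • lap G p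
      - (inner ℝ w.2.2 (lap G p)) • p.2.2 - (inner ℝ p.2.2 (lap G p)) • w.2.2) := by
  have hs := hG.smooth
  have hR : ContDiff ℝ ((⊤ : ℕ∞) : WithTop ℕ∞) fun x => 2 * M * R M x :=
    contDiff_const.mul (contDiff_R_top hM)
  have s1 : Sm fun p : Pt => (‖p.2.2‖ ^ 2) • lap G p := Sm.normSq.smul hs.lap
  have s2 : Sm fun p : Pt => inner ℝ p.2.2 (lap G p) := Sm.snd_snd.inner hs.lap
  have s3 : Sm fun p : Pt => (inner ℝ p.2.2 (lap G p)) • p.2.2 := s2.smul Sm.snd_snd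
  have s4 : Sm fun p : Pt => (2 * M * R M p.2.1) • G p := (Sm.radial hR).smul hs
  have h := D_congr hG.equation w hp
  rw [D_sub ((hs.D _).D _) ((hs.D _).D _) w hp,
    D_smul (Sm.radial (contDiff_V₁_top hM)) ((s1.sub s3).sub s4) w hp,
    D_radial ((contDiff_V₁_top hM).differentiable (by simp)) hw, D_sub (s1.sub s3) s4 w hp,
    D_sub s1 s3 w hp, D_smul Sm.normSq hs.lap w hp, D_smul s2 Sm.snd_snd w hp,
    D_smul (Sm.radial hR) hs w hp, D_radial (hR.differentiable (by simp)) hw,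
    D_inner Sm.snd_snd hs.lap w hp, D_snd_snd, D_normSq w hp] at h
  rw [h]
  module

omit hM in
theorem inner_D {w : Pt} {p : Pt} (hp : p ∈ offAxis) :
    inner ℝ p.2.2 (D w G p) = -inner ℝ w.2.2 (G p) := by
  have h1 := D_inner Sm.snd_snd hG.smooth w hp
  rw [D_congr (g := fun p => inner ℝ p.2.2 (G p)) (h := fun _ => (0 : ℝ)) hG.tangential _ hp,
    D_const, D_snd_snd] at h1
  linarith

/-- The coefficients do not depend on `t`. This is how the estimate of the field becomes one of its
time derivative. -/
theorem D_t : Wave M (D et G) where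
  smooth := hG.smooth.D _
  homog := hG.homog.D_tx hG.smooth 1 0
  tangential := fun p hp => by
    rw [hG.inner_D hp]
    simp
  equation := fun p hp => by
    have h := hG.D_equation hM (w := et) rfl hp
    rw [D_lap hG.smooth et hp, D_D_comm hG.smooth et ex ex hp] at h
    rw [h]
    simp

/-- Rotating the argument alone would spoil tangentiality; the Lie derivative also rotates the
value. The terms in which the derivative falls on `y` in the projection cancel against the rotated
equation, by antisymmetry of the generator. -/
theorem lie (k j : Fin 3) : Wave M (lie k j G) where
  smooth := hG.smooth.lie k j
  homog := by
    intro t x y c hc hy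
    have h1 := hG.homog t x y c hc hy
    have h2 := fun i => hG.homog.D_y hG.smooth (b i) t x y c hc hy
    rw [pow_zero, one_smul] at h1 ⊢
    simp only [zero_add, pow_one] at h2
    simp only [Schwarzschild.lie, rotD_eq, h1]
    rw [← h2 j, ← h2 k]
    simp [mul_smul, smul_comm c]
  tangential := fun p hp => by
    rw [Schwarzschild.lie, inner_sub_right, rotD, hG.inner_D hp]
    have := inner_rotGen k j p.2.2 (G p)
    simp only
    linarith
  equation := fun p hp => by
    have hs := hG.smooth
    have h := hG.D_equation hM (w := (0, 0, rotGen k j p.2.2)) rfl hp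
    have h' := congrArg (rotGen k j) (hG.equation p hp)
    have hAs : Sm fun p => rotGen k j (G p) := hs.clm _
    have hlap : lap (Schwarzschild.lie k j G) p =
        D (0, 0, rotGen k j p.2.2) (lap G) p - rotGen k j (lap G p) := by
      have e := lap_sub (hs.rotD k j) hAs hp
      rw [lap_rotD hs k j hp, lap_clm hs _ hp] at e
      exact e
    have htx : ∀ w : Pt, w.2.2 = 0 → D w (D w (Schwarzschild.lie k j G)) p =
        D (0, 0, rotGen k j p.2.2) (D w (D w G)) p - rotGen k j (D w (D w G) p) := by
      intro w hw
      have e : ∀ q ∈ offAxis, D w (Schwarzschild.lie k j G) q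
          = D w (rotD k j G) q - rotGen k j (D w G q) := by
        intro q hq
        have := D_sub (hs.rotD k j) hAs w hq
        rw [D_clm _ hs _ hq] at this
        exact this
      rw [D_congr e w hp, D_sub ((hs.rotD k j).D w) ((hs.D w).clm _) w hp,
        D_clm _ (hs.D w) _ hp, D_D_tx_rotD hs k j hw hp]
      rfl
    have hinner := inner_rotGen k j p.2.2 (lap G p)
    rw [htx et rfl, htx ex rfl, hlap]
    simp only [Schwarzschild.lie, rotD]
    simp only [map_sub, map_smul, inner_self_rotGen, hinner] at h h'
    rw [inner_sub_right, sub_sub_sub_comm, h, h']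
    module

end Wave

/-! ### The energy profile of a solution -/

/-- The inner product of two fields on the spheres. -/
def ip (K H : Pt → E3) : ℝ × ℝ → ℝ := sInt fun p => inner ℝ (K p) (H p)

/-- The inner product of the derivatives along the spheres of two fields. -/
def dyip (K H : Pt → E3) : ℝ × ℝ → ℝ := sInt fun p => ∑ i, inner ℝ (D (ey i) K p) (D (ey i) H p)

section

variable {K H : Pt → E3}

theorem ip_comm (K H : Pt → E3) (z : ℝ × ℝ) : ip K H z = ip H K z :=
  sInt_congr (fun _ _ => real_inner_comm _ _) z

theorem ip_congr {H' : Pt → E3} (h : ∀ p ∈ offAxis, H p = H' p) (z : ℝ × ℝ) :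
    ip K H z = ip K H' z :=
  sInt_congr (fun p hp => by rw [h p hp]) z

theorem contDiff_ip (hK : Sm K) (hH : Sm H) : ContDiff ℝ 1 (ip K H) := contDiff_sInt (hK.inner hH)

theorem fderiv_ip_fst (hK : Sm K) (hH : Sm H) (z : ℝ × ℝ) :
    fderiv ℝ (ip K H) z (1, 0) = ip K (D et H) z + ip (D et K) H z := by
  rw [ip, fderiv_sInt_fst (hK.inner hH), ip, ip,
    ← sInt_add (hK.inner (hH.D _)) ((hK.D _).inner hH)]
  exact sInt_congr (fun p hp => D_inner hK hH et hp) z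

theorem fderiv_ip_snd (hK : Sm K) (hH : Sm H) (z : ℝ × ℝ) :
    fderiv ℝ (ip K H) z (0, 1) = ip K (D ex H) z + ip (D ex K) H z := by
  rw [ip, fderiv_sInt_snd (hK.inner hH), ip, ip,
    ← sInt_add (hK.inner (hH.D _)) ((hK.D _).inner hH)]
  exact sInt_congr (fun p hp => D_inner hK hH ex hp) z

theorem sm_dyip (hK : Sm K) (hH : Sm H) :
    Sm fun p => ∑ i, inner ℝ (D (ey i) K p) (D (ey i) H p) :=
  Sm.sum fun _ _ => (hK.D _).inner (hH.D _)

theorem dyip_comm (K H : Pt → E3) (z : ℝ × ℝ) : dyip K H z = dyip H K z :=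
  sInt_congr (fun _ _ => Finset.sum_congr rfl fun _ _ => real_inner_comm _ _) z

theorem contDiff_dyip (hK : Sm K) (hH : Sm H) : ContDiff ℝ 1 (dyip K H) :=
  contDiff_sInt (sm_dyip hK hH)

theorem D_sum_inner (hK : Sm K) (hH : Sm H) (w : Pt) {p : Pt} (hp : p ∈ offAxis) :
    D w (fun p => ∑ i, inner ℝ (D (ey i) K p) (D (ey i) H p)) p
      = (∑ i, inner ℝ (D (ey i) K p) (D (ey i) (D w H) p))
        + ∑ i, inner ℝ (D (ey i) (D w K) p) (D (ey i) H p) := by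
  rw [D_sum (fun i _ => (hK.D _).inner (hH.D _)) w hp, ← Finset.sum_add_distrib]
  refine Finset.sum_congr rfl fun i _ => ?_
  rw [D_inner (hK.D _) (hH.D _) w hp, D_comm hH w (ey i) hp, D_comm hK w (ey i) hp]

theorem fderiv_dyip_fst (hK : Sm K) (hH : Sm H) (z : ℝ × ℝ) :
    fderiv ℝ (dyip K H) z (1, 0) = dyip K (D et H) z + dyip (D et K) H z := by
  rw [dyip, fderiv_sInt_fst (sm_dyip hK hH), dyip, dyip,
    ← sInt_add (sm_dyip hK (hH.D _)) (sm_dyip (hK.D _) hH)]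
  exact sInt_congr (fun p hp => D_sum_inner hK hH et hp) z

theorem fderiv_dyip_snd (hK : Sm K) (hH : Sm H) (z : ℝ × ℝ) :
    fderiv ℝ (dyip K H) z (0, 1) = dyip K (D ex H) z + dyip (D ex K) H z := by
  rw [dyip, fderiv_sInt_snd (sm_dyip hK hH), dyip, dyip,
    ← sInt_add (sm_dyip hK (hH.D _)) (sm_dyip (hK.D _) hH)]
  exact sInt_congr (fun p hp => D_sum_inner hK hH ex hp) z

theorem ip_self_nonneg (K : Pt → E3) (z : ℝ × ℝ) : 0 ≤ ip K K z :=
  sInt_nonneg (fun _ _ => real_inner_self_nonneg) z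

/-- Integrate `|s a K - H|² ≥ 0` over the sphere for both signs `s`. -/
theorem abs_two_mul_ip_le (hK : Sm K) (hH : Sm H) (a : ℝ) (z : ℝ × ℝ) :
    |2 * a * ip K H z| ≤ a ^ 2 * ip K K z + ip H H z := by
  have key : ∀ s : ℝ, s ^ 2 = 1 → 2 * (s * a) * ip K H z ≤ a ^ 2 * ip K K z + ip H H z := by
    intro s hs
    unfold ip
    rw [← sInt_const_mul, ← sInt_const_mul, ← sInt_add ((Sm.const _).mul (hK.inner hK))
      (hH.inner hH)]
    refine sInt_mono ((Sm.const _).mul (hK.inner hH)) (((Sm.const _).mul (hK.inner hK)).add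
      (hH.inner hH)) (fun t x ω => ?_) z
    have h := real_inner_self_nonneg (F := E3)
      (x := (s * a) • K (t, x, (ω : E3)) - H (t, x, (ω : E3)))
    rw [real_inner_sub_sub_self] at h
    simp only [inner_smul_left, inner_smul_right, conj_trivial] at h
    have e : (s * a) * ((s * a) * inner ℝ (K (t, x, (ω : E3))) (K (t, x, (ω : E3))))
        = a ^ 2 * inner ℝ (K (t, x, (ω : E3))) (K (t, x, (ω : E3))) := by
      linear_combination (a ^ 2 * inner ℝ (K (t, x, (ω : E3))) (K (t, x, (ω : E3)))) * hs
    linarith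
  have h1 := key 1 (by norm_num)
  have h2 := key (-1) (by norm_num)
  rw [abs_le]
  constructor <;> linarith

end

/-! ### Weak form of the equation and the profile of a solution. -/

namespace Wave

variable {M : ℝ} (hM : 0 < M) {G : Pt → E3} (hG : Wave M G)
include hG

theorem tangential_D_t (p : Pt) (hp : p ∈ offAxis) : inner ℝ p.2.2 (D et G p) = 0 := by
  rw [hG.inner_D hp]
  simp

theorem tangential_D_x (p : Pt) (hp : p ∈ offAxis) : inner ℝ p.2.2 (D ex G p) = 0 := by
  rw [hG.inner_D hp]
  simp

/-- The weak form of the equation. -/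
theorem ip_equation {K : Pt → E3} (hK : Sm K) (homK : Hom 0 K)
    (tanK : ∀ p ∈ offAxis, inner ℝ p.2.2 (K p) = 0) (z : ℝ × ℝ) :
    ip K (D et (D et G)) z = ip K (D ex (D ex G)) z - V₁ M z.2 * dyip K G z
      - V₃ M z.2 * ip K G z := by
  have hs := hG.smooth
  have green := sInt_inner_lap hK hs homK hG.homog z
  have h3 : V₃ M z.2 = V₁ M z.2 * (2 * M * R M z.2) := by
    unfold V₁ V₃
    ring
  have key : ip K (D et (D et G)) z = ip K (D ex (D ex G)) z
      + (V₁ M z.2 * sInt (fun p => inner ℝ (K p) (lap G p)) z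
      - V₃ M z.2 * sInt (fun p => inner ℝ (K p) (G p)) z) := by
    simp only [ip, sInt]
    rw [← integral_const_mul, ← integral_const_mul, ← integral_sub, ← integral_add]
    · congr 1
      funext ω
      have hp := mem_offAxis z.1 z.2 ω
      have he := sub_eq_iff_eq_add.1 (hG.equation _ hp)
      -- Tangentiality of the test field removes the radial part of the Laplacian.
      have ht := tanK _ hp
      simp only at he ht
      rw [he, inner_add_right, inner_smul_right, inner_sub_right, inner_sub_right,
        inner_smul_right, inner_smul_right, inner_smul_right, norm_sphere, h3,
        real_inner_comm (ω : E3), ht]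
      ring
    · exact (hK.inner ((hs.D _).D _)).integrable _ _
    · exact (((hK.inner hs.lap).integrable _ _).const_mul _).sub
        (((hK.inner hs).integrable _ _).const_mul _)
    · exact ((hK.inner hs.lap).integrable _ _).const_mul _
    · exact ((hK.inner hs).integrable _ _).const_mul _
  rw [key, green]
  unfold dyip ip
  ring

/-- A Poincaré inequality without integration: up to sign, the `i`-th component of a tangential
field is the normal component of its `i`-th derivative. -/
theorem norm_sq_le_sum (t x : ℝ) (ω : S2) : inner ℝ (G (t, x, (ω : E3))) (G (t, x, (ω : E3)))
    ≤ ∑ i, inner ℝ (D (ey i) G (t, x, (ω : E3))) (D (ey i) G (t, x, (ω : E3))) := by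
  have h : inner ℝ (G (t, x, (ω : E3))) (G (t, x, (ω : E3))) = ∑ i, (G (t, x, (ω : E3)) i) ^ 2 := by
    rw [real_inner_self_eq_norm_sq, EuclideanSpace.norm_sq_eq]
    simp
  rw [h]
  refine Finset.sum_le_sum fun i _ => ?_
  have h1 := hG.inner_D (w := ey i) (mem_offAxis t x ω)
  rw [inner_b] at h1
  have h2 := abs_real_inner_le_norm (ω : E3) (D (ey i) G (t, x, (ω : E3)))
  simp only at h1
  rw [h1, abs_neg, norm_sphere, one_mul] at h2
  rw [real_inner_self_eq_norm_sq, ← sq_abs]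
  gcongr

/-- The energy profile of a solution. -/
def profile : Profile M where
  q0 := ip G G
  qt := ip (D et G) (D et G)
  qx := ip (D ex G) (D ex G)
  qy := dyip G G
  m := ip (D et G) (D ex G)
  k := ip G (D et G)
  l := ip G (D ex G)
  contDiff_q0 := contDiff_ip hG.smooth hG.smooth
  contDiff_qt := contDiff_ip (hG.smooth.D _) (hG.smooth.D _)
  contDiff_qx := contDiff_ip (hG.smooth.D _) (hG.smooth.D _)
  contDiff_qy := contDiff_dyip hG.smooth hG.smooth
  contDiff_m := contDiff_ip (hG.smooth.D _) (hG.smooth.D _)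
  contDiff_k := contDiff_ip hG.smooth (hG.smooth.D _)
  contDiff_l := contDiff_ip hG.smooth (hG.smooth.D _)
  energy_t := fun p => by
    have hs := hG.smooth
    rw [fderiv_ip_fst (hs.D _) (hs.D _), fderiv_ip_fst (hs.D _) (hs.D _), fderiv_dyip_fst hs hs,
      fderiv_ip_fst hs hs, fderiv_ip_snd (hs.D _) (hs.D _), ip_comm (D et (D et G)),
      ip_comm (D et (D ex G)), dyip_comm G, ip_comm G,
      ip_congr (K := D ex G) (fun q hq => D_comm hs et ex hq), ip_comm (D ex (D et G))]
    have h := hG.ip_equation (hs.D et) (hG.homog.D_tx hs 1 0) hG.tangential_D_t p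
    linear_combination 2 * h
  m_t := fun p => by
    have hs := hG.smooth
    rw [fderiv_ip_fst (hs.D _) (hs.D _), fderiv_ip_snd (hs.D _) (hs.D _),
      fderiv_ip_snd (hs.D _) (hs.D _), fderiv_dyip_snd hs hs, fderiv_ip_snd hs hs,
      ip_comm (D et (D et G)), ip_comm (D ex (D ex G)), dyip_comm G, ip_comm G,
      ip_congr (K := D et G) (fun q hq => D_comm hs et ex hq), ip_comm (D ex (D et G))]
    have h := hG.ip_equation (hs.D ex) (hG.homog.D_tx hs 0 1) hG.tangential_D_x p
    linear_combination 2 * h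
  k_t := fun p => by
    have hs := hG.smooth
    rw [fderiv_ip_fst hs (hs.D _), fderiv_ip_snd hs (hs.D _)]
    have h := hG.ip_equation hs hG.homog hG.tangential p
    linear_combination h
  q0_x := fun p => by
    have hs := hG.smooth
    rw [fderiv_ip_snd hs hs, ip_comm (D ex G)]
    ring
  q0_nonneg := ip_self_nonneg _
  qt_nonneg := ip_self_nonneg _
  qx_nonneg := ip_self_nonneg _
  q0_le_qy := sInt_mono (hG.smooth.inner hG.smooth) (sm_dyip hG.smooth hG.smooth) hG.norm_sq_le_sum
  m_le := fun p => by
    have := abs_two_mul_ip_le (hG.smooth.D et) (hG.smooth.D ex) 1 p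
    simpa using this
  k_le := fun p a => abs_two_mul_ip_le hG.smooth (hG.smooth.D et) a p
  l_le := fun p a => abs_two_mul_ip_le hG.smooth (hG.smooth.D ex) a p

end Wave

/-! ### A Sobolev inequality on Euclidean three-space -/

/-- The partial derivatives of a vector-valued function. -/
def pd (i : Fin 3) (k : E3 → E3) : E3 → E3 := fun y => fderiv ℝ k y (b i)

section Sobolev

variable {k : E3 → E3}

theorem contDiff_pd (hk : ContDiff ℝ ((⊤ : ℕ∞) : WithTop ℕ∞) k) (i : Fin 3) :
    ContDiff ℝ ((⊤ : ℕ∞) : WithTop ℕ∞) (pd i k) :=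
  (hk.fderiv_right (by simp)).clm_apply contDiff_const

theorem hasCompactSupport_pd (hs : HasCompactSupport k) (i : Fin 3) :
    HasCompactSupport (pd i k) := hs.fderiv_apply ℝ (b i)

theorem toLp_update (x : Fin 3 → ℝ) (i : Fin 3) (s : ℝ) :
    WithLp.toLp 2 (Function.update x i s) = (WithLp.toLp 2 x : E3) + (s - x i) • b i := by
  ext j
  by_cases h : j = i
  · subst h
    simp
  · simp [h]

/-- The fundamental theorem of calculus along a coordinate line; compact support removes the
boundary term. -/
theorem enorm_le_lmarginal_pd (hk : ContDiff ℝ ((⊤ : ℕ∞) : WithTop ℕ∞) k)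
    (hs : HasCompactSupport k) (i : Fin 3) (x : Fin 3 → ℝ) :
    ‖k (WithLp.toLp 2 x)‖ₑ ≤ (∫⋯∫⁻_{i}, (fun x => ‖pd i k (WithLp.toLp 2 x)‖ₑ)
      ∂(fun _ => (volume : Measure ℝ))) x := by
  rw [lmarginal_singleton]
  have hγ : ∀ s, HasDerivAt (fun s : ℝ => (WithLp.toLp 2 x : E3) + (s - x i) • b i) (b i) s := by
    intro s
    have := (((hasDerivAt_id s).sub_const (x i)).smul_const (b i)).const_add
      (WithLp.toLp 2 x : E3)
    simpa using this
  have hγc : ContDiff ℝ 1 (fun s : ℝ => (WithLp.toLp 2 x : E3) + (s - x i) • b i) := by fun_prop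
  have hφ : ContDiff ℝ 1 fun s : ℝ => k ((WithLp.toLp 2 x : E3) + (s - x i) • b i) :=
    (hk.of_le (by simp)).comp hγc
  have hd : ∀ s, deriv (fun s : ℝ => k ((WithLp.toLp 2 x : E3) + (s - x i) • b i)) s
      = pd i k ((WithLp.toLp 2 x : E3) + (s - x i) • b i) := fun s =>
    (HasFDerivAt.comp_hasDerivAt (f := fun s : ℝ => (WithLp.toLp 2 x : E3) + (s - x i) • b i) s
      (hk.differentiable (by simp) _).hasFDerivAt (hγ s)).deriv
  have hcs : HasCompactSupport fun s : ℝ => k ((WithLp.toLp 2 x : E3) + (s - x i) • b i) := by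
    obtain ⟨r, hr⟩ := hs.isCompact.isBounded.subset_closedBall 0
    refine HasCompactSupport.of_support_subset_isCompact (isCompact_closedBall (0 : ℝ) r)
      fun s hs' => ?_
    have h1 := hr (subset_tsupport _ hs')
    rw [mem_closedBall_zero_iff] at h1 ⊢
    refine le_trans ?_ h1
    have h2 := PiLp.norm_apply_le ((WithLp.toLp 2 x : E3) + (s - x i) • b i) i
    simpa using h2
  have h := HasCompactSupport.enorm_le_lintegral_Ici_deriv hφ hcs (x i)
  simp only [sub_self, zero_smul, add_zero, hd] at h
  refine h.trans ((setLIntegral_le_lintegral _ _).trans_eq ?_)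
  simp only [toLp_update]

/-- The one-dimensional bound is applied to one coordinate after another, each time to the
derivative just produced. After three rounds the marginals exhaust the space. -/
theorem norm_le_integral_pd (hk : ContDiff ℝ ((⊤ : ℕ∞) : WithTop ℕ∞) k)
    (hs : HasCompactSupport k) (y : E3) : ‖k y‖ ≤ ∫ y, ‖pd 2 (pd 1 (pd 0 k)) y‖ := by
  have hk0 := contDiff_pd hk 0
  have hk1 := contDiff_pd hk0 1
  have hk2 := contDiff_pd hk1 2
  have hs0 := hasCompactSupport_pd hs 0
  have hs1 := hasCompactSupport_pd hs0 1
  have hs2 := hasCompactSupport_pd hs1 2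
  have hmeas : ∀ {k : E3 → E3}, ContDiff ℝ ((⊤ : ℕ∞) : WithTop ℕ∞) k →
      Measurable fun x : Fin 3 → ℝ => ‖k (WithLp.toLp 2 x)‖ₑ := fun hk =>
    (hk.continuous.comp (PiLp.continuous_toLp 2 _)).enorm.measurable
  have e0 := enorm_le_lmarginal_pd hk hs 0 (WithLp.ofLp y)
  have e1 := lmarginal_mono (μ := fun _ : Fin 3 => (volume : Measure ℝ)) (s := {0})
    (f := fun x => ‖pd 0 k (WithLp.toLp 2 x)‖ₑ) (fun x => enorm_le_lmarginal_pd hk0 hs0 1 x)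
  have e2 := lmarginal_mono (μ := fun _ : Fin 3 => (volume : Measure ℝ)) (s := {0} ∪ {1})
    (f := fun x => ‖pd 1 (pd 0 k) (WithLp.toLp 2 x)‖ₑ)
    (fun x => enorm_le_lmarginal_pd hk1 hs1 2 x)
  rw [← lmarginal_union _ _ (hmeas hk1) (by decide)] at e1
  rw [← lmarginal_union _ _ (hmeas hk2) (by decide)] at e2
  have huniv : (({0} ∪ {1} ∪ {2} : Finset (Fin 3))) = Finset.univ := by decide
  rw [huniv, lmarginal_univ] at e2
  have h := (e0.trans (e1 _)).trans (e2 _)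
  have hmp := (PiLp.volume_preserving_toLp (Fin 3)).lintegral_comp (f := fun y : E3 =>
    ‖pd 2 (pd 1 (pd 0 k)) y‖ₑ) hk2.continuous.enorm.measurable
  rw [volume_pi] at hmp
  rw [hmp] at h
  have hint := hk2.continuous.integrable_of_hasCompactSupport (μ := volume) hs2
  have h' : ‖k y‖ₑ ≤ ENNReal.ofReal (∫ y, ‖pd 2 (pd 1 (pd 0 k)) y‖) := by
    rw [ofReal_integral_norm_eq_lintegral_enorm hint]
    exact h
  rw [← ofReal_norm] at h'
  exact (ENNReal.ofReal_le_ofReal_iff (integral_nonneg fun _ => norm_nonneg _)).1 h'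

end Sobolev

/-! ### Finite speed of propagation and growth of square integrals -/

namespace Profile.IsPotential

variable {M : ℝ} {P : Profile M} {E : ℝ × ℝ → ℝ} (hE : P.IsPotential E) (hM : 0 < M) {R₀ : ℝ}
  (hR : 0 ≤ R₀) (h0 : ∀ x, R₀ ≤ |x| → P.e (0, x) = 0)
include hE hM hR h0

/-- Let `λ = R₀ + 1 + |t|`. Since `∂_x q0 = 2l`, the function `(y + 2λ) q0 + 9λ² E` increases on
`[-λ, λ]`: there `y + 2λ ≤ 3λ`, and Cauchy-Schwarz bounds the cross term by `q0 + 9λ² qx`. At `y =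
λ` the field vanishes, and `x + 2λ ≥ λ` gives the linear growth. -/
theorem q0_le (t x : ℝ) :
    P.q0 (t, x) ≤ 9 * (R₀ + 1 + |t|) * (E (0, R₀) - E (0, -R₀)) := by
  have hs := hE.supportedIn hM h0
  set l := R₀ + 1 + |t| with hl
  have ht := abs_nonneg t
  have hl0 : 0 < l := by positivity
  have hcE := hE.mem_Icc hM h0
  have hEE : 0 ≤ E (0, R₀) - E (0, -R₀) := by
    have := hcE (0, R₀)
    linarith [this.1]
  rcases lt_or_ge l |x| with hx | hx
  · rw [(P.eq_zero_of_e_eq_zero hM (hs t x (by linarith))).1]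
    positivity
  have hx' := abs_le.1 hx
  have hd : ∀ y, HasDerivAt (fun y => (y + 2 * l) * P.q0 (t, y) + 9 * l ^ 2 * E (t, y))
      (P.q0 (t, y) + (y + 2 * l) * (2 * P.l (t, y)) + 9 * l ^ 2 * P.e (t, y)) y := fun y => by
    have h1 := Schwarzschild.hasDerivAt_snd (P.contDiff_q0.differentiable one_ne_zero (t, y))
    rw [P.q0_x] at h1
    have h2 := (((hasDerivAt_id y).add_const (2 * l)).mul h1).add
      ((hE.hasDerivAt_snd t y).const_mul (9 * l ^ 2))
    refine h2.congr_deriv ?_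
    simp only [id]
    ring
  have mono : MonotoneOn (fun y => (y + 2 * l) * P.q0 (t, y) + 9 * l ^ 2 * E (t, y))
      (Set.Icc (-l) l) := by
    refine monotoneOn_of_deriv_nonneg (convex_Icc _ _)
      (fun y _ => (hd y).continuousAt.continuousWithinAt)
      (fun y _ => (hd y).differentiableAt.differentiableWithinAt) fun y hy => ?_
    rw [interior_Icc] at hy
    rw [(hd y).deriv]
    have h1 := P.l_le (t, y) (1 / (3 * l))
    have h2 := P.qt_add_qx_le_e hM (t, y)
    have h3 := P.qt_nonneg (t, y)
    have h4 := mul_le_mul_of_nonneg_left h1 (by positivity : 0 ≤ 9 * l ^ 2)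
    have e1 : 9 * l ^ 2 * |2 * (1 / (3 * l)) * P.l (t, y)| = 3 * l * |2 * P.l (t, y)| := by
      rw [mul_right_comm 2, abs_mul _ (1 / (3 * l)), abs_of_pos (by positivity : 0 < 1 / (3 * l))]
      field_simp
      ring
    have e2 : 9 * l ^ 2 * ((1 / (3 * l)) ^ 2 * P.q0 (t, y) + P.qx (t, y))
        = P.q0 (t, y) + 9 * l ^ 2 * P.qx (t, y) := by
      field_simp
      ring
    rw [e1, e2] at h4
    have h5 : -(3 * l * |2 * P.l (t, y)|) ≤ (y + 2 * l) * (2 * P.l (t, y)) := by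
      have h6 := neg_abs_le ((y + 2 * l) * (2 * P.l (t, y)))
      rw [abs_mul, abs_of_pos (by linarith [hy.1] : 0 < y + 2 * l)] at h6
      have h7 := mul_le_mul_of_nonneg_right (by linarith [hy.2] : y + 2 * l ≤ 3 * l)
        (abs_nonneg (2 * P.l (t, y)))
      linarith
    have h8 := mul_le_mul_of_nonneg_left (by linarith : P.qx (t, y) ≤ P.e (t, y))
      (by positivity : 0 ≤ 9 * l ^ 2)
    linarith
  have h1 := mono ⟨hx'.1, hx'.2⟩ (Set.right_mem_Icc.2 (by linarith)) hx'.2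
  have h2 : P.q0 (t, l) = 0 := (P.eq_zero_of_e_eq_zero hM (hs t l (by
    rw [abs_of_pos hl0]
    linarith))).1
  simp only [h2, mul_zero, zero_add] at h1
  have h3 := mul_le_mul_of_nonneg_right (by linarith [hx'.1] : l ≤ x + 2 * l)
    (P.q0_nonneg (t, x))
  have h4 : 9 * l ^ 2 * (E (t, l) - E (t, x)) ≤ 9 * l ^ 2 * (E (0, R₀) - E (0, -R₀)) :=
    mul_le_mul_of_nonneg_left (by linarith [(hcE (t, l)).2, (hcE (t, x)).1]) (by positivity)
  have h5 : l * P.q0 (t, x) ≤ l * (9 * l * (E (0, R₀) - E (0, -R₀))) := by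
    have : l * (9 * l * (E (0, R₀) - E (0, -R₀))) = 9 * l ^ 2 * (E (0, R₀) - E (0, -R₀)) := by ring
    linarith
  exact le_of_mul_le_mul_left h5 hl0

end Profile.IsPotential

/-- The field vanishes outside the domain of influence of `{|r_*| ≤ R₀}`. -/
def Vanish (R₀ : ℝ) (G : Pt → E3) : Prop := ∀ p ∈ offAxis, R₀ + |p.1| < |p.2.1| → G p = 0

namespace Vanish

variable {R₀ : ℝ} {G : Pt → E3} (hG : Vanish R₀ G)
include hG

theorem D (w : Pt) : Vanish R₀ (D w G) := by
  intro p hp hx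
  have h1 : ∀ᶠ q in 𝓝 p, q ∈ offAxis := isOpen_offAxis.mem_nhds hp
  have h2 : ∀ᶠ q : Pt in 𝓝 p, R₀ + |q.1| < |q.2.1| :=
    (isOpen_lt (by fun_prop) (by fun_prop)).mem_nhds hx
  have h3 : G =ᶠ[𝓝 p] fun _ => 0 := by
    filter_upwards [h1, h2] with q a b using hG q a b
  rw [Schwarzschild.D, h3.fderiv_eq]
  simp

theorem lie (k j : Fin 3) : Vanish R₀ (lie k j G) := by
  intro p hp hx
  rw [Schwarzschild.lie, rotD, hG.D _ p hp hx, hG p hp hx, map_zero, sub_zero]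

theorem e_profile {M : ℝ} (hW : Wave M G) {t x : ℝ} (hx : R₀ + |t| < |x|) :
    hW.profile.e (t, x) = 0 := by
  have key : ∀ (w : Pt) (ω : S2), Schwarzschild.D w G (t, x, (ω : E3)) = 0 := fun w ω =>
    hG.D w _ (mem_offAxis t x ω) hx
  have key' : ∀ ω : S2, G (t, x, (ω : E3)) = 0 := fun ω => hG _ (mem_offAxis t x ω) hx
  simp [Profile.e, Wave.profile, ip, dyip, sInt, key, key']

end Vanish

theorem Wave.exists_ip_le {M R₀ : ℝ} (hM : 0 < M) (hR : 0 ≤ R₀) {G : Pt → E3} (hW : Wave M G)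
    (hG : Vanish R₀ G) : ∃ C, 0 ≤ C ∧ ∀ t x, ip G G (t, x) ≤ C * (1 + |t|) := by
  obtain ⟨E, hE⟩ := hW.profile.exists_potential hM
  have hE : hW.profile.IsPotential E := hE
  -- `Vanish` speaks of the strict exterior, the potential lemmas of a closed one; hence the shift
  -- by 1.
  have h0 : ∀ x, R₀ + 1 ≤ |x| → hW.profile.e (0, x) = 0 := fun x hx =>
    hG.e_profile hW (by simp; linarith)
  have hEE : 0 ≤ E (0, R₀ + 1) - E (0, -(R₀ + 1)) := by
    have := hE.mem_Icc hM h0 (0, R₀ + 1)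
    linarith [this.1]
  refine ⟨9 * (R₀ + 2) * (E (0, R₀ + 1) - E (0, -(R₀ + 1))), by positivity, fun t x => ?_⟩
  refine (hE.q0_le hM (by linarith) h0 t x).trans ?_
  have ht := abs_nonneg t
  have h1 : R₀ + 1 + 1 + |t| ≤ (R₀ + 2) * (1 + |t|) := by nlinarith
  have := mul_le_mul_of_nonneg_right h1 hEE
  linarith

theorem exists_forall_eq_zero_of_hasCompactSupport {f : ℝ × S2 → E3} (hf : HasCompactSupport f) :
    ∃ r : ℝ, ∀ x ω, r < |x| → f (x, ω) = 0 := by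
  obtain ⟨r, hr⟩ := (hf.isCompact.image continuous_fst).isBounded.subset_closedBall 0
  refine ⟨r, fun x ω hx => ?_⟩
  by_contra h
  have h1 := hr (Set.mem_image_of_mem Prod.fst (subset_tsupport f h))
  rw [mem_closedBall_zero_iff, Real.norm_eq_abs] at h1
  exact hx.not_ge h1

instance : area.IsOpenPosMeasure := by
  unfold area
  infer_instance

theorem eq_zero_of_ip_eq_zero {G : Pt → E3} (hG : Sm G) {t x : ℝ} (h : ip G G (t, x) = 0) (ω : S2) :
    G (t, x, ω) = 0 := by
  have hc := (hG.inner hG).continuous_sphere_right t x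
  have h1 := (integral_eq_zero_iff_of_nonneg (fun _ => real_inner_self_nonneg)
    ((hG.inner hG).integrable t x)).1 h
  have h2 := (hc.ae_eq_iff_eq area continuous_zero).1 h1
  exact inner_self_eq_zero.1 (congrFun h2 ω)

/-- Outside the support of the data all first derivatives vanish at time zero, hence so does the
energy density. Finite speed carries this to all times; `q0 = 0` kills the field on the sphere and
homogeneity kills its extension. -/
theorem IsSolution.exists_vanish {M : ℝ} (hM : 0 < M) {Φ : Field} (hΦ : IsSolution M Φ)
    (hdata : HasCompactData Φ) : ∃ R₀, 0 ≤ R₀ ∧ Vanish R₀ (extField Φ) := by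
  obtain ⟨r₁, h₁⟩ := exists_forall_eq_zero_of_hasCompactSupport hdata.1
  obtain ⟨r₂, h₂⟩ := exists_forall_eq_zero_of_hasCompactSupport hdata.2
  refine ⟨max 0 (max r₁ r₂ + 1), le_max_left _ _, ?_⟩
  set R₀ := max 0 (max r₁ r₂ + 1) with hR₀
  have hr : ∀ x : ℝ, R₀ ≤ |x| → r₁ < |x| ∧ r₂ < |x| := fun x hx => by
    have a1 := le_max_right 0 (max r₁ r₂ + 1)
    have a2 := le_max_left r₁ r₂
    have a3 := le_max_right r₁ r₂
    constructor <;> linarith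
  have hz : ∀ x : ℝ, r₁ < |x| → ∀ y, extField Φ (0, x, y) = 0 := fun x hx y => by
    simp only [extField, radialExt]
    split_ifs with h
    · rfl
    · exact h₁ x _ hx
  have h0 : ∀ x, R₀ ≤ |x| → hΦ.wave.profile.e (0, x) = 0 := fun x hx => by
    obtain ⟨hx1, hx2⟩ := hr x hx
    have k0 : ∀ ω : S2, extField Φ (0, x, (ω : E3)) = 0 := fun ω => hz x hx1 _
    have kt : ∀ ω : S2, D et (extField Φ) (0, x, (ω : E3)) = 0 := fun ω => by
      rw [← hΦ.Dt_eq]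
      exact h₂ x ω hx2
    have kx : ∀ ω : S2, D ex (extField Φ) (0, x, (ω : E3)) = 0 := fun ω => by
      refine (deriv_x_eq_D hΦ.sm (sphere_ne_zero ω)).unique
        ((hasDerivAt_const x 0).congr_of_eventuallyEq ?_)
      have : ∀ᶠ x' in 𝓝 x, r₁ < |x'| := (isOpen_lt (by fun_prop) (by fun_prop)).mem_nhds hx1
      filter_upwards [this] with x' hx' using hz x' hx' _
    have ky : ∀ (i : Fin 3) (ω : S2), D (ey i) (extField Φ) (0, x, (ω : E3)) = 0 := fun i ω => by
      have h := fderiv_y_eq_D hΦ.sm (t := 0) (x := x) (sphere_ne_zero ω) (b i)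
      simp only [hz x hx1, fderiv_fun_const, Pi.zero_apply, zero_apply] at h
      exact h.symm
    simp [Profile.e, Wave.profile, ip, dyip, sInt, k0, kt, kx, ky]
  obtain ⟨E, hE⟩ := hΦ.wave.profile.exists_potential hM
  have hs := Profile.IsPotential.supportedIn (E := E) hE hM h0
  intro p hp hx
  obtain ⟨t, x, y⟩ := p
  obtain ⟨ω, hω⟩ := exists_smul_sphere hp
  have h1 := eq_zero_of_ip_eq_zero hΦ.sm
    (hΦ.wave.profile.eq_zero_of_e_eq_zero hM (hs t x hx)).1 ω
  have h2 := hΦ.wave.homog t x ω ‖y‖ (norm_pos_iff.2 hp) (sphere_ne_zero ω)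
  rw [pow_zero, one_smul, h1, ← hω] at h2
  exact h2


/-! ### Pointwise bounds -/

/-- A spherical shell around the unit sphere. -/
def shell : Set E3 := {y | 1 / 2 ≤ ‖y‖ ^ 2 ∧ ‖y‖ ^ 2 ≤ 3 / 2}

theorem isCompact_shell : IsCompact shell := by
  refine (isCompact_closedBall (0 : E3) 2).of_isClosed_subset ?_ fun y hy => ?_
  · have hc : Continuous fun y : E3 => ‖y‖ ^ 2 := by fun_prop
    exact (isClosed_le continuous_const hc).inter (isClosed_le hc continuous_const)
  · rw [mem_closedBall_zero_iff]
    nlinarith [norm_nonneg y, hy.2]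

theorem ne_zero_of_mem_shell {y : E3} (hy : y ∈ shell) : y ≠ 0 := by
  rintro rfl
  have := hy.1
  norm_num at this

/-- A smooth function supported in the shell. -/
structure Cut (c : E3 → ℝ) : Prop where
  contDiff : ContDiff ℝ ((⊤ : ℕ∞) : WithTop ℕ∞) c
  tsupport_subset : tsupport c ⊆ shell

namespace Cut

variable {c : E3 → ℝ} (hc : Cut c)
include hc

theorem zero_notMem : (0 : E3) ∉ tsupport c := fun h =>
  ne_zero_of_mem_shell (hc.tsupport_subset h) rfl

theorem hasCompactSupport : HasCompactSupport c :=
  isCompact_shell.of_isClosed_subset (isClosed_tsupport c) hc.tsupport_subset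

theorem fderiv (i : Fin 3) : Cut fun y => fderiv ℝ c y (b i) where
  contDiff := (hc.contDiff.fderiv_right (by simp)).clm_apply contDiff_const
  tsupport_subset := (tsupport_fderiv_apply_subset ℝ (b i)).trans hc.tsupport_subset

theorem coord (k : Fin 3) : Cut fun y => c y * (y k / ‖y‖ ^ 2) where
  contDiff := contDiff_smul_of_notMem_tsupport (g := fun p : Pt => p.2.2 k / ‖p.2.2‖ ^ 2)
    hc.contDiff hc.zero_notMem
    ((ContDiffOn.div (Sm.coord k) Sm.normSq fun _ hp =>
      pow_ne_zero 2 (norm_ne_zero_iff.2 hp)).congr fun _ _ => rfl) 0 0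
  tsupport_subset := (tsupport_mul_subset_left).trans hc.tsupport_subset

theorem contDiff_smul (L : E3 →L[ℝ] E3) {G : Pt → E3} (hG : Sm G) (t x : ℝ) :
    ContDiff ℝ ((⊤ : ℕ∞) : WithTop ℕ∞) fun y => c y • L (G (t, x, y)) :=
  contDiff_smul_of_notMem_tsupport hc.contDiff hc.zero_notMem (hG.clm L) t x

end Cut

theorem cut_cutoff : Cut cutoff := ⟨contDiff_cutoff, tsupport_cutoff_subset⟩

/-- Iterated partial derivatives of a vector-valued function. -/
def pds : List (Fin 3) → (E3 → E3) → E3 → E3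
  | [], k => k
  | i :: l, k => pds l (pd i k)

section Iterated

variable {k f g : E3 → E3}

theorem contDiff_pds (l : List (Fin 3)) (hk : ContDiff ℝ ((⊤ : ℕ∞) : WithTop ℕ∞) k) :
    ContDiff ℝ ((⊤ : ℕ∞) : WithTop ℕ∞) (pds l k) := by
  induction l generalizing k with
  | nil => exact hk
  | cons i l ih => exact ih (contDiff_pd hk i)

theorem hasCompactSupport_pds (l : List (Fin 3)) (hk : HasCompactSupport k) :
    HasCompactSupport (pds l k) := by
  induction l generalizing k with
  | nil => exact hk
  | cons i l ih => exact ih (hasCompactSupport_pd hk i)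

theorem pds_add (l : List (Fin 3)) (hf : ContDiff ℝ ((⊤ : ℕ∞) : WithTop ℕ∞) f)
    (hg : ContDiff ℝ ((⊤ : ℕ∞) : WithTop ℕ∞) g) :
    pds l (fun y => f y + g y) = fun y => pds l f y + pds l g y := by
  induction l generalizing f g with
  | nil => rfl
  | cons i l ih =>
    have h : pd i (fun y => f y + g y) = fun y => pd i f y + pd i g y := by
      funext y
      unfold pd
      rw [fderiv_fun_add (hf.differentiable (by simp) y) (hg.differentiable (by simp) y)]
      rfl
    simp only [pds, h]
    exact ih (contDiff_pd hf i) (contDiff_pd hg i)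

end Iterated

/-- A family of test fields whose derivatives along `l` grow at most like `|t| ^ (1 / 2)` in `L¹`. -/
structure Tame (l : List (Fin 3)) (k : ℝ → ℝ → E3 → E3) : Prop where
  contDiff : ∀ t x, ContDiff ℝ ((⊤ : ℕ∞) : WithTop ℕ∞) (k t x)
  hasCompactSupport : ∀ t x, HasCompactSupport (k t x)
  bound : ∃ C, ∀ t x, ∫ y, ‖pds l (k t x) y‖ ≤ C * √(1 + |t|)

theorem Tame.add {l : List (Fin 3)} {k k' : ℝ → ℝ → E3 → E3} (h : Tame l k) (h' : Tame l k') :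
    Tame l fun t x y => k t x y + k' t x y where
  contDiff t x := (h.contDiff t x).add (h'.contDiff t x)
  hasCompactSupport t x := (h.hasCompactSupport t x).add (h'.hasCompactSupport t x)
  bound := by
    obtain ⟨C, hC⟩ := h.bound
    obtain ⟨C', hC'⟩ := h'.bound
    refine ⟨C + C', fun t x => ?_⟩
    have i1 := ((contDiff_pds l (h.contDiff t x)).continuous.integrable_of_hasCompactSupport
      (μ := volume) (hasCompactSupport_pds l (h.hasCompactSupport t x))).norm
    have i2 := ((contDiff_pds l (h'.contDiff t x)).continuous.integrable_of_hasCompactSupport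
      (μ := volume) (hasCompactSupport_pds l (h'.hasCompactSupport t x))).norm
    rw [pds_add l (h.contDiff t x) (h'.contDiff t x), add_mul]
    refine le_trans ?_ (add_le_add (hC t x) (hC' t x))
    rw [← integral_add i1 i2]
    exact integral_mono_of_nonneg (Eventually.of_forall fun _ => norm_nonneg _) (i1.add i2)
      (Eventually.of_forall fun _ => norm_add_le _ _)

/-- Euler's relation removes the radial derivative, so the rotations span all derivatives in `y`. -/
theorem normSq_smul_D_eq {G : Pt → E3} (hG : Sm G) (hom : Hom 0 G) (i : Fin 3) {p : Pt}
    (hp : p ∈ offAxis) : ‖p.2.2‖ ^ 2 • D (ey i) G p = ∑ k, p.2.2 k • rotD k i G p := by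
  have h : ‖p.2.2‖ ^ 2 = ∑ k, p.2.2 k ^ 2 := by
    rw [EuclideanSpace.norm_sq_eq]
    simp
  have h1 : ∀ k, p.2.2 k • rotD k i G p
      = p.2.2 k ^ 2 • D (ey i) G p - p.2.2 i • (p.2.2 k • D (ey k) G p) := fun k => by
    rw [rotD_eq, smul_sub, smul_smul, smul_comm, pow_two]
  simp only [h1, Finset.sum_sub_distrib, ← Finset.smul_sum, hom.euler hG hp, smul_zero, sub_zero,
    ← Finset.sum_smul, h]

theorem D_eq_sum_lie {G : Pt → E3} (hG : Sm G) (hom : Hom 0 G) (i : Fin 3) {p : Pt}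
    (hp : p ∈ offAxis) : D (ey i) G p =
      ∑ k, (p.2.2 k / ‖p.2.2‖ ^ 2) • (lie k i G p + rotGen k i (G p)) := by
  have h0 : ‖p.2.2‖ ^ 2 ≠ 0 := pow_ne_zero 2 (norm_ne_zero_iff.2 hp)
  have h := congrArg (fun z => (‖p.2.2‖ ^ 2)⁻¹ • z) (normSq_smul_D_eq hG hom i hp)
  simp only [smul_smul, inv_mul_cancel₀ h0, one_smul, Finset.smul_sum] at h
  rw [h]
  refine Finset.sum_congr rfl fun k _ => ?_
  rw [lie, sub_add_cancel, div_eq_inv_mul]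

/-! ### Pointwise growth of solutions and their angular derivatives. -/

section Growth

variable {M R₀ : ℝ} (hM : 0 < M) (hR : 0 ≤ R₀)
include hM hR

/-- On the shell `|G| ≤ s + |G|²/s` with `s = √(1 + |t|)`. By polar coordinates the integral of the
right side is a multiple of its sphere integral, which is `O(s)` as the sphere norm squared is
`O(s²)`. -/
theorem tame_nil {c : E3 → ℝ} (hc : Cut c) (L : E3 →L[ℝ] E3) {G : Pt → E3} (hW : Wave M G)
    (hG : Vanish R₀ G) : Tame [] fun t x y => c y • L (G (t, x, y)) where
  contDiff := hc.contDiff_smul L hW.smooth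
  hasCompactSupport _ _ := hc.hasCompactSupport.smul_right
  bound := by
    obtain ⟨C₀, hC₀, hC⟩ := hW.exists_ip_le hM hR hG
    obtain ⟨B, hB⟩ := hc.contDiff.continuous.bounded_above_of_compact_support hc.hasCompactSupport
    have hB0 : 0 ≤ B := (norm_nonneg _).trans (hB 0)
    set f : ℝ → ℝ := fun r => if 1 / 2 ≤ r ^ 2 ∧ r ^ 2 ≤ 3 / 2 then 1 else 0 with hf
    set m := ∫ r : Set.Ioi (0 : ℝ), f r ∂(Measure.volumeIoiPow 2) with hm
    have hm0 : 0 ≤ m := integral_nonneg fun r => by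
      simp only [hf, Pi.zero_apply]
      split_ifs <;> norm_num
    refine ⟨B * ‖L‖ * ((area.real Set.univ + C₀) * m), fun t x => ?_⟩
    set s := √(1 + |t|) with hs
    have hs0 : 0 < s := Real.sqrt_pos.2 (by positivity)
    have hss : s ^ 2 = 1 + |t| := Real.sq_sqrt (by positivity)
    set g : E3 → ℝ := fun y => s + inner ℝ (G (t, x, y)) (G (t, x, y)) / s with hg
    have hpolar := integral_polar f (g := g) fun a y ha hy => by
      have := hW.homog t x y a ha hy
      rw [pow_zero, one_smul] at this
      simp only [hg, this]
    have hind : (fun y => f ‖y‖ * g y) = shell.indicator g := by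
      funext y
      by_cases hy : y ∈ shell
      · have : f ‖y‖ = 1 := if_pos hy
        rw [Set.indicator_of_mem hy, this, one_mul]
      · have : f ‖y‖ = 0 := if_neg hy
        rw [Set.indicator_of_notMem hy, this, zero_mul]
    have hgi : Integrable fun y => f ‖y‖ * g y := by
      rw [hind]
      refine (ContinuousOn.integrableOn_compact isCompact_shell ?_).integrable_indicator
        isCompact_shell.isClosed.measurableSet
      refine continuousOn_const.add (ContinuousOn.div_const ?_ s)
      exact (hW.smooth.inner hW.smooth).continuousOn.comp (f := fun y : E3 => ((t, x, y) : Pt))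
        (by fun_prop) fun y hy => ne_zero_of_mem_shell hy
    have hsph : ∫ ω, g (ω : E3) ∂area ≤ (area.real Set.univ + C₀) * s := by
      simp only [hg]
      rw [integral_add (integrable_const _) (((hW.smooth.inner hW.smooth).integrable t x).div_const _),
        integral_const, integral_div, smul_eq_mul, add_mul]
      have h1 : (∫ ω : S2, inner ℝ (G (t, x, (ω : E3))) (G (t, x, (ω : E3))) ∂area) ≤ C₀ * s ^ 2 := by
        rw [hss]
        exact hC t x
      have h2 := div_le_div_of_nonneg_right h1 hs0.le
      have h3 : C₀ * s ^ 2 / s = C₀ * s := by field_simp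
      linarith
    calc ∫ y, ‖pds [] (fun y => c y • L (G (t, x, y))) y‖
        ≤ ∫ y, B * ‖L‖ * (f ‖y‖ * g y) := by
          refine integral_mono_of_nonneg (Eventually.of_forall fun _ => norm_nonneg _)
            (hgi.const_mul _) (Eventually.of_forall fun y => ?_)
          simp only [pds, norm_smul]
          by_cases hy : y ∈ shell
          · have hf1 : f ‖y‖ = 1 := if_pos hy
            have hgy : ‖G (t, x, y)‖ ≤ g y := by
              simp only [hg, real_inner_self_eq_norm_sq]
              have h1 : s + ‖G (t, x, y)‖ ^ 2 / s - ‖G (t, x, y)‖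
                  = ((s - ‖G (t, x, y)‖ / 2) ^ 2 + 3 / 4 * ‖G (t, x, y)‖ ^ 2) / s := by
                field_simp
                ring
              have h2 : 0 ≤ ((s - ‖G (t, x, y)‖ / 2) ^ 2 + 3 / 4 * ‖G (t, x, y)‖ ^ 2) / s := by
                positivity
              linarith
            rw [hf1, one_mul, mul_assoc]
            exact mul_le_mul (hB y) ((L.le_opNorm _).trans
              (mul_le_mul_of_nonneg_left hgy (norm_nonneg _))) (norm_nonneg _) hB0
          · have hf1 : f ‖y‖ = 0 := if_neg hy
            have hc0 : c y = 0 := image_eq_zero_of_notMem_tsupport fun h => hy (hc.tsupport_subset h)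
            rw [hf1, hc0]
            simp
      _ = B * ‖L‖ * ((∫ ω, g (ω : E3) ∂area) * m) := by rw [integral_const_mul, hpolar]
      _ ≤ B * ‖L‖ * (((area.real Set.univ + C₀) * s) * m) := by gcongr
      _ = _ := by ring

omit hM hR in
-- A derivative of a test field is a sum of seven test fields of the same type: one with the cut-off
-- differentiated, three with a Lie derivative of `G`, three with a modified linear map.
theorem pd_smul_clm {c : E3 → ℝ} (hc : Cut c) (L : E3 →L[ℝ] E3) {G : Pt → E3} (hG : Sm G)
    (hom : Hom 0 G) (i : Fin 3) (t x : ℝ) : pd i (fun y => c y • L (G (t, x, y))) = fun y =>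
      (fderiv ℝ c y (b i) • L (G (t, x, y)) +
        ((c y * (y 0 / ‖y‖ ^ 2)) • L (lie 0 i G (t, x, y)) +
        ((c y * (y 1 / ‖y‖ ^ 2)) • L (lie 1 i G (t, x, y)) +
        (c y * (y 2 / ‖y‖ ^ 2)) • L (lie 2 i G (t, x, y))))) +
        ((c y * (y 0 / ‖y‖ ^ 2)) • (L.comp (rotGen 0 i)) (G (t, x, y)) +
        ((c y * (y 1 / ‖y‖ ^ 2)) • (L.comp (rotGen 1 i)) (G (t, x, y)) +
        (c y * (y 2 / ‖y‖ ^ 2)) • (L.comp (rotGen 2 i)) (G (t, x, y)))) := by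
  funext y
  rcases eq_or_ne y 0 with rfl | hy
  · have h1 := (notMem_tsupport_iff_eventuallyEq.1 hc.zero_notMem)
    have h2 : (fun y => c y • L (G (t, x, y))) =ᶠ[𝓝 0] fun _ => 0 := by
      filter_upwards [h1] with y hy
      rw [hy, Pi.zero_apply, zero_smul]
    rw [pd, h2.fderiv_eq, h1.fderiv_eq, h1.self_of_nhds]
    simp
  · have hp : (t, x, y) ∈ offAxis := hy
    have hd : DifferentiableAt ℝ (fun z => L (G (t, x, z))) y :=
      ((hG.clm L).differentiableAt hp).comp (f := fun z : E3 => ((t, x, z) : Pt)) y (by fun_prop)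
    have h2 : pd i (fun y => c y • L (G (t, x, y))) y
        = c y • L (D (ey i) G (t, x, y)) + fderiv ℝ c y (b i) • L (G (t, x, y)) := by
      rw [pd, fderiv_fun_smul (hc.contDiff.differentiable (by simp) y) hd, ← D_clm L hG _ hp,
        ← fderiv_y_eq_D (hG.clm L) hy]
      rfl
    rw [h2, D_eq_sum_lie hG hom i hp]
    simp only [Fin.sum_univ_three, map_add, map_smul, smul_add, smul_smul,
      ContinuousLinearMap.comp_apply]
    abel

/-- The induction must range over all cut-offs, linear maps and solutions, because each derivative
changes all three. -/
theorem tame (l : List (Fin 3)) : ∀ {c : E3 → ℝ}, Cut c → ∀ (L : E3 →L[ℝ] E3) {G : Pt → E3},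
    Wave M G → Vanish R₀ G → Tame l fun t x y => c y • L (G (t, x, y)) := by
  induction l with
  | nil => exact fun hc L _ hW hG => tame_nil hM hR hc L hW hG
  | cons i l ih =>
    intro c hc L G hW hG
    refine ⟨hc.contDiff_smul L hW.smooth, fun _ _ => hc.hasCompactSupport.smul_right, ?_⟩
    have A := ih (hc.fderiv i) L hW hG
    have B := fun k => ih (hc.coord k) L (hW.lie hM k i) (hG.lie k i)
    have C := fun k => ih (hc.coord k) (L.comp (rotGen k i)) hW hG
    obtain ⟨K, hK⟩ := ((A.add ((B 0).add ((B 1).add (B 2)))).add ((C 0).add ((C 1).add (C 2)))).bound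
    refine ⟨K, fun t x => ?_⟩
    simp only [pds, pd_smul_clm hc L hW.smooth hW.homog i t x]
    exact hK t x

variable {G : Pt → E3} (hW : Wave M G) (hG : Vanish R₀ G)
include hW hG

theorem Wave.exists_norm_le : ∃ C, 0 ≤ C ∧ ∀ t x (ω : S2), ‖G (t, x, ω)‖ ≤ C * √(1 + |t|) := by
  have h := tame hM hR [0, 1, 2] cut_cutoff (ContinuousLinearMap.id ℝ E3) hW hG
  obtain ⟨C, hC⟩ := h.bound
  refine ⟨max C 0, le_max_right _ _, fun t x ω => ?_⟩
  have h1 := norm_le_integral_pd (h.contDiff t x) (h.hasCompactSupport t x) ω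
  simp only [cutoff_sphere, one_smul, ContinuousLinearMap.id_apply] at h1
  exact h1.trans ((hC t x).trans (by gcongr; exact le_max_left _ _))

theorem Wave.exists_norm_D_le : ∃ C, 0 ≤ C ∧ ∀ i t x (ω : S2),
    ‖D (ey i) G (t, x, ω)‖ ≤ C * √(1 + |t|) := by
  obtain ⟨C, hC0, hC⟩ := hW.exists_norm_le hM hR hG
  choose B hB0 hB using fun k i => (hW.lie hM k i).exists_norm_le hM hR (hG.lie k i)
  refine ⟨∑ i, ∑ k, (B k i + ‖rotGen k i‖ * C), ?_, fun i t x ω => ?_⟩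
  · exact Finset.sum_nonneg fun i _ => Finset.sum_nonneg fun k _ =>
      add_nonneg (hB0 k i) (mul_nonneg (norm_nonneg _) hC0)
  rw [D_eq_sum_lie hW.smooth hW.homog i (mem_offAxis t x ω)]
  refine (norm_sum_le _ _).trans ?_
  have h1 : ∑ k, (B k i + ‖rotGen k i‖ * C) ≤ ∑ i, ∑ k, (B k i + ‖rotGen k i‖ * C) :=
    Finset.single_le_sum (f := fun i => ∑ k, (B k i + ‖rotGen k i‖ * C))
      (fun i _ => Finset.sum_nonneg fun k _ =>
        add_nonneg (hB0 k i) (mul_nonneg (norm_nonneg _) hC0)) (Finset.mem_univ i)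
  refine le_trans ?_ (mul_le_mul_of_nonneg_right h1 (Real.sqrt_nonneg _))
  rw [Finset.sum_mul]
  refine Finset.sum_le_sum fun k _ => ?_
  have hω : ‖(ω : E3) k‖ ≤ 1 := by
    have := PiLp.norm_apply_le (ω : E3) k
    rwa [norm_sphere] at this
  simp only [norm_sphere, one_pow, div_one, norm_smul]
  calc ‖(ω : E3) k‖ * ‖Schwarzschild.lie k i G (t, x, ω) + rotGen k i (G (t, x, ω))‖
      ≤ 1 * (B k i * √(1 + |t|) + ‖rotGen k i‖ * (C * √(1 + |t|))) := by
        refine mul_le_mul hω ((norm_add_le _ _).trans (add_le_add (hB k i t x ω)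
          (((rotGen k i).le_opNorm _).trans ?_))) (norm_nonneg _) zero_le_one
        exact mul_le_mul_of_nonneg_left (hC t x ω) (norm_nonneg _)
    _ = _ := by ring

theorem Wave.exists_norm_D_D_le (i : Fin 3) : ∃ C, 0 ≤ C ∧ ∀ t x (ω : S2),
    ‖D (ey i) (D (ey i) G) (t, x, ω)‖ ≤ C * √(1 + |t|) := by
  obtain ⟨C, hC0, hC⟩ := hW.exists_norm_D_le hM hR hG
  choose B hB0 hB using fun k i => (hW.lie hM k i).exists_norm_D_le hM hR (hG.lie k i)
  refine ⟨∑ k, (B k i + ‖rotGen k i‖ * C) + 2 * C, ?_, fun t x ω => ?_⟩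
  · have := Finset.sum_nonneg fun (k : Fin 3) (_ : k ∈ Finset.univ) =>
      add_nonneg (hB0 k i) (mul_nonneg (norm_nonneg (rotGen k i)) hC0)
    positivity
  have hs := hW.smooth
  have hp := mem_offAxis t x ω
  -- Differentiating the rotation identity once more expresses the second derivative through first
  -- derivatives of Lie derivatives and of `G`, all already bounded.
  have key := D_congr (fun p hp => normSq_smul_D_eq hs hW.homog i hp) (ey i) hp
  rw [D_smul Sm.normSq (hs.D _) _ hp, D_normSq _ hp,
    D_sum (fun k _ => (Sm.coord k).smul (hs.rotD k i)) _ hp] at key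
  have h1 : ∀ k, D (ey i) (fun p => p.2.2 k • rotD k i G p) (t, x, (ω : E3))
      = (ω : E3) k • (D (ey i) (Schwarzschild.lie k i G) (t, x, (ω : E3))
          + rotGen k i (D (ey i) G (t, x, (ω : E3)))) := fun k => by
    have e1 : (b i : E3) k • rotD k i G (t, x, (ω : E3)) = 0 := by
      by_cases h : k = i
      · rw [h, rotD_eq, sub_self, smul_zero]
      · simp [h]
    rw [D_smul (Sm.coord k) (hs.rotD k i) _ hp, D_coord, e1, add_zero, ← D_clm _ hs _ hp,
      ← D_add (hs.lie k i) (hs.clm _) _ hp]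
    congr 1
    exact D_congr (fun q _ => by rw [Schwarzschild.lie, sub_add_cancel]) _ hp
  simp only [h1, norm_sphere, one_pow, one_smul] at key
  have hω : ∀ k, ‖(ω : E3) k‖ ≤ 1 := fun k => by
    have := PiLp.norm_apply_le (ω : E3) k
    rwa [norm_sphere] at this
  rw [eq_sub_of_add_eq key, add_mul, Finset.sum_mul]
  refine (norm_sub_le _ _).trans (add_le_add ((norm_sum_le _ _).trans
    (Finset.sum_le_sum fun k _ => ?_)) ?_)
  · rw [norm_smul]
    calc ‖(ω : E3) k‖ * ‖D (ey i) (Schwarzschild.lie k i G) (t, x, (ω : E3))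
          + rotGen k i (D (ey i) G (t, x, (ω : E3)))‖
        ≤ 1 * (B k i * √(1 + |t|) + ‖rotGen k i‖ * (C * √(1 + |t|))) := by
          refine mul_le_mul (hω k) ((norm_add_le _ _).trans (add_le_add (hB k i i t x ω)
            (((rotGen k i).le_opNorm _).trans ?_))) (norm_nonneg _) zero_le_one
          exact mul_le_mul_of_nonneg_left (hC i t x ω) (norm_nonneg _)
      _ = _ := by ring
  · have h2 : inner ℝ (ω : E3) (b i) = (ω : E3) i := by rw [real_inner_comm, inner_b]
    rw [norm_smul, h2, norm_mul, Real.norm_ofNat, mul_assoc, mul_assoc]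
    have := mul_le_mul (hω i) (hC i t x ω) (norm_nonneg _) zero_le_one
    linarith

/-- The decay of `L L̲ G` towards the horizon and null infinity. -/
theorem Wave.exists_norm_sub_le : ∃ C, 0 ≤ C ∧ ∀ t x (ω : S2),
    ‖D et (D et G) (t, x, ω) - D ex (D ex G) (t, x, ω)‖ ≤ C * (√(1 + |t|) * V₁ M x) := by
  obtain ⟨C, hC0, hC⟩ := hW.exists_norm_le hM hR hG
  choose B hB0 hB using hW.exists_norm_D_D_le hM hR hG
  refine ⟨2 * (∑ i, B i) + C, ?_, fun t x ω => ?_⟩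
  · have := Finset.sum_nonneg fun (i : Fin 3) (_ : i ∈ Finset.univ) => hB0 i
    positivity
  have hV := V₁_pos hM x
  have h2R := two_mul_R_lt_one hM x
  have h2R' : 0 ≤ 2 * M * R M x := by
    have := R_pos hM x
    positivity
  rw [hW.equation _ (mem_offAxis t x ω), norm_smul, Real.norm_of_nonneg hV.le]
  simp only [norm_sphere, one_pow, one_smul]
  have hlap : ‖lap G (t, x, ω)‖ ≤ (∑ i, B i) * √(1 + |t|) := by
    rw [Finset.sum_mul]
    exact (norm_sum_le _ _).trans (Finset.sum_le_sum fun i _ => hB i t x ω)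
  have h1 : ‖inner ℝ (ω : E3) (lap G (t, x, ω)) • (ω : E3)‖ ≤ ‖lap G (t, x, ω)‖ := by
    rw [norm_smul, norm_sphere, mul_one]
    have := abs_real_inner_le_norm (ω : E3) (lap G (t, x, ω))
    rwa [norm_sphere, one_mul] at this
  have h3 : ‖(2 * M * R M x) • G (t, x, ω)‖ ≤ 1 * ‖G (t, x, ω)‖ := by
    rw [norm_smul, Real.norm_of_nonneg h2R']
    exact mul_le_mul_of_nonneg_right h2R.le (norm_nonneg _)
  have h4 := hC t x ω
  have h5 := (norm_sub_le (lap G (t, x, ω) - inner ℝ (ω : E3) (lap G (t, x, ω)) • (ω : E3))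
    ((2 * M * R M x) • G (t, x, ω))).trans (add_le_add_left (norm_sub_le _ _) _)
  calc V₁ M x * _ ≤ V₁ M x * ((2 * (∑ i, B i) + C) * √(1 + |t|)) :=
        mul_le_mul_of_nonneg_left (by linarith) hV.le
    _ = _ := by ring

theorem Wave.exists_dyip_le : ∃ C, 0 ≤ C ∧ ∀ t x, dyip G G (t, x) ≤ C * (1 + |t|) := by
  obtain ⟨C, hC0, hC⟩ := hW.exists_norm_D_le hM hR hG
  refine ⟨area.real Set.univ * (3 * C ^ 2), by positivity, fun t x => ?_⟩
  have h : dyip G G (t, x) ≤ ∫ _ : S2, 3 * C ^ 2 * (1 + |t|) ∂area := by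
    refine integral_mono ((sm_dyip hW.smooth hW.smooth).integrable t x) (integrable_const _)
      fun ω => ?_
    have h1 : ∀ i, inner ℝ (D (ey i) G (t, x, (ω : E3))) (D (ey i) G (t, x, (ω : E3)))
        ≤ C ^ 2 * (1 + |t|) := fun i => by
      have h2 := pow_le_pow_left₀ (norm_nonneg _) (hC i t x ω) 2
      rwa [mul_pow, Real.sq_sqrt (by positivity), ← real_inner_self_eq_norm_sq] at h2
    have := Finset.sum_le_sum fun (i : Fin 3) (_ : i ∈ Finset.univ) => h1 i
    rw [Finset.sum_const, Finset.card_univ, Fintype.card_fin, nsmul_eq_mul] at this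
    refine this.trans_eq ?_
    push_cast
    ring
  rw [integral_const, smul_eq_mul] at h
  linarith

end Growth

/-! ### Traces at infinity -/

/-- A family `K σ` that converges as `σ → ∞`, as its derivative in `σ` decays like `σ ^ (-3 / 2)`
locally uniformly in `τ`. -/
structure Convergent (K : ℝ → ℝ → S2 → E3) : Prop where
  continuous : Continuous fun p : ℝ × ℝ × S2 => K p.1 p.2.1 p.2.2
  decay : ∃ K' : ℝ → ℝ → S2 → E3, (∀ σ τ ω, HasDerivAt (fun σ => K σ τ ω) (K' σ τ ω) σ) ∧
    ∀ T, ∃ C σ₀ : ℝ, 0 < σ₀ ∧ 0 ≤ C ∧ ∀ σ τ ω, σ₀ ≤ σ → |τ| ≤ T → ‖K' σ τ ω‖ ≤ C / (σ * √σ)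

/-- `2C/√σ - 2C/√s` is the primitive in `s` of the bound on the derivative that vanishes at `s = σ`.
-/
theorem norm_sub_le_of_deriv_le {f f' : ℝ → E3} (hf : ∀ σ, HasDerivAt f (f' σ) σ) {C σ₀ : ℝ}
    (h0 : 0 < σ₀) (hC : 0 ≤ C) (h : ∀ σ, σ₀ ≤ σ → ‖f' σ‖ ≤ C / (σ * √σ)) {σ σ' : ℝ} (h1 : σ₀ ≤ σ)
    (h2 : σ ≤ σ') : ‖f σ' - f σ‖ ≤ 2 * C / √σ := by
  have hB : ∀ s, 0 < s → HasDerivAt (fun s => 2 * C / √σ - 2 * C / √s) (C / (s * √s)) s := by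
    intro s hs
    have hs' : √s ≠ 0 := (Real.sqrt_pos.2 hs).ne'
    have h3 := (((Real.hasDerivAt_sqrt hs.ne').inv hs').const_mul (2 * C)).const_sub (2 * C / √σ)
    refine (h3.congr_deriv ?_).congr_of_eventuallyEq (Eventually.of_forall fun s => ?_)
    · have : √s ^ 2 = s := Real.sq_sqrt hs.le
      field_simp
      rw [this]
    · simp [div_eq_mul_inv]
  have key := image_norm_le_of_norm_deriv_right_le_deriv_boundary' (f := fun s => f s - f σ)
    (f' := f') (a := σ) (b := σ') (B := fun s => 2 * C / √σ - 2 * C / √s)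
    (B' := fun s => C / (s * √s))
    (fun s _ => ((hf s).sub_const _).continuousAt.continuousWithinAt)
    (fun s _ => ((hf s).sub_const _).hasDerivWithinAt) (by simp)
    (fun s hs => (hB s (h0.trans_le (h1.trans hs.1))).continuousAt.continuousWithinAt)
    (fun s hs => (hB s (h0.trans_le (h1.trans hs.1))).hasDerivWithinAt)
    (fun s hs => h s (h1.trans hs.1)) (Set.right_mem_Icc.2 h2)
  have : 0 ≤ 2 * C / √σ' := by positivity
  exact key.trans (by linarith)

theorem tendsto_div_sqrt (C : ℝ) : Tendsto (fun σ : ℝ => C / √σ) atTop (𝓝 0) :=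
  tendsto_const_nhds.div_atTop (Real.tendsto_sqrt_atTop)

theorem continuous_integral_sphere {X : Type*} [TopologicalSpace X] [FirstCountableTopology X]
    [LocallyCompactSpace X] {f : X × S2 → ℝ} (hf : Continuous f) :
    Continuous fun x => ∫ ω, f (x, ω) ∂area := by
  have := continuous_parametric_integral_of_continuous (μ := area) (s := Set.univ)
    (f := fun (x : X) (ω : S2) => f (x, ω)) hf isCompact_univ
  simpa only [Measure.restrict_univ] using this

namespace Convergent

variable {K : ℝ → ℝ → S2 → E3} (hK : Convergent K)
include hK

theorem exists_limit : ∃ h : ℝ → S2 → E3, ∀ T, ∃ C σ₀ : ℝ, 0 ≤ C ∧ ∀ σ τ ω, σ₀ ≤ σ → |τ| ≤ T →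
    ‖K σ τ ω - h τ ω‖ ≤ C / √σ := by
  obtain ⟨K', hd, hb⟩ := hK.decay
  have lim : ∀ τ ω, ∃ z, Tendsto (fun σ => K σ τ ω) atTop (𝓝 z) := by
    intro τ ω
    obtain ⟨C, σ₀, h0, hC, h⟩ := hb |τ|
    -- Truncating at `σ₀` makes the estimate valid for every parameter without changing the limit.
    have hc : CauchySeq fun σ => K (max σ σ₀) τ ω := by
      refine cauchySeq_of_le_tendsto_0' (fun σ => 2 * C / √(max σ σ₀)) (fun σ σ' hσ => ?_) ?_
      · rw [dist_comm, dist_eq_norm]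
        exact norm_sub_le_of_deriv_le (fun σ => hd σ τ ω) h0 hC (fun σ hσ => h σ τ ω hσ le_rfl)
          (le_max_right _ _) (max_le_max_right _ hσ)
      · exact (tendsto_div_sqrt (2 * C)).comp
          (tendsto_atTop_mono (fun σ => le_max_left σ σ₀) tendsto_id)
    obtain ⟨z, hz⟩ := cauchySeq_tendsto_of_complete hc
    refine ⟨z, hz.congr' ?_⟩
    filter_upwards [eventually_ge_atTop σ₀] with σ hσ
    rw [max_eq_left hσ]
  choose h hh using lim
  refine ⟨h, fun T => ?_⟩
  obtain ⟨C, σ₀, h0, hC, hB⟩ := hb T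
  refine ⟨2 * C, σ₀, by positivity, fun σ τ ω hσ hτ => ?_⟩
  have h1 := ((hh τ ω).sub_const (K σ τ ω)).norm
  rw [norm_sub_rev]
  refine le_of_tendsto h1 ?_
  filter_upwards [eventually_ge_atTop σ] with σ' hσ'
  exact norm_sub_le_of_deriv_le (fun σ => hd σ τ ω) h0 hC (fun σ hσ => hB σ τ ω hσ hτ) hσ hσ'

omit hK in
theorem tendstoLocallyUniformly {h : ℝ → S2 → E3} (hh : ∀ T, ∃ C σ₀ : ℝ, 0 ≤ C ∧ ∀ σ τ ω,
    σ₀ ≤ σ → |τ| ≤ T → ‖K σ τ ω - h τ ω‖ ≤ C / √σ) :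
    TendstoLocallyUniformly (fun σ (q : ℝ × S2) => K σ q.1 q.2) (fun q => h q.1 q.2) atTop := by
  rw [Metric.tendstoLocallyUniformly_iff]
  intro ε hε q
  obtain ⟨C, σ₀, -, hC⟩ := hh (|q.1| + 1)
  refine ⟨{p | |p.1| < |q.1| + 1}, (isOpen_lt (by fun_prop) (by fun_prop)).mem_nhds
    (by simp), ?_⟩
  filter_upwards [eventually_ge_atTop σ₀, (tendsto_div_sqrt C).eventually_lt_const hε] with σ h1 h2
    p hp
  rw [dist_comm, dist_eq_norm]
  exact (hC σ p.1 p.2 h1 (le_of_lt hp)).trans_lt h2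

/-- The trace of a convergent family and its flux. -/
theorem exists_trace {A W : ℝ → ℝ → ℝ} {a B : ℝ}
    (h0 : ∀ τ ω, τ ≤ a → ∀ᶠ σ in atTop, K σ τ ω = 0)
    (hWc : ∀ σ, Continuous (W σ))
    (hW : ∀ T, ∃ C σ₀ : ℝ, ∀ σ τ, σ₀ ≤ σ → |τ| ≤ T → |W σ τ| ≤ C / √σ)
    (hA : ∀ σ τ, HasDerivAt (A σ) (1 / 2 * ((∫ ω, ‖K σ τ ω‖ ^ 2 ∂area) + W σ τ)) τ)
    (hB : ∀ σ τ, A σ τ - A σ a ≤ B) :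
    ∃ h : ℝ → S2 → E3, (∀ τ ω, Tendsto (fun p : ℝ × ℝ × S2 => K p.1 p.2.1 p.2.2)
        (atTop ×ˢ 𝓝 (τ, ω)) (𝓝 (h τ ω))) ∧
      Integrable (fun p : ℝ × S2 => ‖h p.1 p.2‖ ^ 2) ((volume : Measure ℝ).prod area) ∧
      (∃ e, Tendsto (boundaryFlux h) atTop (𝓝 e)) ∧
      ∀ T, a ≤ T → Tendsto (fun σ => 4 * (A σ T - A σ a)) atTop (𝓝 (boundaryFlux h T)) := by
  obtain ⟨h, hh⟩ := hK.exists_limit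
  have hlu := tendstoLocallyUniformly hh
  have hKc : ∀ σ, Continuous fun q : ℝ × S2 => K σ q.1 q.2 := fun σ =>
    hK.continuous.comp (f := fun q : ℝ × S2 => (σ, q)) (by fun_prop)
  have hc : Continuous fun q : ℝ × S2 => h q.1 q.2 :=
    hlu.continuous (Frequently.of_forall hKc)
  have hjoint : ∀ τ ω, Tendsto (fun p : ℝ × ℝ × S2 => K p.1 p.2.1 p.2.2)
      (atTop ×ˢ 𝓝 (τ, ω)) (𝓝 (h τ ω)) := fun τ ω => by
    have h1 := (tendstoLocallyUniformly_iff_forall_tendsto.1 hlu) (τ, ω)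
    have h2 : Tendsto (fun p : ℝ × ℝ × S2 => h p.2.1 p.2.2) (atTop ×ˢ 𝓝 (τ, ω)) (𝓝 (h τ ω)) :=
      (hc.tendsto (τ, ω)).comp tendsto_snd
    exact h2.congr_uniformity h1
  have hpt : ∀ τ ω, Tendsto (fun σ => K σ τ ω) atTop (𝓝 (h τ ω)) := fun τ ω =>
    (hjoint τ ω).comp (tendsto_id.prodMk tendsto_const_nhds)
  have hz : ∀ τ ω, τ ≤ a → h τ ω = 0 := fun τ ω hτ =>
    tendsto_nhds_unique (hpt τ ω) (tendsto_const_nhds.congr' ((h0 τ ω hτ).mono fun _ e => e.symm))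
  set H : ℝ → ℝ := fun τ => ∫ ω, ‖h τ ω‖ ^ 2 ∂area with hH
  have hHc : Continuous H := continuous_integral_sphere (hc.norm.pow 2)
  have hH0 : ∀ τ, 0 ≤ H τ := fun τ => integral_nonneg fun ω => by positivity
  have hHz : ∀ τ, τ ≤ a → H τ = 0 := fun τ hτ => by simp [hH, hz τ _ hτ]
  have hkc : ∀ σ, Continuous fun τ => ∫ ω, ‖K σ τ ω‖ ^ 2 ∂area := fun σ =>
    continuous_integral_sphere ((hKc σ).norm.pow 2)
  -- Dominated convergence passes to the limit first on the sphere and then in `τ`; `W` is uniformly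
  -- small on bounded ranges of `τ`.
  have hflux : ∀ T, a ≤ T →
      Tendsto (fun σ => 4 * (A σ T - A σ a)) atTop (𝓝 (2 * ∫ τ in a..T, H τ)) := by
    intro T hT
    set T₁ := max |a| |T| with hT₁
    have habs : ∀ τ ∈ Set.Ioc a T, |τ| ≤ T₁ := fun τ hτ => by
      rw [abs_le]
      have h1 := neg_abs_le a
      have h2 := le_abs_self T
      exact ⟨by linarith [le_max_left |a| |T|, hτ.1], by linarith [le_max_right |a| |T|, hτ.2]⟩
    obtain ⟨C, σ₀, hC, hCb⟩ := hh T₁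
    obtain ⟨D, σ₁, hD⟩ := hW T₁
    obtain ⟨b, hb⟩ := (isCompact_Icc (a := -T₁) (b := T₁) |>.prod
      (isCompact_univ (X := S2))).exists_bound_of_continuousOn hc.continuousOn
    have hsq : ∀ σ : ℝ, 1 ≤ σ → ∀ c : ℝ, 0 ≤ c → c / √σ ≤ c := fun σ hσ c hc =>
      div_le_self hc (Real.one_le_sqrt.2 hσ)
    have hKb : ∀ σ τ ω, max σ₀ 1 ≤ σ → |τ| ≤ T₁ → ‖K σ τ ω‖ ≤ b + C := fun σ τ ω hσ hτ => by
      have h1 := hCb σ τ ω ((le_max_left _ _).trans hσ) hτ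
      have h2 := hb (τ, ω) ⟨abs_le.1 hτ, Set.mem_univ _⟩
      have h3 := hsq σ ((le_max_right _ _).trans hσ) C hC
      have h4 := norm_add_le (K σ τ ω - h τ ω) (h τ ω)
      rw [sub_add_cancel] at h4
      simp only at h2
      linarith
    have hlim : Tendsto (fun σ => ∫ τ in a..T, ((∫ ω, ‖K σ τ ω‖ ^ 2 ∂area) + W σ τ)) atTop
        (𝓝 (∫ τ in a..T, H τ)) := by
      refine intervalIntegral.tendsto_integral_filter_of_dominated_convergence
        (fun _ => area.real Set.univ * (b + C) ^ 2 + |D|)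
        (Eventually.of_forall fun σ => ((hkc σ).add (hWc σ)).aestronglyMeasurable) ?_
        intervalIntegrable_const ?_
      · filter_upwards [eventually_ge_atTop (max σ₀ 1), eventually_ge_atTop σ₁] with σ h1 h2
        refine Eventually.of_forall fun τ hτ => ?_
        rw [Set.uIoc_of_le hT] at hτ
        have hτ' := habs τ hτ
        refine (norm_add_le _ _).trans (add_le_add ?_ ?_)
        · rw [Real.norm_of_nonneg (integral_nonneg fun ω => by positivity)]
          have h3 : (∫ ω, ‖K σ τ ω‖ ^ 2 ∂area) ≤ ∫ _ : S2, (b + C) ^ 2 ∂area :=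
            integral_mono_of_nonneg (Eventually.of_forall fun ω => by positivity)
              (integrable_const _) (Eventually.of_forall fun ω =>
                pow_le_pow_left₀ (norm_nonneg _) (hKb σ τ ω h1 hτ') 2)
          rwa [integral_const, smul_eq_mul] at h3
        · have hσ1 : 1 ≤ σ := (le_max_right _ _).trans h1
          exact (hD σ τ h2 hτ').trans ((div_le_div_of_nonneg_right (le_abs_self D)
            (Real.sqrt_nonneg σ)).trans (hsq σ hσ1 _ (abs_nonneg D)))
      · refine Eventually.of_forall fun τ hτ => ?_
        rw [Set.uIoc_of_le hT] at hτ
        have hτ' := habs τ hτ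
        have h1 : Tendsto (fun σ => ∫ ω, ‖K σ τ ω‖ ^ 2 ∂area) atTop (𝓝 (H τ)) := by
          refine tendsto_integral_filter_of_dominated_convergence (fun _ => (b + C) ^ 2)
            (Eventually.of_forall fun σ => Continuous.aestronglyMeasurable ?_) ?_
            (integrable_const _) (Eventually.of_forall fun ω => ((hpt τ ω).norm.pow 2))
          · exact ((hKc σ).comp (f := fun ω : S2 => (τ, ω)) (by fun_prop)).norm.pow 2
          · filter_upwards [eventually_ge_atTop (max σ₀ 1)] with σ h1
            refine Eventually.of_forall fun ω => ?_
            rw [Real.norm_of_nonneg (by positivity)]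
            exact pow_le_pow_left₀ (norm_nonneg _) (hKb σ τ ω h1 hτ') 2
        have h2 : Tendsto (fun σ => W σ τ) atTop (𝓝 0) := by
          refine squeeze_zero_norm' ?_ (tendsto_div_sqrt D)
          filter_upwards [eventually_ge_atTop σ₁] with σ h2 using hD σ τ h2 hτ'
        simpa using h1.add h2
    refine (hlim.const_mul 2).congr fun σ => ?_
    have h1 := intervalIntegral.integral_eq_sub_of_hasDerivAt (a := a) (b := T)
      (fun τ _ => hA σ τ)
      (Continuous.intervalIntegrable (continuous_const.mul ((hkc σ).add (hWc σ))) _ _)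
    rw [intervalIntegral.integral_const_mul] at h1
    linarith
  have hbd : ∀ T, a ≤ T → ∫ τ in a..T, H τ ≤ 2 * B := fun T hT => by
    have := le_of_tendsto' (hflux T hT) fun σ => mul_le_mul_of_nonneg_left (hB σ T) zero_le_four
    linarith
  have hIic : ∀ T, ∫ τ in Set.Iic T, H τ = ∫ τ in Set.Ioc a T, H τ := fun T => by
    refine setIntegral_eq_of_subset_of_forall_sdiff_eq_zero measurableSet_Iic
      Set.Ioc_subset_Iic_self fun τ hτ => hHz τ ?_
    by_contra! h1
    exact hτ.2 ⟨h1, hτ.1⟩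
  have hHi : Integrable H := by
    refine integrable_of_intervalIntegral_norm_bounded (l := atTop) (a := fun n : ℝ => -n)
      (b := fun n : ℝ => n) (2 * B) (fun n => (hHc.integrableOn_Ioc)) tendsto_neg_atTop_atBot
      tendsto_id ?_
    filter_upwards [eventually_ge_atTop (max |a| 0)] with n hn
    have hn1 := abs_le.1 ((le_max_left _ _).trans hn)
    simp only [Real.norm_of_nonneg (hH0 _)]
    rw [← intervalIntegral.integral_add_adjacent_intervals (b := a)
      (hHc.intervalIntegrable _ _) (hHc.intervalIntegrable _ _)]
    have h1 : ∫ τ in -n..a, H τ = 0 := by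
      rw [intervalIntegral.integral_congr (g := fun _ => (0 : ℝ)),
        intervalIntegral.integral_zero]
      intro τ hτ
      rw [Set.uIcc_of_le hn1.1] at hτ
      exact hHz τ hτ.2
    rw [h1, zero_add]
    exact hbd n hn1.2
  have hbF : ∀ T, boundaryFlux h T = 2 * ∫ τ in Set.Iic T, H τ := fun T => rfl
  refine ⟨h, hjoint, ?_, ⟨2 * ∫ τ, H τ, ?_⟩, fun T hT => ?_⟩
  · have hm : Continuous fun p : ℝ × S2 => ‖h p.1 p.2‖ ^ 2 := hc.norm.pow 2
    rw [integrable_prod_iff hm.aestronglyMeasurable]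
    refine ⟨Eventually.of_forall fun τ => integrable_sphere
      ((hc.comp (f := fun ω : S2 => (τ, ω)) (by fun_prop)).norm.pow 2), ?_⟩
    simpa only [norm_pow, norm_norm] using hHi
  · simp only [funext hbF]
    exact ((aecover_Iic tendsto_id).integral_tendsto_of_countably_generated hHi).const_mul 2
  · rw [hbF, hIic, ← intervalIntegral.integral_of_le hT]
    exact hflux T hT

end Convergent

/-! ### Traces of solutions on the horizon and on null infinity -/

/-- The decay of the weights as `σ → ∞` with `τ` bounded, for null coordinates `σ` and `τ`. -/
theorem exists_weight_decay {M : ℝ} (hM : 0 < M) : ∃ C, 0 ≤ C ∧ ∀ T : ℝ, ∃ σ₀ : ℝ, 0 < σ₀ ∧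
    ∀ σ τ t x : ℝ, σ₀ ≤ σ → |τ| ≤ T → |t| = |σ + τ| / 2 → |x| = |σ - τ| / 2 →
      √(1 + |t|) * V₁ M x ≤ C / (σ * √σ) ∧ (1 + |t|) * V₁ M x ≤ C / √σ := by
  obtain ⟨C, hC, hV⟩ := sq_abs_mul_V₁_le hM
  refine ⟨32 * C, by positivity, fun T => ⟨2 * |T| + 1, by positivity,
    -- For `σ ≥ 2|T| + 1` one has `|x| ≥ σ/4` and `1 + |t| ≤ 2σ`, so `V₁ ≤ 16C/σ²`. The two products
    -- then give 32.
    fun σ τ t x hσ hτ ht hx => ?_⟩⟩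
  have hT := hτ.trans (le_abs_self T)
  have hT0 := abs_nonneg T
  obtain ⟨h1, h2⟩ := abs_le.1 hT
  have hσ1 : 1 ≤ σ := by linarith
  have hσ0 : 0 < σ := by linarith
  rw [abs_of_nonneg (by linarith : 0 ≤ σ + τ)] at ht
  rw [abs_of_nonneg (by linarith : 0 ≤ σ - τ)] at hx
  have ht' : 1 + |t| ≤ 2 * σ := by linarith
  have hs : √σ ^ 2 = σ := Real.sq_sqrt hσ0.le
  have hs1 : 1 ≤ √σ := Real.one_le_sqrt.2 hσ1
  have hs0 : 0 < √σ := by linarith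
  have hV' : V₁ M x ≤ 16 * C / σ ^ 2 := by
    refine (hV x).trans ?_
    rw [div_le_div_iff₀ (by positivity) (by positivity)]
    have h3 : σ / 4 ≤ 1 + |x| := by linarith
    have h4 := pow_le_pow_left₀ (by positivity) h3 2
    have h5 := mul_le_mul_of_nonneg_left h4 (by positivity : 0 ≤ 16 * C)
    linarith
  have hV0 := (V₁_pos hM x).le
  constructor
  · have h3 : √(1 + |t|) ≤ 2 * √σ := by
      rw [Real.sqrt_le_left (by positivity), mul_pow, hs]
      linarith
    refine (mul_le_mul h3 hV' hV0 (by positivity)).trans_eq ?_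
    have h4 : σ ^ 2 = σ * √σ ^ 2 := by rw [hs, pow_two]
    rw [h4]
    field_simp
    norm_num
  · refine (mul_le_mul ht' hV' hV0 (by positivity)).trans ?_
    have h4 : 2 * σ * (16 * C / σ ^ 2) = 32 * C / σ := by
      field_simp
      norm_num
    rw [h4]
    refine div_le_div_of_nonneg_left (by positivity) hs0 ?_
    nlinarith

/-- The derivative along the null vector `∂_t + ε ∂_{r_*}`, for `ε = ± 1`. -/
def nullD (ε : ℝ) (G : Pt → E3) (p : Pt) : E3 := D et G p + ε • D ex G p

theorem Sm.nullD {G : Pt → E3} (hG : Sm G) (ε : ℝ) : Sm (nullD ε G) :=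
  (hG.D et).add ((Sm.const ε).smul (hG.D ex))

/-- The point of the `(t, r_*)` plane with null coordinates `t - ε r_* = σ` and `t + ε r_* = τ`. -/
def nullPt (ε σ τ : ℝ) : ℝ × ℝ := ((σ + τ) / 2, ε * ((τ - σ) / 2))

/-- The derivative of a field along `∂_t + ε ∂_{r_*}`, in null coordinates. -/
def nullField (ε : ℝ) (G : Pt → E3) (σ τ : ℝ) (ω : S2) : E3 :=
  nullD ε G ((nullPt ε σ τ).1, (nullPt ε σ τ).2, ω)

section

variable {M R₀ : ℝ} (hM : 0 < M) (hR : 0 ≤ R₀) {ε : ℝ} (hε : |ε| = 1) {G : Pt → E3}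
  (hW : Wave M G) (hG : Vanish R₀ G)

include hε in
theorem abs_nullPt_snd (σ τ : ℝ) : |(nullPt ε σ τ).2| = |σ - τ| / 2 := by
  rw [nullPt, abs_mul, hε, one_mul, abs_div, abs_two, abs_sub_comm]

theorem abs_nullPt_fst (ε σ τ : ℝ) : |(nullPt ε σ τ).1| = |σ + τ| / 2 := by
  rw [nullPt, abs_div, abs_two]

theorem continuous_nullPt (ε : ℝ) : Continuous fun p : ℝ × ℝ => nullPt ε p.1 p.2 := by
  unfold nullPt
  fun_prop

include hε in
-- Moving `σ` differentiates along half the opposite null vector, so the two null derivatives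
-- compose to half of `∂_t² - ∂_{r_*}²`.
theorem hasDerivAt_nullField (hs : Sm G) (σ τ : ℝ) (ω : S2) :
    HasDerivAt (fun σ => nullField ε G σ τ ω)
      ((1 / 2 : ℝ) • (D et (D et G) ((nullPt ε σ τ).1, (nullPt ε σ τ).2, ω)
        - D ex (D ex G) ((nullPt ε σ τ).1, (nullPt ε σ τ).2, ω))) σ := by
  set p : Pt := ((nullPt ε σ τ).1, (nullPt ε σ τ).2, (ω : E3)) with hp'
  have hp : p ∈ offAxis := mem_offAxis _ _ ω
  have hε2 : ε * ε = 1 := by rw [← abs_mul_abs_self, hε, one_mul]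
  have h1 := HasFDerivAt.comp_hasDerivAt
    (f := fun σ => (((nullPt ε σ τ).1, (nullPt ε σ τ).2, (ω : E3)) : Pt)) σ
    ((hs.nullD ε).differentiableAt hp).hasFDerivAt
    ((((hasDerivAt_id σ).add_const τ).div_const 2).prodMk
      (((((hasDerivAt_id σ).const_sub τ).div_const 2).const_mul ε).prodMk
        (hasDerivAt_const σ (ω : E3))))
  refine h1.congr_deriv ?_
  have h2 : ((1 / 2, ε * (-1 / 2), 0) : Pt) = (1 / 2 : ℝ) • et + (-ε / 2) • ex := by
    simp only [Prod.smul_mk, smul_zero, Prod.mk_add_mk, smul_eq_mul, add_zero, mul_one, mul_zero,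
      zero_add]
    congr 2
    ring
  have h3 : ∀ w, D w (nullD ε G) p = D w (D et G) p + ε • D w (D ex G) p := fun w => by
    unfold nullD
    rw [D_add (hs.D _) ((Sm.const ε).smul (hs.D _)) _ hp, D_smul (Sm.const ε) (hs.D _) _ hp,
      D_const, zero_smul, add_zero]
  change D (1 / 2, ε * (-1 / 2), 0) (nullD ε G) p = _
  rw [h2, D_lin, h3, h3, D_comm hs ex et hp]
  have h4 : ∀ a b c : E3, (1 / 2 : ℝ) • (a + ε • b) + (-ε / 2) • (b + ε • c)
      = (1 / 2 : ℝ) • (a - c) := fun a b c => by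
    have e1 : (-ε / 2) * ε = -(1 / 2 : ℝ) := by linear_combination (-1 / 2 : ℝ) * hε2
    rw [smul_add, smul_add, smul_smul, smul_smul, e1, smul_sub]
    module
  exact h4 _ _ _

include hM hR hε hW hG

/-- The equation exchanges this transverse derivative for `V₁` times quantities of size `√(1 +
|t|)`; together they decay like `σ^(-3/2)`. -/
theorem convergent_nullField : Convergent (nullField ε G) where
  continuous := (hW.smooth.nullD ε).continuous_sphere.comp
    (f := fun p : ℝ × ℝ × S2 => (nullPt ε p.1 p.2.1, p.2.2))
    (((continuous_nullPt ε).comp (by fun_prop : Continuous fun p : ℝ × ℝ × S2 =>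
      (p.1, p.2.1))).prodMk (by fun_prop))
  decay := by
    obtain ⟨C, hC, hb⟩ := hW.exists_norm_sub_le hM hR hG
    obtain ⟨C', hC', hw⟩ := exists_weight_decay hM
    refine ⟨_, hasDerivAt_nullField hε hW.smooth, fun T => ?_⟩
    obtain ⟨σ₀, h0, h⟩ := hw T
    refine ⟨C * C', σ₀, h0, by positivity, fun σ τ ω hσ hτ => ?_⟩
    have h1 := (h σ τ _ _ hσ hτ (abs_nullPt_fst ε σ τ) (abs_nullPt_snd hε σ τ)).1
    have h2 := hb (nullPt ε σ τ).1 (nullPt ε σ τ).2 ω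
    rw [norm_smul, Real.norm_of_nonneg (by norm_num), mul_div_assoc]
    have h3 := mul_le_mul_of_nonneg_left h1 hC
    have h4 := norm_nonneg (D et (D et G) ((nullPt ε σ τ).1, (nullPt ε σ τ).2, (ω : E3))
      - D ex (D ex G) ((nullPt ε σ τ).1, (nullPt ε σ τ).2, (ω : E3)))
    linarith

/-- The potential part of the energy density. -/
def Profile.pot (P : Profile M) (z : ℝ × ℝ) : ℝ := V₁ M z.2 * P.qy z + V₃ M z.2 * P.q0 z

omit hM hR hε hW hG in
theorem Profile.continuous_pot (hM : 0 < M) (P : Profile M) : Continuous P.pot := by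
  have h1 := (contDiff_V₁ hM 0).continuous
  have h3 := (contDiff_V₃ hM 0).continuous
  have := P.contDiff_qy.continuous
  have := P.contDiff_q0.continuous
  unfold Profile.pot
  fun_prop

omit hM hR hG in
theorem integral_normSq_nullD (z : ℝ × ℝ) :
    ∫ ω : S2, ‖nullD ε G (z.1, z.2, ω)‖ ^ 2 ∂area
      = hW.profile.qt z + 2 * ε * hW.profile.m z + hW.profile.qx z := by
  have hε2 : ε * ε = 1 := by rw [← abs_mul_abs_self, hε, one_mul]
  have hs := hW.smooth
  have h1 : ∀ ω : S2, ‖nullD ε G (z.1, z.2, (ω : E3))‖ ^ 2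
      = inner ℝ (D et G (z.1, z.2, (ω : E3))) (D et G (z.1, z.2, (ω : E3)))
        + 2 * ε * inner ℝ (D et G (z.1, z.2, (ω : E3))) (D ex G (z.1, z.2, (ω : E3)))
        + inner ℝ (D ex G (z.1, z.2, (ω : E3))) (D ex G (z.1, z.2, (ω : E3))) := fun ω => by
    rw [nullD, norm_add_sq_real, inner_smul_right, norm_smul, mul_pow, Real.norm_eq_abs, sq_abs,
      real_inner_self_eq_norm_sq, real_inner_self_eq_norm_sq, pow_two ε, hε2]
    ring
  simp only [h1]
  rw [integral_add, integral_add, integral_const_mul]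
  · rfl
  · exact ((hs.D _).inner (hs.D _)).integrable _ _
  · exact (((hs.D _).inner (hs.D _)).integrable _ _).const_mul _
  · exact (((hs.D _).inner (hs.D _)).integrable _ _).add
      ((((hs.D _).inner (hs.D _)).integrable _ _).const_mul _)
  · exact ((hs.D _).inner (hs.D _)).integrable _ _

omit hR hG hM in
-- Along a null line `dE` combines `e` and `2m` into the square of the null derivative plus the
-- potential part. The sign `ε` makes the flux nonnegative in both directions.
theorem hasDerivAt_nullPotential {E : ℝ × ℝ → ℝ} (hE : hW.profile.IsPotential E) (σ τ : ℝ) :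
    HasDerivAt (fun τ => ε * E (nullPt ε σ τ)) (1 / 2 * ((∫ ω, ‖nullField ε G σ τ ω‖ ^ 2 ∂area)
      + hW.profile.pot (nullPt ε σ τ))) τ := by
  have hε2 : ε * ε = 1 := by rw [← abs_mul_abs_self, hε, one_mul]
  have h1 := (hE.hasDerivAt_comp (((hasDerivAt_id τ).const_add σ).div_const 2)
    ((((hasDerivAt_id τ).sub_const σ).div_const 2).const_mul ε)).const_mul ε
  refine h1.congr_deriv ?_
  have h2 := integral_normSq_nullD hε hW (nullPt ε σ τ)
  unfold nullField
  rw [h2]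
  simp only [id]
  change ε * (2 * hW.profile.m (nullPt ε σ τ) * (1 / 2)
    + hW.profile.e (nullPt ε σ τ) * (ε * (1 / 2))) = _
  unfold Profile.e Profile.pot
  linear_combination (1 / 2 * (hW.profile.qt (nullPt ε σ τ) + hW.profile.qx (nullPt ε σ τ)
    + V₁ M (nullPt ε σ τ).2 * hW.profile.qy (nullPt ε σ τ)
    + V₃ M (nullPt ε σ τ).2 * hW.profile.q0 (nullPt ε σ τ))) * hε2

theorem exists_pot_decay (T : ℝ) : ∃ C σ₀ : ℝ, ∀ σ τ, σ₀ ≤ σ → |τ| ≤ T →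
    |hW.profile.pot (nullPt ε σ τ)| ≤ C / √σ := by
  obtain ⟨C, hC, hb⟩ := hW.exists_dyip_le hM hR hG
  obtain ⟨C', hC', hw⟩ := exists_weight_decay hM
  obtain ⟨σ₀, h0, h⟩ := hw T
  refine ⟨2 * C * C', σ₀, fun σ τ hσ hτ => ?_⟩
  have h1 := (h σ τ _ _ hσ hτ (abs_nullPt_fst ε σ τ) (abs_nullPt_snd hε σ τ)).2
  set z := nullPt ε σ τ with hz
  have h2 : hW.profile.qy z ≤ C * (1 + |z.1|) := hb z.1 z.2
  have h3 := hW.profile.q0_le_qy z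
  have h4 := hW.profile.q0_nonneg z
  have v1 := (V₁_pos hM z.2).le
  have v3 := (V₃_pos hM z.2).le
  have h5 := hW.profile.qy_nonneg z
  have hR1 := two_mul_R_lt_one hM z.2
  have v13 : V₃ M z.2 ≤ V₁ M z.2 := by
    have h6 : V₃ M z.2 = V₁ M z.2 * (2 * M * R M z.2) := by
      unfold V₁ V₃
      ring
    rw [h6]
    exact mul_le_of_le_one_right v1 hR1.le
  rw [Profile.pot, abs_of_nonneg (add_nonneg (mul_nonneg v1 h5) (mul_nonneg v3 h4))]
  have h7 := mul_le_mul v13 h3 h4 v1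
  have h8 := mul_le_mul_of_nonneg_left h2 v1
  have h9 := mul_le_mul_of_nonneg_left h1 (by positivity : 0 ≤ 2 * C)
  rw [mul_div_assoc]
  linarith

/-- The trace of `∂_t G + ε ∂_{r_*} G`, and the energy radiated through the boundary. -/
theorem Wave.exists_trace {E : ℝ × ℝ → ℝ} (hE : hW.profile.IsPotential E) :
    ∃ h : ℝ → S2 → E3, (∀ τ ω, Tendsto (fun p : ℝ × ℝ × S2 => nullField ε G p.1 p.2.1 p.2.2)
        (atTop ×ˢ 𝓝 (τ, ω)) (𝓝 (h τ ω))) ∧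
      Integrable (fun p : ℝ × S2 => ‖h p.1 p.2‖ ^ 2) ((volume : Measure ℝ).prod area) ∧
      (∃ e, Tendsto (boundaryFlux h) atTop (𝓝 e)) ∧
      ∀ T, -(R₀ + 1) ≤ T → Tendsto (fun σ => 4 * (ε * E (nullPt ε σ T)
        - ε * E (nullPt ε σ (-(R₀ + 1))))) atTop (𝓝 (boundaryFlux h T)) := by
  have h0 : ∀ x, R₀ + 1 ≤ |x| → hW.profile.e (0, x) = 0 := fun x hx =>
    hG.e_profile hW (by simp; linarith)
  have hI := hE.mem_Icc hM h0
  refine (convergent_nullField hM hR hε hW hG).exists_trace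
    (A := fun σ τ => ε * E (nullPt ε σ τ)) (W := fun σ τ => hW.profile.pot (nullPt ε σ τ))
    (a := -(R₀ + 1)) (B := E (0, R₀ + 1) - E (0, -(R₀ + 1))) (fun τ ω hτ => ?_) (fun σ => ?_)
    (exists_pot_decay hM hR hε hW hG) (hasDerivAt_nullPotential hε hW hE) fun σ τ => ?_
  -- Here `|r_*| - |t| = -τ ≥ R₀ + 1`, so the point lies outside the domain of influence.
  · filter_upwards [eventually_ge_atTop (-τ)] with σ hσ
    have h1 : R₀ + |(nullPt ε σ τ).1| < |(nullPt ε σ τ).2| := by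
      rw [abs_nullPt_fst, abs_nullPt_snd hε, abs_of_nonneg (by linarith),
        abs_of_nonneg (by linarith)]
      linarith
    rw [nullField, nullD, hG.D _ _ (mem_offAxis _ _ ω) h1, hG.D _ _ (mem_offAxis _ _ ω) h1,
      smul_zero, add_zero]
  · exact (hW.profile.continuous_pot hM).comp ((continuous_nullPt ε).comp
      (f := fun τ : ℝ => (σ, τ)) (by fun_prop))
  · obtain ⟨a1, a2⟩ := hI (nullPt ε σ τ)
    obtain ⟨b1, b2⟩ := hI (nullPt ε σ (-(R₀ + 1)))
    rw [← mul_sub]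
    refine (le_abs_self _).trans ?_
    rw [abs_mul, hε, one_mul, abs_le]
    constructor <;> linarith

end

/-! ### Energies in terms of the potential -/

/-- A function of `(t, r_*)` at the point with `t - r_* = u` and `t + r_* = v`. -/
def nullE (E : ℝ × ℝ → ℝ) (u v : ℝ) : ℝ := E ((u + v) / 2, (v - u) / 2)

theorem apply_nullPt_one (E : ℝ × ℝ → ℝ) (u v : ℝ) : E (nullPt 1 u v) = nullE E u v := by
  simp [nullPt, nullE]

theorem apply_nullPt_neg_one (E : ℝ × ℝ → ℝ) (u v : ℝ) : E (nullPt (-1) v u) = nullE E u v := by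
  rw [nullPt, nullE, add_comm v u]
  congr 2
  ring

namespace Profile.IsPotential

variable {M : ℝ} {P : Profile M} {E : ℝ × ℝ → ℝ} (hE : P.IsPotential E) (hM : 0 < M)
include hE hM

theorem monotone_nullE (u : ℝ) : Monotone (nullE E u) := fun v v' hv => by
  have h := hE.monotone_outgoing hM (u / 2) (-u / 2) (by linarith : v / 2 ≤ v' / 2)
  have e : ∀ v, E (u / 2 + v / 2, -u / 2 + v / 2) = nullE E u v := fun v => by
    rw [nullE]
    congr 2 <;> ring
  simp only [e] at h
  exact h

theorem antitone_nullE (v : ℝ) : Antitone fun u => nullE E u v := fun u u' hu => by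
  have h := hE.antitone_incoming hM (v / 2) (v / 2) (by linarith : u / 2 ≤ u' / 2)
  have e : ∀ u, E (v / 2 + u / 2, v / 2 - u / 2) = nullE E u v := fun u => by
    rw [nullE]
    congr 2 <;> ring
  simp only [e] at h
  exact h

variable {R₀ : ℝ} (h0 : ∀ x, R₀ ≤ |x| → P.e (0, x) = 0)
include h0

theorem nullE_right {u v : ℝ} (hu : u ≤ -R₀) (huv : -u ≤ v) : nullE E u v = E (0, R₀) :=
  hE.eq_right hM h0 (by
    rw [abs_of_nonneg (by linarith)]
    linarith)

theorem nullE_left {u v : ℝ} (hv : v ≤ -R₀) (huv : -v ≤ u) : nullE E u v = E (0, -R₀) :=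
  hE.eq_left hM h0 (by
    rw [abs_of_nonneg (by linarith)]
    linarith)

theorem integral_e_univ (hR : 0 ≤ R₀) : ∫ x, P.e (0, x) = E (0, R₀) - E (0, -R₀) := by
  rw [← hE.integral_e hM, intervalIntegral.integral_of_le (by linarith),
    ← integral_Icc_eq_integral_Ioc]
  refine (setIntegral_eq_integral_of_forall_compl_eq_zero fun x hx => h0 x ?_).symm
  by_contra! h
  exact hx ⟨(abs_lt.1 h).1.le, (abs_lt.1 h).2.le⟩

end Profile.IsPotential

/-! ### Energies and fluxes of a solution through the potential. -/

section

variable {M : ℝ} {Φ : Field} (hΦ : IsSolution M Φ)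
include hΦ

theorem IsSolution.potentialDensity_eq (t x : ℝ) (ω : S2) : potentialDensity M Φ t x ω
    = V₁ M x * (∑ i, inner ℝ (D (ey i) (extField Φ) (t, x, (ω : E3)))
        (D (ey i) (extField Φ) (t, x, (ω : E3))))
      + V₃ M x * inner ℝ (extField Φ (t, x, (ω : E3))) (extField Φ (t, x, (ω : E3))) := by
  simp only [real_inner_self_eq_norm_sq]
  rw [← hΦ.sphereGradSq_eq, extField_coe, potentialDensity, F_eq]
  unfold V₁ V₃
  ring

theorem IsSolution.integrable_potentialDensity (t x : ℝ) :
    Integrable (fun ω => potentialDensity M Φ t x ω) area := by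
  simp only [hΦ.potentialDensity_eq]
  exact (((sm_dyip hΦ.sm hΦ.sm).integrable t x).const_mul _).add
    (((hΦ.sm.inner hΦ.sm).integrable t x).const_mul _)

theorem IsSolution.integral_potentialDensity (t x : ℝ) :
    ∫ ω, potentialDensity M Φ t x ω ∂area = hΦ.wave.profile.pot (t, x) := by
  simp only [hΦ.potentialDensity_eq]
  rw [integral_add (((sm_dyip hΦ.sm hΦ.sm).integrable t x).const_mul _)
    (((hΦ.sm.inner hΦ.sm).integrable t x).const_mul _), integral_const_mul, integral_const_mul]
  rfl

theorem IsSolution.initialEnergy_eq : initialEnergy M Φ = 4 * ∫ x, hΦ.wave.profile.e (0, x) := by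
  unfold initialEnergy
  congr 2
  funext x
  have i1 := (((hΦ.sm.D et).inner (hΦ.sm.D et)).integrable 0 x)
  have i2 := (((hΦ.sm.D ex).inner (hΦ.sm.D ex)).integrable 0 x)
  have i3 : Integrable (fun ω : S2 =>
      inner ℝ (D et (extField Φ) (0, x, (ω : E3))) (D et (extField Φ) (0, x, (ω : E3)))
        + inner ℝ (D ex (extField Φ) (0, x, (ω : E3))) (D ex (extField Φ) (0, x, (ω : E3)))) area :=
    i1.add i2
  have h : ∀ ω, ‖Dt Φ 0 x ω‖ ^ 2 + ‖Dx Φ 0 x ω‖ ^ 2 + potentialDensity M Φ 0 x ω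
      = inner ℝ (D et (extField Φ) (0, x, (ω : E3))) (D et (extField Φ) (0, x, (ω : E3)))
        + inner ℝ (D ex (extField Φ) (0, x, (ω : E3))) (D ex (extField Φ) (0, x, (ω : E3)))
        + potentialDensity M Φ 0 x ω := fun ω => by
    rw [hΦ.Dt_eq, hΦ.Dx_eq, real_inner_self_eq_norm_sq, real_inner_self_eq_norm_sq]
  simp only [h]
  rw [integral_add i3 (hΦ.integrable_potentialDensity 0 x), integral_add i1 i2,
    hΦ.integral_potentialDensity, Profile.e, add_assoc _ (V₁ M _ * _)]
  rfl

variable {E : ℝ × ℝ → ℝ} (hE : hΦ.wave.profile.IsPotential E)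

theorem IsSolution.integral_flux_density {ε : ℝ} (t x : ℝ) :
    ∫ ω, (‖nullD ε (extField Φ) (t, x, ω)‖ ^ 2 + potentialDensity M Φ t x ω) ∂area
      = (∫ ω : S2, ‖nullD ε (extField Φ) (t, x, ω)‖ ^ 2 ∂area) + hΦ.wave.profile.pot (t, x) := by
  have hs : Continuous fun ω : S2 => ‖nullD ε (extField Φ) (t, x, (ω : E3))‖ ^ 2 :=
    ((hΦ.sm.nullD ε).continuous_sphere_right t x).norm.pow 2
  rw [integral_add (integrable_sphere hs)
    (hΦ.integrable_potentialDensity t x), hΦ.integral_potentialDensity]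

theorem IsSolution.atNull_DL (u v : ℝ) (ω : S2) :
    atNull (DL Φ) u v ω = nullField 1 (extField Φ) u v ω := by
  rw [atNull, hΦ.DL_eq, nullField, nullD, nullPt, one_smul, one_mul]

theorem IsSolution.atNull_DLbar (u v : ℝ) (ω : S2) :
    atNull (DLbar Φ) u v ω = nullField (-1) (extField Φ) v u ω := by
  have h : nullPt (-1) v u = ((u + v) / 2, (v - u) / 2) := by
    rw [nullPt, add_comm v u]
    congr 1
    ring
  rw [atNull, hΦ.DLbar_eq, nullField, h, nullD, neg_smul, one_smul, sub_eq_add_neg]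

include hE

theorem IsSolution.integral_flux (hM : 0 < M) {ε : ℝ} (hε : |ε| = 1) (σ a b : ℝ) :
    2 * ∫ τ in a..b, ((∫ ω, ‖nullField ε (extField Φ) σ τ ω‖ ^ 2 ∂area)
      + hΦ.wave.profile.pot (nullPt ε σ τ))
      = 4 * (ε * E (nullPt ε σ b) - ε * E (nullPt ε σ a)) := by
  have hn := (continuous_nullPt ε).comp (f := fun τ : ℝ => (σ, τ)) (by fun_prop)
  have h1 := intervalIntegral.integral_eq_sub_of_hasDerivAt (a := a) (b := b)
    (fun τ _ => hasDerivAt_nullPotential hε hΦ.wave hE σ τ) (by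
      refine Continuous.intervalIntegrable (continuous_const.mul (Continuous.add ?_ ?_)) _ _
      · refine continuous_integral_sphere (f := fun p : ℝ × S2 =>
          ‖nullField ε (extField Φ) σ p.1 p.2‖ ^ 2) (Continuous.pow (Continuous.norm ?_) 2)
        exact (hΦ.sm.nullD ε).continuous_sphere.comp
          (f := fun p : ℝ × S2 => (nullPt ε σ p.1, p.2))
          ((hn.comp continuous_fst).prodMk continuous_snd)
      · exact (hΦ.wave.profile.continuous_pot hM).comp hn)
  rw [intervalIntegral.integral_const_mul] at h1
  linarith

theorem IsSolution.outgoingFlux_eq (hM : 0 < M) (u v : ℝ) :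
    outgoingFlux M Φ u v = 4 * (nullE E u (2 * v) - nullE E u v) := by
  have h := hΦ.integral_flux hE hM (ε := 1) (by simp) u v (2 * v)
  simp only [apply_nullPt_one, one_mul] at h
  rw [← h, outgoingFlux]
  congr 2
  funext τ
  simp only [hΦ.atNull_DL]
  have h1 := hΦ.integral_flux_density (ε := 1) ((u + τ) / 2) ((τ - u) / 2)
  simp only [nullField, nullPt, one_mul, atNull]
  exact h1

theorem IsSolution.incomingFlux_eq (hM : 0 < M) (u v : ℝ) :
    incomingFlux M Φ u v = 4 * (nullE E u v - nullE E (2 * u) v) := by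
  have h := hΦ.integral_flux hE hM (ε := -1) (by simp) v u (2 * u)
  simp only [apply_nullPt_neg_one] at h
  have h' : 4 * (nullE E u v - nullE E (2 * u) v)
      = 4 * (-1 * nullE E (2 * u) v - -1 * nullE E u v) := by ring
  rw [h', ← h, incomingFlux]
  congr 2
  funext τ
  have hn : nullPt (-1) v τ = ((τ + v) / 2, (v - τ) / 2) := by
    rw [nullPt, add_comm v τ]
    congr 1
    ring
  simp only [hΦ.atNull_DLbar]
  simp only [nullField, hn, atNull]
  exact hΦ.integral_flux_density (ε := -1) ((τ + v) / 2) ((v - τ) / 2)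

theorem IsSolution.exists_nullE_sub_le (hM : 0 < M) {R₀ : ℝ} (hR : 0 ≤ R₀)
    (hV : Vanish R₀ (extField Φ)) : ∃ C, ∀ T U V : ℝ, 0 < U → 0 < V → U + V ≤ 2 * T →
      min U V * (nullE E U (2 * T - U) - nullE E (2 * T - V) V) ≤ C := by
  have hR1 : 0 ≤ R₀ + 1 := by linarith
  have h0 : ∀ {G : Pt → E3} (hW : Wave M G), Vanish R₀ G →
      ∀ x, R₀ + 1 ≤ |x| → hW.profile.e (0, x) = 0 := fun hW hG x hx =>
    hG.e_profile hW (by simp; linarith)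
  have hWt := hΦ.wave.D_t hM
  obtain ⟨E', hE'⟩ := hWt.profile.exists_potential hM
  -- The required bound on the `qt` term of `Φ` is the Morawetz bound on the `q0` term of `∂_t Φ`,
  -- which is again a solution.
  obtain ⟨C, hC⟩ := Profile.energy_between_cones_le hM hE hR1 (h0 hΦ.wave hV)
    fun T hT => Profile.integral_decayWeight_q0_le hM hE' hR1 (h0 hWt (hV.D et)) hT
  refine ⟨C, fun T U V hU hV hT => ?_⟩
  convert hC T U V hU hV hT using 3
  · unfold nullE
    congr 2 <;> ring
  · unfold nullE
    congr 2 <;> ring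

end

/-! ### The main result -/

/-- Energy conservation between the initial hypersurface and the boundary at infinity. -/
theorem IsSolution.exists_traces {M : ℝ} (hM : 0 < M) {Φ : Field} (hΦ : IsSolution M Φ)
    (hdata : HasCompactData Φ) :
    ∃ h s : ℝ → S2 → E3,
      IsHorizonTrace (DL Φ) h ∧
      IsScriTrace (DLbar Φ) s ∧
      Integrable (fun p : ℝ × S2 => ‖h p.1 p.2‖ ^ 2)
        ((volume : Measure ℝ).prod area) ∧
      Integrable (fun p : ℝ × S2 => ‖s p.1 p.2‖ ^ 2)
        ((volume : Measure ℝ).prod area) ∧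
      ∃ EH EI : ℝ,
        Tendsto (boundaryFlux h) atTop (𝓝 EH) ∧
        Tendsto (boundaryFlux s) atTop (𝓝 EI) ∧
        EI + EH ≤ initialEnergy M Φ ∧
        (EI + EH = initialEnergy M Φ ↔
          Tendsto (fun p : ℝ × ℝ => outgoingFlux M Φ p.1 p.2
            + incomingFlux M Φ p.1 p.2) (atTop ×ˢ atTop) (𝓝 0)) := by
  obtain ⟨R₀, hR, hV⟩ := hΦ.exists_vanish hM hdata
  obtain ⟨E, hE⟩ := hΦ.wave.profile.exists_potential hM
  replace hE : hΦ.wave.profile.IsPotential E := hE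
  have h0 : ∀ x, R₀ + 1 ≤ |x| → hΦ.wave.profile.e (0, x) = 0 := fun x hx =>
    hV.e_profile hΦ.wave (by simp; linarith)
  obtain ⟨h, h1, h2, ⟨EH, h3⟩, h4⟩ := hΦ.wave.exists_trace hM hR (ε := 1) (by simp) hV hE
  obtain ⟨s, s1, s2, ⟨EI, s3⟩, s4⟩ := hΦ.wave.exists_trace hM hR (ε := -1) (by simp) hV hE
  obtain ⟨C, hC⟩ := hΦ.exists_nullE_sub_le hE hM hR hV
  have hC0 : 0 ≤ C := by
    refine le_trans (mul_nonneg (by norm_num) (sub_nonneg.2 ?_)) (hC 1 1 1 one_pos one_pos (by norm_num))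
    norm_num
  have mono := hE.monotone_nullE hM
  have anti := hE.antitone_nullE hM
  set cp := E (0, R₀ + 1) with hcp
  set cm := E (0, -(R₀ + 1)) with hcm
  have hinit : initialEnergy M Φ = 4 * (cp - cm) := by
    rw [hΦ.initialEnergy_eq, hE.integral_e_univ hM h0 (by linarith)]
  -- the sum of the fluxes through the boundary
  have hsum : ∀ T, 0 ≤ T → Tendsto (fun σ => 4 * (cp - cm) - 4 * (nullE E T σ - nullE E σ T)) atTop
      (𝓝 (boundaryFlux s T + boundaryFlux h T)) := fun T hT => by
    refine ((s4 T (by linarith)).add (h4 T (by linarith))).congr' ?_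
    filter_upwards [eventually_ge_atTop (R₀ + 1)] with σ hσ
    simp only [apply_nullPt_one, apply_nullPt_neg_one]
    rw [hE.nullE_right hM h0 le_rfl (by linarith), hE.nullE_left hM h0 le_rfl (by linarith)]
    ring
  have hupper : EI + EH ≤ 4 * (cp - cm) := by
    refine le_of_tendsto (s3.add h3) ?_
    filter_upwards [eventually_ge_atTop 0] with T hT
    refine le_of_tendsto (hsum T hT) ?_
    filter_upwards [eventually_ge_atTop T] with σ hσ
    have a1 := mono T hσ
    have a2 := anti T hσ
    simp only at a2
    linarith
  -- The energy that has not crossed the boundary before retarded and advanced time `T` is at most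
  -- `4C/T`. The null lines are prolonged to `2σ - T` so that their ends lie on the slice `t = σ`.
  have hlower : 4 * (cp - cm) ≤ EI + EH := by
    have hz : Tendsto (fun T => 4 * (cp - cm) - 4 * (C / T)) atTop (𝓝 (4 * (cp - cm))) := by
      have := ((tendsto_const_nhds (x := C)).div_atTop tendsto_id (l := atTop)).const_mul 4
      simpa using this.const_sub (4 * (cp - cm))
    refine le_of_tendsto_of_tendsto hz (s3.add h3) ?_
    filter_upwards [eventually_gt_atTop 0] with T hT
    refine ge_of_tendsto (hsum T hT.le) ?_
    filter_upwards [eventually_ge_atTop T] with σ hσ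
    have a0 := hC σ T T hT hT (by linarith)
    rw [min_self, ← le_div_iff₀' hT] at a0
    have a1 := mono T (by linarith : σ ≤ 2 * σ - T)
    have a2 := anti T (by linarith : σ ≤ 2 * σ - T)
    simp only at a2
    linarith
  refine ⟨h, s, fun v ω => ?_, fun u ω => ?_, h2, s2, EH, EI, h3, s3, ?_, ?_⟩
  · simp only [hΦ.atNull_DL]
    exact h1 v ω
  · simp only [hΦ.atNull_DLbar]
    exact s1 u ω
  · rw [hinit]
    exact hupper
  -- Neither implication uses its premise: equality was just proved, and the fluxes tend to zero by
  -- the decay between cones.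
  · refine ⟨fun _ => ?_, fun _ => by rw [hinit]; exact le_antisymm hupper hlower⟩
    have hz : Tendsto (fun p : ℝ × ℝ => 4 * (C / p.1) + 4 * (C / p.2)) (atTop ×ˢ atTop) (𝓝 0) := by
      have := ((tendsto_const_nhds (x := C)).div_atTop tendsto_id (l := atTop)).const_mul 4
      simpa using (this.comp tendsto_fst).add (this.comp tendsto_snd)
    refine squeeze_zero' ?_ ?_ hz
    · filter_upwards [(eventually_ge_atTop (0 : ℝ)).prod_mk (eventually_ge_atTop (0 : ℝ))]
        with p hp
      rw [hΦ.outgoingFlux_eq hE hM, hΦ.incomingFlux_eq hE hM]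
      have a1 := mono p.1 (by linarith [hp.2] : p.2 ≤ 2 * p.2)
      have a2 := anti p.2 (by linarith [hp.1] : p.1 ≤ 2 * p.1)
      simp only at a2
      linarith
    · filter_upwards [(eventually_gt_atTop (0 : ℝ)).prod_mk (eventually_gt_atTop (0 : ℝ))]
        with p hp
      obtain ⟨hu, hv⟩ := hp
      rw [hΦ.outgoingFlux_eq hE hM, hΦ.incomingFlux_eq hE hM]
      -- The common corner of the two null segments cancels in the sum. At time `u + v` the slice
      -- meets the cones beyond their other ends, at advanced time `u + 2v ≥ 2v` and retarded time
      -- `2u + v ≥ 2u`.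
      have a0 := hC (p.1 + p.2) p.1 p.2 hu hv (by linarith)
      have a1 := mono p.1 (by linarith : 2 * p.2 ≤ 2 * (p.1 + p.2) - p.1)
      have a2 := anti p.2 (by linarith : 2 * p.1 ≤ 2 * (p.1 + p.2) - p.2)
      simp only at a2
      rw [← le_div_iff₀' (lt_min hu hv)] at a0
      have a3 : C / min p.1 p.2 ≤ C / p.1 + C / p.2 := by
        have b1 : 0 ≤ C / p.1 := by positivity
        have b2 : 0 ≤ C / p.2 := by positivity
        rcases min_choice p.1 p.2 with e | e <;> rw [e] <;> linarith
      linarith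

end Schwarzschild
end


theorem mainTheorem6 (M : ℝ) (hM : 0 < M) (Φ : Schwarzschild.Field)
    (hΦ : Schwarzschild.IsSolution M Φ) (hdata : Schwarzschild.HasCompactData Φ) :
    ∃ h s : ℝ → Schwarzschild.S2 → Schwarzschild.E3,
      Schwarzschild.IsHorizonTrace (Schwarzschild.DL Φ) h ∧
      Schwarzschild.IsScriTrace (Schwarzschild.DLbar Φ) s ∧
      Integrable (fun p : ℝ × Schwarzschild.S2 => ‖h p.1 p.2‖ ^ 2)
        ((volume : Measure ℝ).prod Schwarzschild.area) ∧
      Integrable (fun p : ℝ × Schwarzschild.S2 => ‖s p.1 p.2‖ ^ 2)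
        ((volume : Measure ℝ).prod Schwarzschild.area) ∧
      ∃ EH EI : ℝ,
        Tendsto (Schwarzschild.boundaryFlux h) atTop (𝓝 EH) ∧
        Tendsto (Schwarzschild.boundaryFlux s) atTop (𝓝 EI) ∧
        EI + EH ≤ Schwarzschild.initialEnergy M Φ ∧
        (EI + EH = Schwarzschild.initialEnergy M Φ ↔
          Tendsto (fun p : ℝ × ℝ => Schwarzschild.outgoingFlux M Φ p.1 p.2
            + Schwarzschild.incomingFlux M Φ p.1 p.2) (atTop ×ˢ atTop) (𝓝 0)) :=
  hΦ.exists_traces hM hdata
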